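/- Let $k$ be an algebraically closed field and let $[x:y:z]$ be homogeneous coordinates on $\mathbb P^2=\mathbb P^2_k$, with line at infinity $L_\infty:\ z=0$ and origin $A=[0:0:1]$. Let $B:\ F=0$ be a smooth conic with center $A$ (that is, the polar line of $A$ with respect to $B$ is $L_\infty$), let $B\cap L_\infty=\{P_1,P_2\}$, and let $\ell_1,\ell_2$ be linear equations of the lines $L_1=AP_1$, $L_2=AP_2$ (these are the tangents to $B$ through $A$). Let $W\subset\mathbb P^2\times\mathbb P^2$ be the incidence surface, with bihomogeneous ideal $\bigl(F(zX-xZ,\,zY-yZ,\,zZ),\ xY-yX\bigr)$ in the coordinates $[x:y:z;\,X:Y:Z]$, and let $\pi_1,\pi_2:W\to\mathbb P^2$ be its projections. The conchoid of a plane curve $C$ with respect to $B$ is the effective divisor $\mathcal C_B(C)=(\pi_2)_*(\pi_1^*(C))$, and the proper conchoid $\mathcal C^p_B(C)$ is obtained from it by removing the components $B$, $L_1$, $L_2$ with their multiplicities. **Theorem.** Let $C$ be a reduced and irreducible curve of degree $\delta$ with equation $G(x,y,z)=0$. Assume that the characteristic of $k$ is $0$ or larger than both $2$ and $\delta$, and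 that $C$ is neither $B$ nor the image $B_2:\ F(x,y,2z)=0$ of $B$ under the homothety of center $A$ and ratio $2$. Consider the condition $(*)$ there are homogeneous polynomials $H_1,H_2\in k[x,y,z]$ (possibly zero) such that $G=H_1^2-\ell_1\ell_2H_2^2$ if $\delta$ is even, or $G=\ell_1H_1^2-\ell_2H_2^2$ if $\delta$ is odd. 1. If $C$ is none of the three lines $L_1$, $L_2$, $L_\infty$, then $\mathcal C^p_B(C)$ is reducible, in the sense that it is the sum of two nonzero effective divisors, if and only if $(*)$ holds. 2. If $C$ is not a line through $A$, then $\mathcal C^p_B(C)$ has at least two distinct irreducible components if and only if $(*)$ holds. -/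

import Mathlib

open MvPolynomial

namespace Conchoid

noncomputable section

/-- The projective plane over `k`, with homogeneous coordinates `[x : y : z]`
indexed by `0, 1, 2`; the line at infinity `L∞` is `z = 0`. -/
abbrev Plane (k : Type*) [Field k] : Type _ := Projectivization k (Fin 3 → k)

/-- Homogeneous coordinate ring of the plane. -/
abbrev PlaneRing (k : Type*) [Field k] : Type _ := MvPolynomial (Fin 3) k

/-- Bihomogeneous coordinate ring of the product of two planes: the variables `x, y, z` of the
first factor are `Sum.inl 0, 1, 2`, the variables `X, Y, Z` of the second factor are
`Sum.inr 0, 1, 2`. -/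
abbrev ProdRing (k : Type*) [Field k] : Type _ := MvPolynomial (Fin 3 ⊕ Fin 3) k

/-- Coordinates of the origin `A = [0 : 0 : 1]` of the affine plane `z ≠ 0`. -/
def origin (k : Type*) [Field k] : Fin 3 → k := ![0, 0, 1]

section Plane

variable {k : Type*} [Field k]

/-- The points common to the curve `F = 0` and to the line at infinity. -/
def pointsAtInfinity (F : PlaneRing k) : Set (Plane k) :=
  {P | eval P.rep F = 0 ∧ P.rep 2 = 0}

/-- `ℓ` is an equation of the line joining the origin `A` to the point `P` (with `P ≠ A`). -/
def IsLineThroughOriginAnd (ℓ : PlaneRing k) (P : Plane k) : Prop :=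
  ℓ ≠ 0 ∧ ℓ.IsHomogeneous 1 ∧ eval (origin k) ℓ = 0 ∧ eval P.rep ℓ = 0

/-- `F = 0` is a smooth conic with center `A`, i.e. the polar line of `A` with respect to it is
the line at infinity. -/
structure IsCenteredConic (F : PlaneRing k) : Prop where
  homogeneous : F.IsHomogeneous 2
  smooth : ∀ v : Fin 3 → k, v ≠ 0 → eval v F = 0 → ∃ i, eval v (pderiv i F) ≠ 0
  center : ∀ v : Fin 3 → k, ∑ i, v i * eval (origin k) (pderiv i F) = 0 ↔ v 2 = 0

/-- The image of the curve `F = 0` under the homothety of center `A` and ratio `2`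
(in characteristic different from `2`). -/
def double (F : PlaneRing k) : PlaneRing k := aeval ![X 0, X 1, C 2 * X 2] F

end Plane

section Cycles

/-- Reduced irreducible curves in the plane, given by their homogeneous prime ideals. -/
structure PrimeCurve (k : Type*) [Field k] where
  ideal : Ideal (PlaneRing k)
  exists_equation : ∃ P : PlaneRing k,
    Irreducible P ∧ (∃ n, P.IsHomogeneous n) ∧ ideal = Ideal.span {P}

/-- Effective divisors (effective 1-cycles) of the plane. -/
abbrev Cycle (k : Type*) [Field k] : Type _ := PrimeCurve k →₀ ℕ

variable {k : Type*} [Field k]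

/-- The points of a reduced irreducible curve. -/
def PrimeCurve.points (D : PrimeCurve k) : Set (Plane k) :=
  {Q | ∀ f ∈ D.ideal, eval Q.rep f = 0}

/-- A curve is reducible if it is the sum of two nonzero curves. -/
def Cycle.IsReducible (D : Cycle k) : Prop :=
  ∃ D₁ D₂ : Cycle k, D₁ ≠ 0 ∧ D₂ ≠ 0 ∧ D = D₁ + D₂

/-- The curve has at least two distinct irreducible components. -/
def Cycle.HasTwoComponents (D : Cycle k) : Prop :=
  ∃ D₁ ∈ D.support, ∃ D₂ ∈ D.support, D₁ ≠ D₂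

end Cycles

section Incidence

variable {k : Type*} [Field k]

/-- The ideal `(F(zX - xZ, zY - yZ, zZ), xY - yX)` of the incidence surface `W`. -/
def incidenceIdeal (F : PlaneRing k) : Ideal (ProdRing k) :=
  Ideal.span
    {aeval ![X (Sum.inl 2) * X (Sum.inr 0) - X (Sum.inl 0) * X (Sum.inr 2),
             X (Sum.inl 2) * X (Sum.inr 1) - X (Sum.inl 1) * X (Sum.inr 2),
             X (Sum.inl 2) * X (Sum.inr 2)] F,
     X (Sum.inl 0) * X (Sum.inr 1) - X (Sum.inl 1) * X (Sum.inr 0)}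

/-- The ideal of the pullback `π₁⁻¹(C)` to `W` of the curve `C : G = 0`: the equation `G(x, y, z)`
is added to those of `W`. -/
def pullbackIdeal (F G : PlaneRing k) : Ideal (ProdRing k) :=
  incidenceIdeal F ⊔ Ideal.span {rename Sum.inl G}

/-- The irreducible components of `π₁⁻¹(C)`: the minimal primes over its ideal that do not
contain one of the two irrelevant ideals `(x, y, z)`, `(X, Y, Z)`. -/
def pullbackComponents (F G : PlaneRing k) : Set (PrimeSpectrum (ProdRing k)) :=
  {q | q.asIdeal ∈ (pullbackIdeal F G).minimalPrimes ∧
    (∃ i, X (Sum.inl i) ∉ q.asIdeal) ∧ ∃ i, X (Sum.inr i) ∉ q.asIdeal}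

theorem pullbackComponents_finite (F G : PlaneRing k) : (pullbackComponents F G).Finite := by
  refine Set.Finite.subset (Set.Finite.preimage (f := PrimeSpectrum.asIdeal) ?_
    (Ideal.finite_minimalPrimes_of_isNoetherianRing _ (pullbackIdeal F G))) (fun q hq => hq.1)
  exact fun a _ b _ h => PrimeSpectrum.ext h

/-- The multiplicity of the component `q` in the divisor `π₁^*(C)`: the length of the local ring
of `π₁⁻¹(C)` at its generic point. -/
def pullbackMultiplicity (F G : PlaneRing k) (q : PrimeSpectrum (ProdRing k)) : ℕ :=
  (Module.length (Localization.AtPrime q.asIdeal)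
    (Localization.AtPrime q.asIdeal ⧸
      (pullbackIdeal F G).map (algebraMap (ProdRing k) (Localization.AtPrime q.asIdeal)))).toNat

/-- The pairs of points of the subvariety of the product of planes with ideal `q`. -/
def zeroLocus (q : PrimeSpectrum (ProdRing k)) : Set (Plane k × Plane k) :=
  {PQ | ∀ f ∈ q.asIdeal, eval (Sum.elim PQ.1.rep PQ.2.rep) f = 0}

/-- The degree over the plane curve `D` of the subvariety with ideal `q` under the second
projection: the number of points in the generic fiber, i.e. in the fiber over all but finitely
many points of `D`. -/
def degreeOver (q : PrimeSpectrum (ProdRing k)) (D : PrimeCurve k) : ℕ :=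
  sInf {m : ℕ | {Q ∈ D.points | {P : Plane k | (P, Q) ∈ zeroLocus q}.ncard ≠ m}.Finite}

open Classical in
/-- The push-forward under the second projection of the subvariety with ideal `q`: if its image
is a curve `D` (whose ideal is the contraction of `q` to `k[X, Y, Z]`) this is `m D`, where `m` is
the degree over `D`; otherwise it is `0`. -/
def pushforward (q : PrimeSpectrum (ProdRing k)) : Cycle k :=
  if h : ∃ D : PrimeCurve k,
      D.ideal = q.asIdeal.comap (rename Sum.inr : PlaneRing k →ₐ[k] ProdRing k)
  then Finsupp.single h.choose (degreeOver q h.choose) else 0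

/-- The conchoid `π₂_*(π₁^*(C))` of the curve `C : G = 0` with respect to `B : F = 0`. -/
def conchoid (F G : PlaneRing k) : Cycle k :=
  ∑ᶠ q ∈ pullbackComponents F G, pullbackMultiplicity F G q • pushforward q

/-- The curves removed in the proper conchoid: `B : F = 0` and the lines joining `A` to the points
at infinity of `B`. -/
def IsExceptional (F : PlaneRing k) (D : PrimeCurve k) : Prop :=
  F ∈ D.ideal ∨
    ∃ P ∈ pointsAtInfinity F, ∃ ℓ : PlaneRing k, IsLineThroughOriginAnd ℓ P ∧ ℓ ∈ D.ideal

open Classical in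
/-- The proper conchoid of `C : G = 0` with respect to `B : F = 0`: what remains of the conchoid
when the exceptional curves are removed with their multiplicities. -/
def properConchoid (F G : PlaneRing k) : Cycle k :=
  (conchoid F G).filter (fun D => ¬ IsExceptional F D)

end Incidence

end

end Conchoid

/-! In coordinates adapted to the two tangents through A the conic is F = d(z² - uv), with u and v
independent linear forms in x, y. For P = [x : y : z] with z and uv nonzero, the incident points are
Q = [x(z + ρ) : y(z + ρ) : zρ] with ρ² = uv. In affine terms Q = P + e, where e runs through the two
opposite points of B on the line AP. Away from the curves that are removed, π₁⁻¹(C) is therefore the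
double cover ρ² = uv of C, and the question is whether uv is a square on C, that is, whether ρ = a/b
with forms a, b of degrees m + 1, m (`HasRoot`).

If uv is not a square, the double cover is irreducible (`IsComponentPoint.le_of_not_hasRoot`), and
its multiplicity is 1 because the binary form t² - uv s² is squarefree when 2 ≠ 0. Its degree over
the image is 1 as well: incidence is symmetric, so degree 2 would put P + 2e on C together with P,
and by iteration P + 2ne for all n. The equation of C restricted to the line AP has degree at most δ
and, by the hypothesis on the characteristic, at least δ + 1 roots, so C would be a line through A
(`isLine_of_forall_nat`); but uv is a square on such a line.

If uv is a square, its two roots give two components. C ≠ B keeps them from being contracted to A,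
and C ≠ B₂ keeps their images out of B (`exists_component_of_root`). If the two images coincide, the
same translation argument shows that C is a line through A, and the common image has coefficient at
least 2: the proper conchoid is still reducible, though possibly without distinct components.

The equivalence of `HasRoot` with (*) is a descent. After the substitution u = x², v = y² the form
a² - uv b² factors, G becomes a norm g · g^σ for the sign change σ of x, and g can be chosen
invariant or anti-invariant under the simultaneous change of both signs. So g = r + xy s or g = x r
+ y s, whose norms are the two forms in (*) up to constants (`Axes.exists_eq_of_dvd`). Anisotropy of
these forms allows r and s to be taken homogeneous. Only the second statement admits C = L∞, and
there both sides are false. -/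

open MvPolynomial

namespace Conchoid

noncomputable section

/-! ### Linear forms attached to the tangents, and the normal form of the conic. -/

/-- A pair of independent linear forms `u, v` in two variables. -/
structure Axes (k : Type*) [Field k] where
  u₀ : k
  u₁ : k
  v₀ : k
  v₁ : k
  det_ne_zero : u₀ * v₁ - u₁ * v₀ ≠ 0

namespace Axes

variable {k : Type*} [Field k] (A : Axes k)

section Ring

variable {T T' : Type*} [CommRing T] [Algebra k T] [CommRing T'] [Algebra k T']

/-- The first linear form. -/
def u (x y : T) : T := algebraMap k T A.u₀ * x + algebraMap k T A.u₁ * y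

/-- The second linear form. -/
def v (x y : T) : T := algebraMap k T A.v₀ * x + algebraMap k T A.v₁ * y

/-- The product of the two linear forms. -/
def norm (x y : T) : T := A.u x y * A.v x y

theorem map_u (f : T →ₐ[k] T') (x y : T) : f (A.u x y) = A.u (f x) (f y) := by
  simp [u]

theorem map_v (f : T →ₐ[k] T') (x y : T) : f (A.v x y) = A.v (f x) (f y) := by
  simp [v]

theorem map_norm (f : T →ₐ[k] T') (x y : T) : f (A.norm x y) = A.norm (f x) (f y) := by
  simp [norm, map_u, map_v]

theorem u_mul (x y c : T) : A.u (x * c) (y * c) = A.u x y * c := by simp only [u]; ring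

theorem v_mul (x y c : T) : A.v (x * c) (y * c) = A.v x y * c := by simp only [v]; ring

theorem norm_mul (x y c : T) : A.norm (x * c) (y * c) = A.norm x y * c ^ 2 := by
  simp only [norm, u_mul, v_mul]; ring

theorem algebraMap_det_isUnit :
    IsUnit (algebraMap k T A.u₀ * algebraMap k T A.v₁ - algebraMap k T A.u₁ * algebraMap k T A.v₀) := by
  rw [← map_mul, ← map_mul, ← map_sub]
  exact (IsUnit.mk0 _ A.det_ne_zero).map _

theorem eq_zero_of_u_v {x y : T} (hu : A.u x y = 0) (hv : A.v x y = 0) : x = 0 ∧ y = 0 := by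
  simp only [u, v] at hu hv
  have h := A.algebraMap_det_isUnit (T := T)
  constructor
  · rw [← h.mul_right_eq_zero]
    linear_combination algebraMap k T A.v₁ * hu - algebraMap k T A.u₁ * hv
  · rw [← h.mul_right_eq_zero]
    linear_combination algebraMap k T A.u₀ * hv - algebraMap k T A.v₀ * hu

@[simp] theorem norm_zero : A.norm (0 : T) 0 = 0 := by simp [norm, u]

end Ring

/-- The first linear form, as an equation of a line. -/
def uPoly : PlaneRing k := A.u (X 0) (X 1)

/-- The second linear form, as an equation of a line. -/
def vPoly : PlaneRing k := A.v (X 0) (X 1)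

/-- The product of the two linear forms, as an equation of a pair of lines. -/
def normPoly : PlaneRing k := A.norm (X 0) (X 1)

theorem normPoly_eq : A.normPoly = A.uPoly * A.vPoly := rfl

variable {T : Type*} [CommRing T] [Algebra k T]

@[simp] theorem aeval_uPoly (P : Fin 3 → T) : aeval P A.uPoly = A.u (P 0) (P 1) := by
  simp [uPoly, map_u]

@[simp] theorem aeval_vPoly (P : Fin 3 → T) : aeval P A.vPoly = A.v (P 0) (P 1) := by
  simp [vPoly, map_v]

@[simp] theorem aeval_normPoly (P : Fin 3 → T) : aeval P A.normPoly = A.norm (P 0) (P 1) := by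
  simp [normPoly, map_norm]

theorem uPoly_isHomogeneous : A.uPoly.IsHomogeneous 1 :=
  (isHomogeneous_C_mul_X _ _).add (isHomogeneous_C_mul_X _ _)

theorem vPoly_isHomogeneous : A.vPoly.IsHomogeneous 1 :=
  (isHomogeneous_C_mul_X _ _).add (isHomogeneous_C_mul_X _ _)

theorem normPoly_isHomogeneous : A.normPoly.IsHomogeneous 2 :=
  A.uPoly_isHomogeneous.mul A.vPoly_isHomogeneous

/-- The conic `d (z² - u v)`. -/
def conic (d : k) : PlaneRing k := C d * (X 2 ^ 2 - A.normPoly)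

end Axes

theorem exists_linear_of_isHomogeneous_one {k : Type*} [Field k] {f : PlaneRing k}
    (hf : f.IsHomogeneous 1) : ∃ a b c : k, f = C a * X 0 + C b * X 1 + C c * X 2 := by
  have h : f ∈ Submodule.span k (Set.range X) := by
    rw [← homogeneousSubmodule_one_eq_span_X]; exact hf
  obtain ⟨c, hc⟩ := (Submodule.mem_span_range_iff_exists_fun k).1 h
  refine ⟨c 0, c 1, c 2, ?_⟩
  rw [← hc, Fin.sum_univ_three]
  simp only [smul_eq_C_mul]

/-- Each partial derivative is a linear form, so its value at A is its z-coefficient, and the polar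
condition removes the terms in xz and yz. Euler's relation then rebuilds 2F, which is why 2 must be
invertible. -/
theorem IsCenteredConic.exists_coefficients {k : Type*} [Field k] (h2 : (2 : k) ≠ 0)
    {F : PlaneRing k} (hF : IsCenteredConic F) :
    ∃ a b c d : k, d ≠ 0 ∧
      F = C a * X 0 ^ 2 + C b * (X 0 * X 1) + C c * X 1 ^ 2 + C d * X 2 ^ 2 := by
  have hlin : ∀ i, ∃ a b c : k, pderiv i F = C a * X 0 + C b * X 1 + C c * X 2 := fun i =>
    exists_linear_of_isHomogeneous_one hF.homogeneous.pderiv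
  choose a b c h using hlin
  have hE := hF.homogeneous.sum_X_mul_pderiv
  rw [Fin.sum_univ_three, h, h, h, two_nsmul, ← two_mul, show (2 : PlaneRing k) = C 2 from (map_ofNat C 2).symm] at hE
  have hcen := hF.center
  have hev : ∀ i, eval (origin k) (pderiv i F) = c i := fun i => by rw [h]; simp [origin]
  have hc0 : c 0 = 0 := by
    have := (hcen (Pi.single 0 1)).2 (by simp)
    simpa [Fin.sum_univ_three, hev] using this
  have hc1 : c 1 = 0 := by
    have := (hcen (Pi.single 1 1)).2 (by simp)
    simpa [Fin.sum_univ_three, hev] using this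
  have hc2 : c 2 ≠ 0 := by
    intro hc2
    have := (hcen (Pi.single 2 1)).1 (by rw [Fin.sum_univ_three, hev 2, hc2]; simp)
    simp at this
  -- Symmetry of the Hessian, read off from the derivative of Euler's relation at A: the
  -- x-coefficient of ∂F/∂z is the z-coefficient of ∂F/∂x.
  have h0 : c 0 + a 2 = 2 * c 0 := by
    have := congrArg (fun p => eval (origin k) (pderiv 0 p)) hE
    rw [pderiv_C_mul, map_mul, hev] at this
    simpa [origin, pderiv_X] using this
  have h1 : c 1 + b 2 = 2 * c 1 := by
    have := congrArg (fun p => eval (origin k) (pderiv 1 p)) hE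
    rw [pderiv_C_mul, map_mul, hev] at this
    simpa [origin, pderiv_X] using this
  have ha2 : a 2 = 0 := by rw [hc0] at h0; simpa using h0
  have hb2 : b 2 = 0 := by rw [hc1] at h1; simpa using h1
  refine ⟨a 0 / 2, (b 0 + a 1) / 2, b 1 / 2, c 2 / 2, div_ne_zero hc2 h2, ?_⟩
  have hC : (C (2 : k) : PlaneRing k) ≠ 0 := by simpa using h2
  apply mul_left_cancel₀ hC
  have hC' : ∀ x : k, (C 2 : PlaneRing k) * C (x / 2) = C x := fun x => by
    rw [← C_mul, mul_div_cancel₀ _ h2]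
  rw [ha2, hb2, hc0, hc1] at hE
  rw [← hE]
  simp only [mul_add, ← mul_assoc, hC']
  simp only [C_0, C_add]
  ring

/-- Quadratic formula for ax² + bxy + cy², with `s` a square root of the discriminant; for a = 0 the
form is y(bx + cy). -/
theorem exists_binary_factor {k : Type*} [Field k] [IsAlgClosed k] (h2 : (2 : k) ≠ 0) (a b c : k) :
    ∃ m₀ m₁ n₀ n₁ : k, a = m₀ * n₀ ∧ b = m₀ * n₁ + m₁ * n₀ ∧ c = m₁ * n₁ := by
  by_cases ha : a = 0
  · exact ⟨0, 1, b, c, by simp [ha], by simp, by simp⟩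
  · obtain ⟨s, hs⟩ := IsAlgClosed.exists_pow_nat_eq (b ^ 2 - 4 * a * c) (n := 2) (by norm_num)
    refine ⟨a, (b - s) / 2, 1, (b + s) / (2 * a), by ring, by field_simp; ring, ?_⟩
    field_simp
    linear_combination hs

/-- A line through the origin is determined by its point at infinity. -/
theorem IsLineThroughOriginAnd.eq {k : Type*} [Field k] {ℓ : PlaneRing k} {m₀ m₁ : k}
    (hm : m₀ ≠ 0 ∨ m₁ ≠ 0) (h : (![m₁, -m₀, 0] : Fin 3 → k) ≠ 0)
    (hℓ : IsLineThroughOriginAnd ℓ (Projectivization.mk k _ h)) :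
    ∃ c : k, c ≠ 0 ∧ ℓ = C c * (C m₀ * X 0 + C m₁ * X 1) := by
  obtain ⟨h0, hh, hO, hP⟩ := hℓ
  obtain ⟨a, b, c, rfl⟩ := exists_linear_of_isHomogeneous_one hh
  obtain ⟨w, hw⟩ := Projectivization.exists_smul_eq_mk_rep k _ h
  rw [← hw] at hP
  have hc : c = 0 := by simpa [origin] using hO
  subst hc
  have hP' : a * m₁ - b * m₀ = 0 := by
    have : (w : k) * (a * m₁ - b * m₀) = 0 := by
      simp [Units.smul_def] at hP
      linear_combination hP
    exact (mul_eq_zero.1 this).resolve_left w.ne_zero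
  obtain ⟨e, h1, h2⟩ : ∃ e, a = e * m₀ ∧ b = e * m₁ := by
    rcases hm with hm | hm
    · refine ⟨a / m₀, by field_simp, ?_⟩
      field_simp; linear_combination -hP'
    · refine ⟨b / m₁, ?_, by field_simp⟩
      field_simp; linear_combination hP'
  have he : e ≠ 0 := by
    rintro rfl
    apply h0; simp [h1, h2]
  refine ⟨e, he, ?_⟩
  rw [h1, h2]; simp only [C_mul, C_0]; ring

/-- If the two linear factors of F(x, y, 0) were proportional, the conic would be singular at a
common zero on L∞. So they are independent and vanish at the two points at infinity, in one order or
the other. The factor `-1 / d` is absorbed in the first form to reach d(z² - uv). -/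
theorem IsCenteredConic.exists_axes {k : Type*} [Field k] [IsAlgClosed k] (h2 : (2 : k) ≠ 0)
    {F : PlaneRing k} (hF : IsCenteredConic F) {P₁ P₂ : Plane k}
    (hP : pointsAtInfinity F = {P₁, P₂}) {ℓ₁ ℓ₂ : PlaneRing k}
    (hℓ₁ : IsLineThroughOriginAnd ℓ₁ P₁) (hℓ₂ : IsLineThroughOriginAnd ℓ₂ P₂) :
    ∃ (A : Axes k) (d c₁ c₂ : k), d ≠ 0 ∧ c₁ ≠ 0 ∧ c₂ ≠ 0 ∧ F = A.conic d ∧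
      ℓ₁ = C c₁ * A.uPoly ∧ ℓ₂ = C c₂ * A.vPoly := by
  obtain ⟨a, b, c, d, hd, hFe⟩ := hF.exists_coefficients h2
  obtain ⟨m₀, m₁, n₀, n₁, rfl, rfl, rfl⟩ := exists_binary_factor h2 a b c
  have hdet : m₀ * n₁ - m₁ * n₀ ≠ 0 := by
    intro hdet
    obtain ⟨w₀, w₁, hw, hm, hn⟩ : ∃ w₀ w₁ : k, (w₀ ≠ 0 ∨ w₁ ≠ 0) ∧ m₀ * w₀ + m₁ * w₁ = 0 ∧
        n₀ * w₀ + n₁ * w₁ = 0 := by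
      by_cases hm : m₀ = 0 ∧ m₁ = 0
      · by_cases hn : n₀ = 0 ∧ n₁ = 0
        · exact ⟨1, 0, by simp, by simp [hm], by simp [hn]⟩
        · refine ⟨n₁, -n₀, ?_, by simp [hm], by ring⟩
          rw [neg_ne_zero]; tauto
      · refine ⟨m₁, -m₀, ?_, by ring, by linear_combination -hdet⟩
        rw [neg_ne_zero]; tauto
    obtain ⟨i, hi⟩ := hF.smooth ![w₀, w₁, 0]
      (by intro h; have h0 := congrFun h 0; have h1 := congrFun h 1; simp at h0 h1; tauto)
      (by rw [hFe]; simp; linear_combination (n₀ * w₀ + n₁ * w₁) * hm)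
    apply hi
    rw [hFe]
    fin_cases i
    · simp [pderiv_X]
      linear_combination n₀ * hm + m₀ * hn
    · simp [pderiv_X]
      linear_combination n₁ * hm + m₁ * hn
    · simp [pderiv_X]
  have hm : m₀ ≠ 0 ∨ m₁ ≠ 0 := by
    by_contra! h; apply hdet; simp [h.1, h.2]
  have hn : n₀ ≠ 0 ∨ n₁ ≠ 0 := by
    by_contra! h; apply hdet; simp [h.1, h.2]
  have hvec : ∀ s t : k, (s ≠ 0 ∨ t ≠ 0) → (![t, -s, 0] : Fin 3 → k) ≠ 0 := by
    intro s t h h'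
    have h0 := congrFun h' 0; have h1 := congrFun h' 1; simp at h0 h1; tauto
  set Wm : Plane k := Projectivization.mk k _ (hvec m₀ m₁ hm) with hWm
  set Wn : Plane k := Projectivization.mk k _ (hvec n₀ n₁ hn) with hWn
  have hne : Wm ≠ Wn := by
    intro h
    rw [hWm, hWn, Projectivization.mk_eq_mk_iff'] at h
    obtain ⟨t, ht⟩ := h
    have h0 := congrFun ht 0; have h1 := congrFun ht 1; simp at h0 h1
    apply hdet
    linear_combination n₀ * h0 + (-n₁) * h1
  have hWm' : Wm ∈ pointsAtInfinity F := by
    obtain ⟨w, hw⟩ := Projectivization.exists_smul_eq_mk_rep k _ (hvec m₀ m₁ hm)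
    simp only [pointsAtInfinity, Set.mem_ofPred_eq, hWm, ← hw, hFe]
    simp [Units.smul_def]; ring
  have hWn' : Wn ∈ pointsAtInfinity F := by
    obtain ⟨w, hw⟩ := Projectivization.exists_smul_eq_mk_rep k _ (hvec n₀ n₁ hn)
    simp only [pointsAtInfinity, Set.mem_ofPred_eq, hWn, ← hw, hFe]
    simp [Units.smul_def]; ring
  have hC : (C d : PlaneRing k) * C (-1 / d) = -1 := by
    rw [← C_mul, mul_div_cancel₀ _ hd]; simp
  rw [hP] at hWm' hWn'
  have hcase : (P₁ = Wm ∧ P₂ = Wn) ∨ (P₁ = Wn ∧ P₂ = Wm) := by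
    simp only [Set.mem_insert_iff, Set.mem_singleton_iff] at hWm' hWn'
    rcases hWm' with h | h <;> rcases hWn' with h' | h'
    · exact absurd (h.trans h'.symm) hne
    · exact .inl ⟨h.symm, h'.symm⟩
    · exact .inr ⟨h'.symm, h.symm⟩
    · exact absurd (h.trans h'.symm) hne
  have hd' : -1 / d ≠ 0 := div_ne_zero (by simp) hd
  rcases hcase with ⟨rfl, rfl⟩ | ⟨rfl, rfl⟩
  · obtain ⟨e₁, he₁, rfl⟩ := hℓ₁.eq hm
    obtain ⟨e₂, he₂, rfl⟩ := hℓ₂.eq hn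
    refine ⟨⟨-1 / d * m₀, -1 / d * m₁, n₀, n₁, ?_⟩, d, e₁ / (-1 / d), e₂, hd, div_ne_zero he₁ hd',
      he₂, ?_, ?_, rfl⟩
    · have : -1 / d * m₀ * n₁ - -1 / d * m₁ * n₀ = -1 / d * (m₀ * n₁ - m₁ * n₀) := by ring
      rw [this]; exact mul_ne_zero hd' hdet
    · rw [hFe]
      simp only [Axes.conic, Axes.normPoly, Axes.norm, Axes.u, Axes.v, algebraMap_eq, C_mul, C_add]
      linear_combination (C m₀ * X 0 + C m₁ * X 1) * (C n₀ * X 0 + C n₁ * X 1) * hC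
    · simp only [Axes.uPoly, Axes.u, algebraMap_eq, C_mul]
      have : (C (e₁ / (-1 / d)) : PlaneRing k) * C (-1 / d) = C e₁ := by
        rw [← C_mul, div_mul_cancel₀ _ hd']
      linear_combination -(C m₀ * X 0 + C m₁ * X 1) * this
  · obtain ⟨e₁, he₁, rfl⟩ := hℓ₁.eq hn
    obtain ⟨e₂, he₂, rfl⟩ := hℓ₂.eq hm
    refine ⟨⟨-1 / d * n₀, -1 / d * n₁, m₀, m₁, ?_⟩, d, e₁ / (-1 / d), e₂, hd, div_ne_zero he₁ hd',
      he₂, ?_, ?_, rfl⟩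
    · have : -1 / d * n₀ * m₁ - -1 / d * n₁ * m₀ = -(-1 / d) * (m₀ * n₁ - m₁ * n₀) := by ring
      rw [this]; exact mul_ne_zero (neg_ne_zero.2 hd') hdet
    · rw [hFe]
      simp only [Axes.conic, Axes.normPoly, Axes.norm, Axes.u, Axes.v, algebraMap_eq, C_mul, C_add]
      linear_combination (C m₀ * X 0 + C m₁ * X 1) * (C n₀ * X 0 + C n₁ * X 1) * hC
    · simp only [Axes.uPoly, Axes.u, algebraMap_eq, C_mul]
      have : (C (e₁ / (-1 / d)) : PlaneRing k) * C (-1 / d) = C e₁ := by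
        rw [← C_mul, div_mul_cancel₀ _ hd']
      linear_combination -(C n₀ * X 0 + C n₁ * X 1) * this

theorem ext_three {T : Type*} {P Q : Fin 3 → T} (h0 : P 0 = Q 0) (h1 : P 1 = Q 1)
    (h2 : P 2 = Q 2) : P = Q := by
  funext i; fin_cases i <;> assumption

/-! ### Scaling of points, and the parametrisation of incident pairs by a square root of uv. -/

section Points

variable {T : Type*} [CommRing T]

/-- The point `[αx : αy : βz]` of the line joining `[x : y : z]` to the origin. -/
def pt (P : Fin 3 → T) (α β : T) : Fin 3 → T := ![P 0 * α, P 1 * α, P 2 * β]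

@[simp] theorem pt_zero (P : Fin 3 → T) (α β : T) : pt P α β 0 = P 0 * α := rfl
@[simp] theorem pt_one (P : Fin 3 → T) (α β : T) : pt P α β 1 = P 1 * α := rfl
@[simp] theorem pt_two (P : Fin 3 → T) (α β : T) : pt P α β 2 = P 2 * β := rfl

theorem smul_pt (c : T) (P : Fin 3 → T) (α β : T) : c • pt P α β = pt P (c * α) (c * β) :=
  ext_three (by simp; ring) (by simp; ring) (by simp; ring)

end Points

section Scaling

variable {k : Type*} [Field k] {T : Type*} [CommRing T] [Algebra k T]

theorem aeval_smul_of_isHomogeneous {σ : Type*} {f : MvPolynomial σ k} {n : ℕ}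
    (hf : f.IsHomogeneous n) (c : T) (P : σ → T) :
    aeval (c • P) f = c ^ n * aeval P f := by
  rw [aeval_def, aeval_def, eval₂_eq, eval₂_eq, Finset.mul_sum]
  refine Finset.sum_congr rfl fun d hd => ?_
  have : ∑ i ∈ d.support, d i = n := by
    by_contra h; exact (mem_support_iff.1 hd) (hf.coeff_eq_zero h)
  simp only [Pi.smul_apply, smul_eq_mul, mul_pow, Finset.prod_mul_distrib, Finset.prod_pow_eq_pow_sum]
  rw [this]
  ring

/-- As a polynomial in c, the value of f at the rescaled point has the weighted components of f as
coefficients. Over an infinite field, vanishing for all c thus becomes vanishing of each component.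
-/
theorem exists_polynomial_weight {σ : Type*} (w : σ → ℕ) (P : σ → T) (f : MvPolynomial σ k) :
    ∃ p : Polynomial T, (∀ i, p.coeff i = aeval P (weightedHomogeneousComponent w i f)) ∧
      ∀ c, p.eval c = aeval (fun i => c ^ w i * P i) f := by
  refine ⟨aeval (fun i => Polynomial.X ^ w i * Polynomial.C (P i)) f, fun i => ?_, fun c => ?_⟩
  · induction f using MvPolynomial.induction_on' with
    | monomial m a =>
      rw [weightedHomogeneousComponent_of_mem
        (isWeightedHomogeneous_monomial w m a (m := Finsupp.weight w m) rfl), aeval_monomial]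
      have : (m.prod fun i e => (Polynomial.X ^ w i * Polynomial.C (P i)) ^ e) =
          Polynomial.C (m.prod fun i e => P i ^ e) * Polynomial.X ^ (Finsupp.weight w m) := by
        simp only [mul_pow, Finsupp.prod_mul, ← pow_mul]
        rw [mul_comm]
        congr 1
        · simp [Finsupp.prod, map_prod]
        · rw [Finsupp.weight_apply, Finsupp.prod, Finset.prod_pow_eq_pow_sum, Finsupp.sum]
          simp [mul_comm]
      rw [this, IsScalarTower.algebraMap_apply k T (Polynomial T), Polynomial.algebraMap_eq,
        ← mul_assoc, ← Polynomial.C_mul, Polynomial.coeff_C_mul_X_pow]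
      split_ifs
      · rw [aeval_monomial]
      · rw [map_zero]
    | add p q hp hq => rw [map_add, Polynomial.coeff_add, hp, hq, map_add, map_add]
  · have : (fun i => c ^ w i * P i) = fun i =>
        ((Polynomial.aeval c : Polynomial T →ₐ[T] T).restrictScalars k)
          (Polynomial.X ^ w i * Polynomial.C (P i)) := by
      funext i; simp; ring
    rw [this, ← MvPolynomial.comp_aeval_apply]
    rfl

theorem exists_polynomial_smul {σ : Type*} (P : σ → T) (f : MvPolynomial σ k) :
    ∃ p : Polynomial T, (∀ i, p.coeff i = aeval P (homogeneousComponent i f)) ∧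
      ∀ c, p.eval c = aeval (c • P) f := by
  obtain ⟨p, hp, hp'⟩ := exists_polynomial_weight 1 P f
  exact ⟨p, hp, fun c => by rw [hp']; congr 2; funext i; simp⟩

theorem aeval_smul_eq_zero_iff {L : Type*} [Field L] [Algebra k L] {σ : Type*}
    {f : MvPolynomial σ k} {n : ℕ} (hf : f.IsHomogeneous n) {c : L} (hc : c ≠ 0) (P : σ → L) :
    aeval (c • P) f = 0 ↔ aeval P f = 0 := by
  rw [aeval_smul_of_isHomogeneous hf, mul_eq_zero, or_iff_right (pow_ne_zero _ hc)]

end Scaling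

namespace Axes

variable {k : Type*} [Field k] (A : Axes k) {T : Type*} [CommRing T] [Algebra k T]

/-- The equations of the incidence surface. -/
def Incident (P Q : Fin 3 → T) : Prop :=
  (P 2 * Q 2) ^ 2 = A.norm (P 2 * Q 0 - P 0 * Q 2) (P 2 * Q 1 - P 1 * Q 2) ∧
    P 0 * Q 1 = P 1 * Q 0

variable {A}

theorem Incident.symm {P Q : Fin 3 → T} (h : A.Incident P Q) : A.Incident Q P := by
  refine ⟨?_, ?_⟩
  · have e : ∀ i, Q 2 * P i - Q i * P 2 = (P 2 * Q i - P i * Q 2) * (-1) := fun i => by ring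
    rw [e, e, norm_mul, mul_comm (Q 2), h.1]; ring
  · rw [mul_comm, ← h.2, mul_comm]

theorem Incident.smul {P Q : Fin 3 → T} (h : A.Incident P Q) (c₁ c₂ : T) :
    A.Incident (c₁ • P) (c₂ • Q) := by
  refine ⟨?_, ?_⟩
  · have e : ∀ i, (c₁ • P) 2 * (c₂ • Q) i - (c₁ • P) i * (c₂ • Q) 2 =
        (P 2 * Q i - P i * Q 2) * (c₁ * c₂) := fun i => by simp; ring
    rw [e, e, norm_mul, ← h.1]; simp; ring
  · simp; linear_combination c₁ * c₂ * h.2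

/-- In affine coordinates the second point is (x, y)/z + (x, y)/ρ, the sum of P and of a point of B
on the line AP. -/
theorem incident_pt {P : Fin 3 → T} {ρ : T} (hρ : ρ ^ 2 = A.norm (P 0) (P 1)) :
    A.Incident P (pt P (P 2 + ρ) ρ) := by
  refine ⟨?_, by simp; ring⟩
  have e : ∀ i, P 2 * (P i * (P 2 + ρ)) - P i * (P 2 * ρ) = P i * (P 2 ^ 2) := fun i => by ring
  simp only [pt_zero, pt_one, pt_two, e, norm_mul, ← hρ]
  ring

/-- Collinearity with A gives (X, Y) = t(x, y), and the other equation becomes (zZ)² = uv(x, y)(zt -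
Z)². So ρ = zZ/(zt - Z) is a square root of uv. -/
theorem Incident.exists_eq_pt {L : Type*} [Field L] [Algebra k L] {P Q : Fin 3 → L}
    (h : A.Incident P Q) (hz : P 2 ≠ 0) (hn : A.norm (P 0) (P 1) ≠ 0) (hQ : Q ≠ 0) :
    ∃ ρ α : L, α ≠ 0 ∧ ρ ≠ 0 ∧ ρ ^ 2 = A.norm (P 0) (P 1) ∧ Q = α • pt P (P 2 + ρ) ρ := by
  obtain ⟨t, h0, h1⟩ : ∃ t, Q 0 = P 0 * t ∧ Q 1 = P 1 * t := by
    by_cases hP : P 0 = 0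
    · have hP1 : P 1 ≠ 0 := by
        intro hP1; apply hn; rw [hP, hP1]; simp
      refine ⟨Q 1 / P 1, ?_, by field_simp⟩
      have := h.2
      rw [hP, zero_mul, eq_comm, mul_eq_zero] at this
      rw [hP, this.resolve_left hP1, zero_mul]
    · refine ⟨Q 0 / P 0, by field_simp, ?_⟩
      have := h.2
      field_simp
      linear_combination this
  have h' := h.1
  have e : ∀ i, P 2 * (P i * t) - P i * Q 2 = P i * (P 2 * t - Q 2) := fun i => by ring
  rw [h0, h1, e, e, norm_mul] at h'
  have hQ2 : Q 2 ≠ 0 := by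
    intro hQ2
    rw [hQ2] at h'
    have ht : t = 0 := by
      simp only [mul_zero, sub_zero, ne_eq, OfNat.ofNat_ne_zero, not_false_eq_true, zero_pow,
        zero_eq_mul, pow_eq_zero_iff, mul_eq_zero] at h'
      tauto
    apply hQ
    refine ext_three ?_ ?_ ?_ <;> simp [h0, h1, ht, hQ2]
  have hD : P 2 * t - Q 2 ≠ 0 := by
    intro hD
    rw [hD] at h'
    simp [hz, hQ2] at h'
  have hD' : t * P 2 - Q 2 ≠ 0 := by rwa [mul_comm]
  have : P 2 + P 2 * Q 2 / (P 2 * t - Q 2) = P 2 ^ 2 * t / (P 2 * t - Q 2) := by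
    rw [eq_div_iff hD, add_mul, div_mul_cancel₀ _ hD]; ring
  refine ⟨P 2 * Q 2 / (P 2 * t - Q 2), (P 2 * t - Q 2) / P 2 ^ 2, div_ne_zero hD (pow_ne_zero 2 hz), ?_, ?_, ?_⟩
  · exact div_ne_zero (mul_ne_zero hz hQ2) hD
  · rw [div_pow, h']; field_simp
  · refine ext_three ?_ ?_ ?_
    · simp only [Pi.smul_apply, pt_zero, smul_eq_mul, h0, this]; field_simp
    · simp only [Pi.smul_apply, pt_one, smul_eq_mul, h1, this]; field_simp
    · simp; field_simp

end Axes

/-! ### Points of the incidence ideals with values in algebras; generic points. -/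

section Ideals

variable {k : Type*} [Field k] {A : Axes k} {d : k} {T : Type*} [CommRing T] [Algebra k T]

/-- Values in arbitrary algebras are needed: the criterion is applied at generic points, over
polynomial rings and in quotients of local rings. -/
theorem incidenceIdeal_le_ker_iff (hd : d ≠ 0) (P Q : Fin 3 → T) :
    incidenceIdeal (A.conic d) ≤ RingHom.ker (aeval (Sum.elim P Q) : ProdRing k →ₐ[k] T) ↔
      A.Incident P Q := by
  rw [incidenceIdeal, Ideal.span_le, Set.insert_subset_iff, Set.singleton_subset_iff]
  simp only [SetLike.mem_coe, RingHom.mem_ker]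
  have hd' : IsUnit (algebraMap k T d) := (IsUnit.mk0 d hd).map _
  simp only [Axes.conic, map_mul, map_sub, map_pow, aeval_X, algHom_C, Axes.aeval_normPoly,
    Axes.map_norm, sub_eq_zero, Axes.Incident, Sum.elim_inl, Sum.elim_inr,
    Matrix.cons_val]
  simp only [algebraMap_eq, algHom_C, hd'.mul_right_eq_zero, sub_eq_zero]

theorem pullbackIdeal_le_ker_iff (hd : d ≠ 0) (G : PlaneRing k) (P Q : Fin 3 → T) :
    pullbackIdeal (A.conic d) G ≤ RingHom.ker (aeval (Sum.elim P Q) : ProdRing k →ₐ[k] T) ↔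
      A.Incident P Q ∧ aeval P G = 0 := by
  rw [pullbackIdeal, sup_le_iff, incidenceIdeal_le_ker_iff hd, Ideal.span_singleton_le_iff_mem,
    RingHom.mem_ker, aeval_rename, Sum.elim_comp_inl]

end Ideals

/-- `(P, Q)` is a generic point of the bihomogeneous ideal `q`. -/
structure IsGeneric {k : Type*} [Field k] {L : Type*} [Field L] [Algebra k L]
    (q : Ideal (ProdRing k)) (P Q : Fin 3 → L) : Prop where
  mem_iff : ∀ f, f ∈ q ↔ aeval (Sum.elim P Q) f = 0
  scale : ∀ f ∈ q, ∀ c₁ c₂ : L, aeval (Sum.elim (c₁ • P) (c₂ • Q)) f = 0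

section Generic

variable {k : Type*} [Field k]

/-- The coordinates of the first projection of the generic point of a prime ideal. -/
def genericFst (q : Ideal (ProdRing k)) [q.IsPrime] : Fin 3 → FractionRing (ProdRing k ⧸ q) :=
  fun i => algebraMap (ProdRing k ⧸ q) _ (Ideal.Quotient.mk q (X (Sum.inl i)))

/-- The coordinates of the second projection of the generic point of a prime ideal. -/
def genericSnd (q : Ideal (ProdRing k)) [q.IsPrime] : Fin 3 → FractionRing (ProdRing k ⧸ q) :=
  fun i => algebraMap (ProdRing k ⧸ q) _ (Ideal.Quotient.mk q (X (Sum.inr i)))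

theorem aeval_generic (q : Ideal (ProdRing k)) [q.IsPrime] (f : ProdRing k) :
    aeval (Sum.elim (genericFst q) (genericSnd q)) f =
      algebraMap (ProdRing k ⧸ q) (FractionRing (ProdRing k ⧸ q)) (Ideal.Quotient.mk q f) := by
  have : (aeval (Sum.elim (genericFst q) (genericSnd q)) :
      ProdRing k →ₐ[k] FractionRing (ProdRing k ⧸ q)) =
      (IsScalarTower.toAlgHom k (ProdRing k ⧸ q) _).comp (Ideal.Quotient.mkₐ k q) := by
    apply algHom_ext; rintro (i | i) <;> simp [genericFst, genericSnd]
  rw [this]; rfl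

theorem mem_iff_aeval_generic (q : Ideal (ProdRing k)) [q.IsPrime] (f : ProdRing k) :
    f ∈ q ↔ aeval (Sum.elim (genericFst q) (genericSnd q)) f = 0 := by
  rw [aeval_generic, map_eq_zero_iff _ (IsFractionRing.injective _ _), Ideal.Quotient.eq_zero_iff_mem]

/-- Minimal primes over a bihomogeneous ideal are bihomogeneous. The ideal of (sP, tQ), with s and t
indeterminates, is prime, contains the pullback ideal and lies in q, so it equals q by minimality;
specialising s and t gives the scaling property. -/
theorem isGeneric_of_mem_minimalPrimes {A : Axes k} {d : k} (hd : d ≠ 0) {G : PlaneRing k} {δ : ℕ}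
    (hG : G.IsHomogeneous δ) {q : Ideal (ProdRing k)}
    (hmin : q ∈ (pullbackIdeal (A.conic d) G).minimalPrimes) {L : Type*} [Field L] [Algebra k L]
    {P Q : Fin 3 → L} (hPQ : ∀ f, f ∈ q ↔ aeval (Sum.elim P Q) f = 0) :
    IsGeneric q P Q := by
  refine ⟨hPQ, fun f hf c₁ c₂ => ?_⟩
  let x : Fin 3 → MvPolynomial (Fin 2) L := fun i => C (P i)
  let y : Fin 3 → MvPolynomial (Fin 2) L := fun i => C (Q i)
  let θ : ProdRing k →ₐ[k] MvPolynomial (Fin 2) L :=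
    aeval (Sum.elim ((X 0 : MvPolynomial (Fin 2) L) • x) ((X 1 : MvPolynomial (Fin 2) L) • y))
  have h0 : pullbackIdeal (A.conic d) G ≤
      RingHom.ker (aeval (Sum.elim P Q) : ProdRing k →ₐ[k] L) := fun g hg =>
    (hPQ g).1 (hmin.1.2 hg)
  have hev : ∀ c : Fin 2 → L, ((aeval c : MvPolynomial (Fin 2) L →ₐ[L] L).restrictScalars k).comp θ =
      aeval (Sum.elim (c 0 • P) (c 1 • Q)) := by
    intro c
    apply algHom_ext; rintro (i | i) <;> simp [θ, x, y]
  rw [pullbackIdeal_le_ker_iff hd] at h0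
  have hx : (aeval x : PlaneRing k →ₐ[k] MvPolynomial (Fin 2) L) =
      (IsScalarTower.toAlgHom k L _).comp (aeval P) := by
    apply algHom_ext; intro i; simp [x]
  have h1 : pullbackIdeal (A.conic d) G ≤ RingHom.ker θ := by
    rw [pullbackIdeal_le_ker_iff hd]
    have hxy : A.Incident x y := by
      have e := h0.1
      have hC : ∀ a : L, (C a : MvPolynomial (Fin 2) L) = IsScalarTower.toAlgHom k L _ a :=
        fun a => rfl
      refine ⟨?_, ?_⟩
      · simp only [x, y, ← C_mul, ← C_sub, ← C_pow, e.1]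
        rw [hC, Axes.map_norm]; rfl
      · simp only [x, y, ← C_mul, e.2]
    refine ⟨hxy.smul _ _, ?_⟩
    rw [aeval_smul_of_isHomogeneous hG, hx, AlgHom.comp_apply, h0.2, map_zero, mul_zero]
  have h2 : RingHom.ker θ ≤ q := by
    intro g hg
    have := hev (fun _ => 1)
    simp only [one_smul] at this
    rw [hPQ, ← this, AlgHom.comp_apply, RingHom.mem_ker.1 hg, map_zero]
  have h3 : q ≤ RingHom.ker θ := hmin.2 ⟨RingHom.ker_isPrime _, h1⟩ h2
  have := hev ![c₁, c₂]
  simp only [Matrix.cons_val_zero, Matrix.cons_val_one] at this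
  rw [← this, AlgHom.comp_apply, RingHom.mem_ker.1 (h3 hf), map_zero]

end Generic

section Cone

variable {k : Type*} [Field k] {L : Type*} [Field L] [Algebra k L]

/-- Two points satisfy the same homogeneous equations. -/
def SameEquations {Ω : Type*} [CommRing Ω] [Algebra k Ω] (P : Fin 3 → L) (P' : Fin 3 → Ω) : Prop :=
  ∀ (n : ℕ) (h : PlaneRing k), h.IsHomogeneous n → (aeval P' h = 0 ↔ aeval P h = 0)

/-- The equations of a point are those of the cone over it. -/
def IsConical (P : Fin 3 → L) : Prop :=
  ∀ h : PlaneRing k, aeval P h = 0 → ∀ c : L, aeval (c • P) h = 0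

theorem IsConical.component [Infinite L] {P : Fin 3 → L} (hP : IsConical (k := k) P)
    {h : PlaneRing k} (hh : aeval P h = 0) (i : ℕ) : aeval P (homogeneousComponent i h) = 0 := by
  obtain ⟨p, hp, hp'⟩ := exists_polynomial_smul P h
  have : p = 0 := Polynomial.funext fun c => by rw [hp', hP h hh]; simp
  rw [← hp, this, Polynomial.coeff_zero]

theorem SameEquations.eq_zero [Infinite L] {P : Fin 3 → L} (hP : IsConical (k := k) P)
    {Ω : Type*} [CommRing Ω] [Algebra k Ω] {P' : Fin 3 → Ω} (h : SameEquations (k := k) P P')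
    (f : PlaneRing k) (hf : aeval P f = 0) : aeval P' f = 0 := by
  rw [← sum_homogeneousComponent f, map_sum]
  exact Finset.sum_eq_zero fun i _ =>
    (h i _ (homogeneousComponent_isHomogeneous i f)).2 (hP.component hf i)

theorem SameEquations.smul {P : Fin 3 → L} {Ω : Type*} [Field Ω] [Algebra k Ω] {P' : Fin 3 → Ω}
    (h : SameEquations (k := k) P P') {c : Ω} (hc : c ≠ 0) : SameEquations (k := k) P (c • P') :=
  fun n f hf => by rw [aeval_smul_eq_zero_iff hf hc, h n f hf]

theorem SameEquations.of_smul {P : Fin 3 → L} {Ω : Type*} [Field Ω] [Algebra k Ω] {P' : Fin 3 → Ω}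
    {c : Ω} (h : SameEquations (k := k) P (c • P')) (hc : c ≠ 0) : SameEquations (k := k) P P' :=
  fun n f hf => by rw [← h n f hf, aeval_smul_eq_zero_iff hf hc]

end Cone

/-! ### Eliminating the second point: rational and irrational square roots. -/

section Substitution

variable {k : Type*} [Field k]

/-- Substitution of `[x(bz + a) : y(bz + a) : za]` for the second point. -/
def ratioHom (a b : PlaneRing k) : ProdRing k →ₐ[k] PlaneRing k :=
  aeval (Sum.elim X (pt X (b * X 2 + a) a))

theorem aeval_ratioHom (a b : PlaneRing k) {Ω : Type*} [CommRing Ω] [Algebra k Ω] (P : Fin 3 → Ω)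
    (f : ProdRing k) : aeval P (ratioHom a b f) =
      aeval (Sum.elim P (pt P (aeval P b * P 2 + aeval P a) (aeval P a))) f := by
  rw [← AlgHom.comp_apply]
  congr 1
  apply algHom_ext
  rintro (i | i)
  · simp [ratioHom]
  · fin_cases i <;> simp [ratioHom]

/-- Substitution of `[x(z + t) : y(z + t) : zt]` for the second point, with a variable `t`. -/
def secantHom : ProdRing k →ₐ[k] Polynomial (PlaneRing k) :=
  aeval (Sum.elim (fun i => Polynomial.C (X i))
    (pt (fun i => Polynomial.C (X i)) (Polynomial.C (X 2) + Polynomial.X) Polynomial.X))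

theorem eval₂_secantHom {Ω : Type*} [CommRing Ω] [Algebra k Ω] (P : Fin 3 → Ω) (t : Ω)
    (f : ProdRing k) : (secantHom f).eval₂ ((aeval P : PlaneRing k →ₐ[k] Ω) : PlaneRing k →+* Ω) t =
      aeval (Sum.elim P (pt P (P 2 + t) t)) f := by
  rw [← Polynomial.coe_eval₂RingHom, ← AlgHom.coe_toRingHom, ← RingHom.comp_apply,
    ← AlgHom.coe_toRingHom]
  congr 1
  apply ringHom_ext
  · intro r
    simp only [RingHom.comp_apply, RingHom.coe_coe, algHom_C]
    rw [IsScalarTower.algebraMap_apply k (PlaneRing k) (Polynomial (PlaneRing k)), algebraMap_eq,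
      Polynomial.algebraMap_eq, Polynomial.coe_eval₂RingHom, Polynomial.eval₂_C]
    simp
  · rintro (i | i)
    · simp [secantHom]
    · fin_cases i <;> simp [secantHom]

/-- Division by the monic polynomial t² - uv. At a square root t of uv the value of f on the
incident pair is then r + s t, with r and s independent of the choice of root. -/
theorem exists_secantHom_eq (A : Axes k) (f : ProdRing k) : ∃ (r s : PlaneRing k)
    (g : Polynomial (PlaneRing k)), secantHom f = Polynomial.C r + Polynomial.C s * Polynomial.X +
      (Polynomial.X ^ 2 - Polynomial.C A.normPoly) * g := by
  have hm := Polynomial.monic_X_pow_sub_C A.normPoly (n := 2) two_ne_zero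
  have hd : (secantHom f %ₘ (Polynomial.X ^ 2 - Polynomial.C A.normPoly)).natDegree ≤ 1 := by
    have := Polynomial.natDegree_modByMonic_lt (secantHom f) hm (by
      intro h; have := congrArg Polynomial.natDegree h
      rw [Polynomial.natDegree_X_pow_sub_C] at this; simp at this)
    rw [Polynomial.natDegree_X_pow_sub_C] at this
    omega
  obtain ⟨s, r, h⟩ := Polynomial.exists_eq_X_add_C_of_natDegree_le_one hd
  refine ⟨r, s, secantHom f /ₘ (Polynomial.X ^ 2 - Polynomial.C A.normPoly), ?_⟩
  conv_lhs => rw [← Polynomial.modByMonic_add_div (secantHom f) (Polynomial.X ^ 2 - Polynomial.C A.normPoly), h]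
  ring

end Substitution

namespace IsGeneric

variable {k : Type*} [Field k] {L : Type*} [Field L] [Algebra k L]
  {q : Ideal (ProdRing k)} {P Q : Fin 3 → L}

/-- The weighted components of an element of q lie in q, as is seen at the generic point. Hence
every zero of q, in any algebra, can be rescaled. -/
theorem eval_weight_eq_zero [Infinite L] (hg : IsGeneric q P Q) (w : Fin 3 ⊕ Fin 3 → ℕ)
    (hw : ∀ f ∈ q, ∀ c : L, aeval (fun i => c ^ w i * Sum.elim P Q i) f = 0)
    {Ω : Type*} [CommRing Ω] [Algebra k Ω] {R : Fin 3 ⊕ Fin 3 → Ω} (hR : ∀ f ∈ q, aeval R f = 0)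
    (c : Ω) : ∀ f ∈ q, aeval (fun i => c ^ w i * R i) f = 0 := by
  intro f hf
  obtain ⟨p, hp, hp'⟩ := exists_polynomial_weight w (Sum.elim P Q) f
  obtain ⟨r, hr, hr'⟩ := exists_polynomial_weight w R f
  have h0 : p = 0 := Polynomial.funext fun c => by rw [hp', hw f hf, Polynomial.eval_zero]
  have h1 : r = 0 := by
    ext i
    rw [hr, Polynomial.coeff_zero, hR]
    rw [hg.mem_iff, ← hp, h0, Polynomial.coeff_zero]
  rw [← hr', h1, Polynomial.eval_zero]

theorem eval_smul_eq_zero [Infinite L] (hg : IsGeneric q P Q) {Ω : Type*} [CommRing Ω]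
    [Algebra k Ω] {P' Q' : Fin 3 → Ω} (h : ∀ f ∈ q, aeval (Sum.elim P' Q') f = 0) (c₁ c₂ : Ω) :
    ∀ f ∈ q, aeval (Sum.elim (c₁ • P') (c₂ • Q')) f = 0 := by
  have h1 := hg.eval_weight_eq_zero (Sum.elim 1 0) (fun f hf c => by
    have := hg.scale f hf c 1
    refine Eq.trans (congrArg (fun g => aeval g f) ?_) this
    funext i
    rcases i with i | i <;> simp) h c₁
  have h2 := hg.eval_weight_eq_zero (Sum.elim 0 1) (fun f hf c => by
    have := hg.scale f hf 1 c
    refine Eq.trans (congrArg (fun g => aeval g f) ?_) this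
    funext i
    rcases i with i | i <;> simp) h1 c₂
  intro f hf
  refine Eq.trans (congrArg (fun g => aeval g f) ?_) (h2 f hf)
  funext i
  rcases i with i | i <;> simp

theorem isConical_fst (hg : IsGeneric q P Q) : IsConical (k := k) P := by
  intro h hh c
  have := hg.scale (rename Sum.inl h) ((hg.mem_iff _).2 (by rw [aeval_rename]; simpa using hh)) c 1
  rwa [aeval_rename, Sum.elim_comp_inl] at this

theorem isConical_snd (hg : IsGeneric q P Q) : IsConical (k := k) Q := by
  intro h hh c
  have := hg.scale (rename Sum.inr h) ((hg.mem_iff _).2 (by rw [aeval_rename]; simpa using hh)) 1 c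
  rwa [aeval_rename, Sum.elim_comp_inr] at this

theorem swap (hg : IsGeneric q P Q) :
    IsGeneric (q.comap (rename Sum.swap : ProdRing k →ₐ[k] ProdRing k)) Q P := by
  have h : ∀ P Q : Fin 3 → L, Sum.elim P Q ∘ Sum.swap = Sum.elim Q P := by
    intro P Q; funext i; cases i <;> rfl
  refine ⟨fun f => ?_, fun f hf c₁ c₂ => ?_⟩
  · rw [Ideal.mem_comap, hg.mem_iff, aeval_rename, h]
  · rw [Ideal.mem_comap] at hf
    have := hg.scale _ hf c₂ c₁
    rwa [aeval_rename, h] at this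

variable {ρ α : L}

/-- With ρ = a/b, clearing the denominator turns f into a polynomial in the first point alone. It
vanishes at P, hence at every specialisation P' of P: zeros of q lift along a rational root. -/
theorem eval_pt_eq_zero (hg : IsGeneric q P Q) (hα : α ≠ 0) (hQ : Q = α • pt P (P 2 + ρ) ρ)
    {a b : PlaneRing k} (hab : aeval P a = aeval P b * ρ) {Ω : Type*} [CommRing Ω] [Algebra k Ω]
    {P' : Fin 3 → Ω} (hP' : ∀ h : PlaneRing k, aeval P h = 0 → aeval P' h = 0)
    {f : ProdRing k} (hf : f ∈ q) :
    aeval (Sum.elim P' (pt P' (aeval P' b * P' 2 + aeval P' a) (aeval P' a))) f = 0 := by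
  rw [← aeval_ratioHom]
  apply hP'
  have h1 := hg.scale f hf 1 (aeval P b / α)
  rw [aeval_ratioHom, hab, ← mul_add, ← smul_pt]
  rwa [one_smul, hQ, smul_smul, div_mul_cancel₀ _ hα] at h1

/-- The relation is Xᵢ/Z = xᵢ(z + ρ)/(zρ) with ρ = a/b. As it comes from an element of q it holds at
all zeros of q, where it recovers the second point and shows which of the two roots q carries. -/
theorem relation (hg : IsGeneric q P Q) (hQ : Q = α • pt P (P 2 + ρ) ρ)
    {a b : PlaneRing k} (hab : aeval P a = aeval P b * ρ) {Ω : Type*} [CommRing Ω] [Algebra k Ω]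
    {P' Q' : Fin 3 → Ω} (h : ∀ f ∈ q, aeval (Sum.elim P' Q') f = 0) {i : Fin 3} (hi : i ≠ 2) :
    Q' i * P' 2 * aeval P' a = Q' 2 * P' i * (aeval P' b * P' 2 + aeval P' a) := by
  have := h (X (Sum.inr i) * X (Sum.inl 2) * rename Sum.inl a -
    X (Sum.inr 2) * X (Sum.inl i) * (rename Sum.inl b * X (Sum.inl 2) + rename Sum.inl a)) (by
      rw [hg.mem_iff]
      simp only [map_sub, map_mul, map_add, aeval_X, aeval_rename, Sum.elim_inl, Sum.elim_inr,
        Sum.elim_comp_inl]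
      have : Q i = α * (P i * (P 2 + ρ)) := by
        rw [hQ]; fin_cases i <;> simp_all
      rw [this, hab, hQ]; simp; ring)
  simpa only [map_sub, map_mul, map_add, aeval_X, aeval_rename, Sum.elim_inl, Sum.elim_inr,
        Sum.elim_comp_inl, sub_eq_zero] using this

/-- If ρ is irrational over P, then r + sρ = 0 forces r = s = 0 at P. The equations in q then do not
see the sign of the root, so both square roots over every specialisation give zeros of q. -/
theorem eval_pt_of_not_ratio (hg : IsGeneric q P Q) (hα : α ≠ 0) {A : Axes k}
    (hρ : ρ ^ 2 = A.norm (P 0) (P 1)) (hQ : Q = α • pt P (P 2 + ρ) ρ)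
    (hab : ∀ a b : PlaneRing k, aeval P a = aeval P b * ρ → aeval P b = 0)
    {Ω : Type*} [CommRing Ω] [Algebra k Ω]
    {P' : Fin 3 → Ω} (hP' : ∀ h : PlaneRing k, aeval P h = 0 → aeval P' h = 0)
    {t : Ω} (ht : t ^ 2 = A.norm (P' 0) (P' 1)) {f : ProdRing k} (hf : f ∈ q) :
    aeval (Sum.elim P' (pt P' (P' 2 + t) t)) f = 0 := by
  obtain ⟨r, s, g, h⟩ := exists_secantHom_eq A f
  have hL := eval₂_secantHom P ρ f
  have hΩ := eval₂_secantHom P' t f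
  rw [h] at hL hΩ
  simp only [Polynomial.eval₂_add, Polynomial.eval₂_mul, Polynomial.eval₂_sub, Polynomial.eval₂_pow,
    Polynomial.eval₂_C, Polynomial.eval₂_X, Axes.aeval_normPoly, hρ, ht,
    RingHom.coe_coe, sub_self, zero_mul, add_zero] at hL hΩ
  have h1 := hg.scale f hf 1 α⁻¹
  rw [one_smul, hQ, smul_smul, inv_mul_cancel₀ hα, one_smul] at h1
  rw [h1] at hL
  have hs : aeval P s = 0 := hab (-r) s (by rw [map_neg]; linear_combination -hL)
  rw [← hΩ, hP' s hs, hP' r (by simpa [hs] using hL)]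
  simp

/-- Bihomogeneity of q makes ρ scale like a coordinate: a(cP) = cρ b(cP) for all c. Comparing
coefficients pairs the component of a of degree m + 1 with that of b of degree m. -/
theorem exists_homogeneous_ratio [Infinite L] (hg : IsGeneric q P Q) (hα : α ≠ 0) {i : Fin 3}
    (hi : i ≠ 2) (hPi : P i ≠ 0) (hP2 : P 2 ≠ 0) (hQ : Q = α • pt P (P 2 + ρ) ρ) {a b : PlaneRing k}
    (hb : aeval P b ≠ 0) (hab : aeval P a = aeval P b * ρ) :
    ∃ (m : ℕ) (a' b' : PlaneRing k), a'.IsHomogeneous (m + 1) ∧ b'.IsHomogeneous m ∧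
      aeval P b' ≠ 0 ∧ aeval P a' = aeval P b' * ρ := by
  obtain ⟨p, hp, hp'⟩ := exists_polynomial_smul P a
  obtain ⟨r, hr, hr'⟩ := exists_polynomial_smul P b
  -- This is a(cP) = cρ b(cP) with a superfluous factor c, since both sides of `relation` contain a
  -- coordinate of cP.
  have key : p * Polynomial.X = Polynomial.X ^ 2 * Polynomial.C ρ * r := by
    apply Polynomial.funext
    intro c
    have h := hg.relation hQ hab (P' := c • P) (Q' := Q)
      (fun f hf => by simpa using hg.scale f hf c 1) hi
    have hQi : Q i = α * (P i * (P 2 + ρ)) := by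
      rw [hQ]; fin_cases i <;> simp_all
    have hQ2 : Q 2 = α * (P 2 * ρ) := by rw [hQ]; simp
    rw [hQi, hQ2] at h
    simp only [Polynomial.eval_mul, Polynomial.eval_X, Polynomial.eval_pow, Polynomial.eval_C, hp',
      hr']
    simp only [Pi.smul_apply, smul_eq_mul] at h
    apply mul_left_cancel₀ (mul_ne_zero (mul_ne_zero hα hPi) (mul_ne_zero hP2 hP2))
    linear_combination h
  have hr0 : r ≠ 0 := by
    intro h0
    apply hb
    have := hr' 1
    rw [h0, one_smul] at this
    simpa using this.symm
  obtain ⟨m, hm⟩ : ∃ m, r.coeff m ≠ 0 := by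
    by_contra! h; exact hr0 (Polynomial.ext (by simpa using h))
  refine ⟨m, homogeneousComponent (m + 1) a, homogeneousComponent m b,
    homogeneousComponent_isHomogeneous _ _, homogeneousComponent_isHomogeneous _ _, ?_, ?_⟩
  · rwa [← hr]
  · rw [← hr, ← hp]
    have := congrArg (fun f => f.coeff (m + 2)) key
    rw [show m + 2 = (m + 1) + 1 from rfl, Polynomial.coeff_mul_X, mul_assoc,
      show (m + 1) + 1 = m + 2 from rfl, Polynomial.coeff_X_pow_mul, Polynomial.coeff_C_mul] at this
    rw [this, mul_comm]

/-- A form of degree n composed with the substitution is a form of degree (m + 2)n, so homogeneous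
equations are transported from the first point to the second. -/
theorem sameEquations_pt (hα : α ≠ 0) (hQ : Q = α • pt P (P 2 + ρ) ρ)
    {m : ℕ} {a b : PlaneRing k} (ha : a.IsHomogeneous (m + 1)) (hb : b.IsHomogeneous m)
    (hb0 : aeval P b ≠ 0) (hab : aeval P a = aeval P b * ρ) {Ω : Type*} [CommRing Ω] [Algebra k Ω]
    {P' : Fin 3 → Ω} (hP' : SameEquations (k := k) P P') :
    SameEquations (k := k) Q (pt P' (aeval P' b * P' 2 + aeval P' a) (aeval P' a)) := by
  intro n h hh
  have h1 : aeval (pt P' (aeval P' b * P' 2 + aeval P' a) (aeval P' a)) h =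
      aeval P' (ratioHom a b (rename Sum.inr h)) := by
    rw [aeval_ratioHom, aeval_rename, Sum.elim_comp_inr]
  have h2 : aeval (pt P (aeval P b * P 2 + aeval P a) (aeval P a)) h =
      aeval P (ratioHom a b (rename Sum.inr h)) := by
    rw [aeval_ratioHom, aeval_rename, Sum.elim_comp_inr]
  have hhom : (ratioHom a b (rename Sum.inr h)).IsHomogeneous ((m + 2) * n) := by
    rw [ratioHom, aeval_rename, Sum.elim_comp_inr]
    refine hh.aeval _ fun i => ?_
    have e : (b * X 2 + a).IsHomogeneous (m + 1) := (hb.mul (isHomogeneous_X _ 2)).add ha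
    have : m + 2 = 1 + (m + 1) := by ring
    rw [this]
    fin_cases i
    · exact (isHomogeneous_X _ _).mul e
    · exact (isHomogeneous_X _ _).mul e
    · exact (isHomogeneous_X _ _).mul ha
  rw [h1, hP' _ _ hhom, ← h2, hab, ← mul_add, ← smul_pt, aeval_smul_eq_zero_iff hh hb0, hQ,
    aeval_smul_eq_zero_iff hh hα]

end IsGeneric

/-! ### Heights: the projections of a component have principal ideals of equations. -/

section Height

variable {k : Type*} [Field k]

/-- The points whose first projection is `P`. -/
def fiberHom {L : Type*} [CommRing L] [Algebra k L] (P : Fin 3 → L) :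
    ProdRing k →ₐ[k] MvPolynomial (Fin 3) L :=
  aeval (Sum.elim (fun i => C (P i)) X)

theorem fiberHom_rename {L : Type*} [CommRing L] [Algebra k L] (P : Fin 3 → L) (f : PlaneRing k) :
    fiberHom P (rename Sum.inl f) = C (aeval P f) := by
  have : (aeval (fun i => C (P i)) : PlaneRing k →ₐ[k] MvPolynomial (Fin 3) L) =
      (IsScalarTower.toAlgHom k L _).comp (aeval P) := by
    apply algHom_ext; intro i; simp
  rw [fiberHom, aeval_rename, Sum.elim_comp_inl, this]; rfl

theorem aeval_mk (I : Ideal (PlaneRing k)) (f : PlaneRing k) :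
    aeval (fun i => Ideal.Quotient.mk I (X i)) f = Ideal.Quotient.mk I f := by
  have : (aeval (fun i => Ideal.Quotient.mk I (X i)) : PlaneRing k →ₐ[k] PlaneRing k ⧸ I) =
      Ideal.Quotient.mkₐ k I := by
    apply algHom_ext; intro i; simp
  rw [this]; rfl

/-- Along the chain 0 ⊂ J₁ ⊂ J₂ ⊂ J₃ ⊂ q, J₁ keeps only the equation H of the first point, J₂ all
equations of P with the second point free, J₃ puts the second point on the line AP, and q adds the
remaining incidence equation. The equation e not divisible by H makes J₁ ≠ J₂. Against
`height_le_three` this shows that no such e exists. -/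
theorem four_le_height {A : Axes k} {d : k} (hd : d ≠ 0) {L : Type*} [Field L] [Algebra k L]
    {q : Ideal (ProdRing k)} [hq : q.IsPrime] [q.FiniteHeight] {P Q : Fin 3 → L}
    (hPQ : ∀ f, f ∈ q ↔ aeval (Sum.elim P Q) f = 0)
    (hinc : A.Incident P Q) {i : Fin 3} (hi : i ≠ 2) (hPi : P i ≠ 0)
    (hn : P 2 = 0 → A.norm (P 0) (P 1) ≠ 0) {H e : PlaneRing k} (hH : Prime H)
    (hPH : aeval P H = 0) (hPe : aeval P e = 0) (hHe : ¬ H ∣ e) : 4 ≤ q.height := by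
  have : (Ideal.span {H}).IsPrime := (Ideal.span_singleton_prime hH.ne_zero).2 hH
  let J₁ : Ideal (ProdRing k) :=
    RingHom.ker (fiberHom (fun i => Ideal.Quotient.mk (Ideal.span {H}) (X i)) : ProdRing k →ₐ[k] _)
  let J₂ : Ideal (ProdRing k) := RingHom.ker (fiberHom P : ProdRing k →ₐ[k] _)
  let x : Fin 3 → MvPolynomial (Fin 2) L := fun i => C (P i)
  let y : Fin 3 → MvPolynomial (Fin 2) L := ![C (P 0) * X 0, C (P 1) * X 0, X 1]
  let J₃ : Ideal (ProdRing k) :=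
    RingHom.ker (aeval (Sum.elim x y) : ProdRing k →ₐ[k] MvPolynomial (Fin 2) L)
  have i₁ : J₁.IsPrime := RingHom.ker_isPrime _
  have i₂ : J₂.IsPrime := RingHom.ker_isPrime _
  have i₃ : J₃.IsPrime := RingHom.ker_isPrime _
  have h₀₁ : ⊥ < J₁ := by
    rw [bot_lt_iff_ne_bot, Submodule.ne_bot_iff]
    refine ⟨rename Sum.inl H, ?_, ?_⟩
    · rw [RingHom.mem_ker, fiberHom_rename, aeval_mk,
        Ideal.Quotient.eq_zero_iff_mem.2 (Ideal.mem_span_singleton_self H), C_0]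
    · rw [Ne, map_eq_zero_iff _ (rename_injective _ Sum.inl_injective)]
      exact hH.ne_zero
  have h₁₂ : J₁ < J₂ := by
    refine lt_of_le_of_ne (fun f hf => ?_) fun h => ?_
    · let ψ : (PlaneRing k ⧸ Ideal.span {H}) →ₐ[k] L := Ideal.Quotient.liftₐ _ (aeval P)
        (fun a ha => by
          obtain ⟨c, rfl⟩ := Ideal.mem_span_singleton.1 ha
          rw [map_mul, hPH, zero_mul])
      have : (fiberHom P : ProdRing k →ₐ[k] _) = (mapAlgHom ψ).comp
          (fiberHom (fun i => Ideal.Quotient.mk (Ideal.span {H}) (X i))) := by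
        apply algHom_ext
        rintro (i | i)
        · have : ψ (Ideal.Quotient.mk _ (X i)) = P i := by
            rw [← aeval_X (R := k) P i]; rfl
          simp [fiberHom, this]
        · simp [fiberHom]
      rw [RingHom.mem_ker, this, AlgHom.comp_apply, RingHom.mem_ker.1 hf, map_zero]
    · have : rename Sum.inl e ∈ J₂ := by
        rw [RingHom.mem_ker, fiberHom_rename, hPe, C_0]
      rw [← h, RingHom.mem_ker, fiberHom_rename, aeval_mk, C_eq_zero,
        Ideal.Quotient.eq_zero_iff_mem, Ideal.mem_span_singleton] at this
      exact hHe this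
  have h₂₃ : J₂ < J₃ := by
    refine lt_of_le_of_ne (fun f hf => ?_) fun h => ?_
    · have : (aeval (Sum.elim x y) : ProdRing k →ₐ[k] MvPolynomial (Fin 2) L) =
          ((aeval y : MvPolynomial (Fin 3) L →ₐ[L] _).restrictScalars k).comp (fiberHom P) := by
        apply algHom_ext
        rintro (i | i) <;> simp [fiberHom, x]
      rw [RingHom.mem_ker, this, AlgHom.comp_apply, RingHom.mem_ker.1 hf, map_zero]
    · have : (X (Sum.inl 0) * X (Sum.inr 1) - X (Sum.inl 1) * X (Sum.inr 0) : ProdRing k) ∈ J₃ := by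
        simp [J₃, RingHom.mem_ker, x, y]; ring
      rw [← h, RingHom.mem_ker] at this
      simp only [fiberHom, map_sub, map_mul, aeval_X, Sum.elim_inl, Sum.elim_inr] at this
      have e0 := congrArg (aeval (![0, 1, 0] : Fin 3 → L)) this
      have e1 := congrArg (aeval (![1, 0, 0] : Fin 3 → L)) this
      simp at e0 e1
      fin_cases i
      · exact hPi e0
      · exact hPi e1
      · exact hi rfl
  have h₃ : J₃ < q := by
    refine lt_of_le_of_ne (fun f hf => ?_) fun h => ?_
    · have : (aeval (Sum.elim P Q) : ProdRing k →ₐ[k] L) =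
          ((aeval ![Q i / P i, Q 2] : MvPolynomial (Fin 2) L →ₐ[L] _).restrictScalars k).comp
            (aeval (Sum.elim x y)) := by
        apply algHom_ext
        have := hinc.2
        rintro (j | j)
        · simp [x]
        · fin_cases i
          · fin_cases j <;> simp [y] <;> field_simp [show P 0 ≠ 0 from hPi]
            all_goals grind
          · fin_cases j <;> simp [y] <;> field_simp [show P 1 ≠ 0 from hPi]
            all_goals grind
          · exact absurd rfl hi
      rw [hPQ, this, AlgHom.comp_apply, RingHom.mem_ker.1 hf, map_zero]
    -- If J₃ = q, every [xs : ys : t] would be incident with P. The choices (s, t) = (0, 1) and (1,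
    -- 0) give z² = uv and z²uv = 0, so z = uv = 0, which `hn` excludes.
    · have hI : incidenceIdeal (A.conic d) ≤ J₃ := by
        rw [h]
        intro f hf
        rw [hPQ]
        exact (incidenceIdeal_le_ker_iff hd P Q).2 hinc hf
      have hI' := (incidenceIdeal_le_ker_iff hd x y).1 hI
      have hev : ∀ s t : L, A.Incident P ![P 0 * s, P 1 * s, t] := by
        intro s t
        rw [← incidenceIdeal_le_ker_iff hd]
        have : (aeval (Sum.elim P ![P 0 * s, P 1 * s, t]) : ProdRing k →ₐ[k] L) =
          ((aeval ![s, t] : MvPolynomial (Fin 2) L →ₐ[L] _).restrictScalars k).comp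
            (aeval (Sum.elim x y)) := by
          apply algHom_ext
          rintro (j | j)
          · simp [x]
          · fin_cases j <;> simp [y]
        intro f hf
        rw [RingHom.mem_ker, this, AlgHom.comp_apply, RingHom.mem_ker.1 (hI hf), map_zero]
      have e0 := (hev 0 1).1
      have e1 := (hev 1 0).1
      simp only [Matrix.cons_val, mul_zero, mul_one, zero_sub, sub_zero] at e0 e1
      have n0 : A.norm (-P 0) (-P 1) = A.norm (P 0) (P 1) := by
        have := A.norm_mul (P 0) (P 1) (-1)
        simpa using this
      have n1 := A.norm_mul (P 0) (P 1) (P 2)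
      rw [mul_comm (P 2), mul_comm (P 2), n1] at e1
      rw [n0] at e0
      have : P 2 = 0 := by
        by_contra hP2
        rw [← e0] at e1
        simp [hP2] at e1
      exact hn this (by rw [← e0, this]; simp)
  have i₀ : (⊥ : Ideal (ProdRing k)).IsPrime := Ideal.isPrime_bot
  have s₃ := Ideal.height_strict_mono_of_isPrime_of_isPrime h₃
  have f₃ : J₃.FiniteHeight := ⟨.inr (s₃.trans_le le_top).ne⟩
  have s₂ := Ideal.height_strict_mono_of_isPrime_of_isPrime h₂₃
  have f₂ : J₂.FiniteHeight := ⟨.inr (s₂.trans_le le_top).ne⟩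
  have s₁ := Ideal.height_strict_mono_of_isPrime_of_isPrime h₁₂
  have f₁ : J₁.FiniteHeight := ⟨.inr (s₁.trans_le le_top).ne⟩
  have s₀ := Ideal.height_strict_mono_of_isPrime_of_isPrime h₀₁
  have t₁ : 1 ≤ J₁.height := by simpa using Order.add_one_le_of_lt s₀
  have t₂ : 2 ≤ J₂.height := by
    have := Order.add_one_le_of_lt (t₁.trans_lt s₁); rwa [one_add_one_eq_two] at this
  have t₃ : 3 ≤ J₃.height := by
    have := Order.add_one_le_of_lt (t₂.trans_lt s₂); rwa [two_add_one_eq_three] at this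
  have := Order.add_one_le_of_lt (t₃.trans_lt s₃); rwa [three_add_one_eq_four] at this

/-- Krull's height theorem for the three generators. -/
theorem height_le_three {F G : PlaneRing k} {q : Ideal (ProdRing k)}
    (hq : q ∈ (pullbackIdeal F G).minimalPrimes) : q.height ≤ 3 := by
  rw [pullbackIdeal, incidenceIdeal, ← Ideal.span_union] at hq
  refine (Ideal.height_le_card_of_mem_minimalPrimes_span (by simp) hq).trans ?_
  have : ∀ a b c : ProdRing k, ({a, b} ∪ {c} : Set (ProdRing k)).ncard ≤ 3 := by
    intro a b c
    rw [Set.union_singleton]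
    refine (Set.ncard_insert_le _ _).trans ?_
    have := Set.ncard_insert_le a {b}
    rw [Set.ncard_singleton] at this
    omega
  exact_mod_cast this _ _ _

/-- The equations of the first projection of a component of `π₁⁻¹(C)` are generated by any
irreducible one. -/
theorem dvd_of_aeval_fst_eq_zero {A : Axes k} {d : k} (hd : d ≠ 0) {G : PlaneRing k} {L : Type*}
    [Field L] [Algebra k L] {q : Ideal (ProdRing k)}
    (hq : q ∈ (pullbackIdeal (A.conic d) G).minimalPrimes) {P Q : Fin 3 → L}
    (hPQ : ∀ f, f ∈ q ↔ aeval (Sum.elim P Q) f = 0) {i : Fin 3} (hi : i ≠ 2) (hPi : P i ≠ 0)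
    (hn : P 2 = 0 → A.norm (P 0) (P 1) ≠ 0) {H e : PlaneRing k} (hH : Prime H)
    (hPH : aeval P H = 0) (hPe : aeval P e = 0) : H ∣ e := by
  by_contra hHe
  have := hq.1.1
  have hinc := ((pullbackIdeal_le_ker_iff hd G P Q).1 fun f hf => (hPQ f).1 (hq.1.2 hf)).1
  have h3 := height_le_three hq
  have : q.FiniteHeight := ⟨.inr (h3.trans_lt (by decide)).ne⟩
  have := (four_le_height hd hPQ hinc hi hPi hn hH hPH hPe hHe).trans h3
  exact absurd this (by decide)

/-- The equations of the second projection of a component of `π₁⁻¹(C)` are generated by any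
irreducible one. -/
theorem dvd_of_aeval_snd_eq_zero {A : Axes k} {d : k} (hd : d ≠ 0) {G : PlaneRing k} {L : Type*}
    [Field L] [Algebra k L] {q : Ideal (ProdRing k)}
    (hq : q ∈ (pullbackIdeal (A.conic d) G).minimalPrimes) {P Q : Fin 3 → L}
    (hg : IsGeneric q P Q) {i : Fin 3} (hi : i ≠ 2) (hQi : Q i ≠ 0)
    (hn : Q 2 = 0 → A.norm (Q 0) (Q 1) ≠ 0) {H e : PlaneRing k} (hH : Prime H)
    (hQH : aeval Q H = 0) (hQe : aeval Q e = 0) : H ∣ e := by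
  by_contra hHe
  have := hq.1.1
  have hinc := ((pullbackIdeal_le_ker_iff hd G P Q).1 fun f hf => (hg.mem_iff f).1 (hq.1.2 hf)).1
  have h3 := height_le_three hq
  -- Incidence is symmetric, so exchanging the two factors reduces the second projection to the
  -- first.
  let e₁ : ProdRing k ≃+* ProdRing k := (renameEquiv k (Equiv.sumComm (Fin 3) (Fin 3))).toRingEquiv
  have he : q.comap (rename Sum.swap : ProdRing k →ₐ[k] ProdRing k) = q.comap e₁ := rfl
  have h3' : (q.comap (rename Sum.swap : ProdRing k →ₐ[k] ProdRing k)).height ≤ 3 := by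
    rw [he, RingEquiv.height_comap]; exact h3
  have : (q.comap (rename Sum.swap : ProdRing k →ₐ[k] ProdRing k)).FiniteHeight :=
    ⟨.inr (h3'.trans_lt (by decide)).ne⟩
  have := (four_le_height hd hg.swap.mem_iff hinc.symm hi hQi hn hH hQH hQe hHe).trans h3'
  exact absurd this (by decide)

end Height

/-! ### Exceptional curves, and the shape of the components that do not lie over them. -/

section Exceptional

variable {k : Type*} [Field k]

theorem PrimeCurve.ext {D D' : PrimeCurve k} (h : D.ideal = D'.ideal) : D = D' := by
  cases D; cases D'; simp only at h; subst h; rfl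

/-- Two lines through the origin and the same point at infinity coincide. -/
theorem IsLineThroughOriginAnd.mem_iff {P : Plane k} (hP : P.rep 2 = 0) {ℓ ℓ' : PlaneRing k}
    (hℓ : IsLineThroughOriginAnd ℓ P) (hℓ' : IsLineThroughOriginAnd ℓ' P) (I : Ideal (PlaneRing k)) :
    ℓ ∈ I ↔ ℓ' ∈ I := by
  have e : P.rep = ![P.rep 0, -(-P.rep 1), 0] := by
    funext i; fin_cases i <;> simp [hP]
  have h0 : (![P.rep 0, -(-P.rep 1), 0] : Fin 3 → k) ≠ 0 := e ▸ P.rep_nonzero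
  have hm : -P.rep 1 ≠ 0 ∨ P.rep 0 ≠ 0 := by
    by_contra! h
    apply h0; funext i; fin_cases i <;> simp [h.2, neg_eq_zero.1 h.1]
  have hPe : P = Projectivization.mk k _ h0 := by
    conv_lhs => rw [← P.mk_rep]
    congr
  rw [hPe] at hℓ hℓ'
  obtain ⟨c, hc, rfl⟩ := hℓ.eq hm
  obtain ⟨c', hc', rfl⟩ := hℓ'.eq hm
  have hu : ∀ c : k, c ≠ 0 → IsUnit (C c : PlaneRing k) := fun c hc => (IsUnit.mk0 c hc).map _
  rw [Ideal.unit_mul_mem_iff_mem _ (hu c hc), Ideal.unit_mul_mem_iff_mem _ (hu c' hc')]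

theorem isExceptional_iff {A : Axes k} {d c₁ c₂ : k} (hc₁ : c₁ ≠ 0) (hc₂ : c₂ ≠ 0)
    {P₁ P₂ : Plane k} (hP : pointsAtInfinity (A.conic d) = {P₁, P₂})
    (hℓ₁ : IsLineThroughOriginAnd (C c₁ * A.uPoly) P₁)
    (hℓ₂ : IsLineThroughOriginAnd (C c₂ * A.vPoly) P₂) (D : PrimeCurve k) :
    IsExceptional (A.conic d) D ↔ A.conic d ∈ D.ideal ∨ A.uPoly ∈ D.ideal ∨ A.vPoly ∈ D.ideal := by
  have hu : ∀ c : k, c ≠ 0 → IsUnit (C c : PlaneRing k) := fun c hc => (IsUnit.mk0 c hc).map _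
  have h₁ : P₁ ∈ pointsAtInfinity (A.conic d) := by rw [hP]; simp
  have h₂ : P₂ ∈ pointsAtInfinity (A.conic d) := by rw [hP]; simp
  unfold IsExceptional
  refine or_congr_right ⟨?_, ?_⟩
  · rintro ⟨P, hPm, ℓ, hℓ, hD⟩
    have hP2 := hPm.2
    rw [hP] at hPm
    rcases hPm with rfl | rfl
    · left
      rwa [hℓ.mem_iff hP2 hℓ₁, Ideal.unit_mul_mem_iff_mem _ (hu c₁ hc₁)] at hD
    · right
      rwa [hℓ.mem_iff hP2 hℓ₂, Ideal.unit_mul_mem_iff_mem _ (hu c₂ hc₂)] at hD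
  · rintro (h | h)
    · exact ⟨P₁, h₁, _, hℓ₁, Ideal.mul_mem_left _ _ h⟩
    · exact ⟨P₂, h₂, _, hℓ₂, Ideal.mul_mem_left _ _ h⟩

end Exceptional

section Component

variable {k : Type*} [Field k] {A : Axes k} {d : k} {G : PlaneRing k} {L : Type*} [Field L]
  [Algebra k L] {q : Ideal (ProdRing k)} {P Q : Fin 3 → L}

theorem Axes.u_ne_zero_or_v_ne_zero (A : Axes k) {i : Fin 3} (hi : i ≠ 2) (hPi : P i ≠ 0) :
    A.u (P 0) (P 1) ≠ 0 ∨ A.v (P 0) (P 1) ≠ 0 := by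
  by_contra! h
  have := A.eq_zero_of_u_v h.1 h.2
  fin_cases i
  · exact hPi this.1
  · exact hPi this.2
  · exact hi rfl

theorem Axes.exists_ne_zero_of_norm_ne_zero (A : Axes k) (h : A.norm (P 0) (P 1) ≠ 0) :
    ∃ i : Fin 3, i ≠ 2 ∧ P i ≠ 0 := by
  by_contra! h'
  apply h
  rw [h' 0 (by decide), h' 1 (by decide), A.norm_zero]

theorem Axes.Incident.u_mul_v (h : A.Incident P Q) :
    A.u (P 0) (P 1) * A.v (Q 0) (Q 1) = A.v (P 0) (P 1) * A.u (Q 0) (Q 1) := by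
  simp only [Axes.u, Axes.v]
  linear_combination (algebraMap k L A.u₀ * algebraMap k L A.v₁ -
    algebraMap k L A.u₁ * algebraMap k L A.v₀) * h.2

/-- For P = A incidence reduces to F(Q) = 0, so a component whose image is not in B does not lie
over A. -/
theorem exists_fst_ne_zero (hinc : A.Incident P Q) (hP : ∃ i, P i ≠ 0)
    (hF : aeval Q (A.conic d) ≠ 0) : ∃ i : Fin 3, i ≠ 2 ∧ P i ≠ 0 := by
  by_contra! h
  have h0 := h 0 (by decide)
  have h1 := h 1 (by decide)
  have h2 : P 2 ≠ 0 := by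
    obtain ⟨i, hi⟩ := hP
    fin_cases i <;> simp_all
  apply hF
  have e := hinc.1
  simp only [h0, h1, zero_mul, sub_zero] at e
  rw [mul_comm (P 2) (Q 0), mul_comm (P 2) (Q 1),
    A.norm_mul] at e
  have : Q 2 ^ 2 = A.norm (Q 0) (Q 1) := by
    apply mul_right_cancel₀ (pow_ne_zero 2 h2); rw [← e]; ring
  simp [Axes.conic, this]

/-- P ≠ A and Q lie on a common line through A, so P can be on L₁ or L₂ only if Q is. -/
theorem norm_ne_zero_of_snd {i : Fin 3} (hi : i ≠ 2) (hPi : P i ≠ 0) (hinc : A.Incident P Q)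
    (hu : A.u (Q 0) (Q 1) ≠ 0) (hv : A.v (Q 0) (Q 1) ≠ 0) : A.norm (P 0) (P 1) ≠ 0 := by
  have := hinc.u_mul_v
  rcases A.u_ne_zero_or_v_ne_zero hi hPi with h | h
  · refine mul_ne_zero h fun h' => ?_
    rw [h', zero_mul] at this
    exact mul_ne_zero h hv this
  · refine mul_ne_zero (fun h' => ?_) h
    rw [h', zero_mul] at this
    exact mul_ne_zero h hu this.symm

/-- The generic point of a component of `π₁⁻¹(C)`. -/
structure IsComponentPoint (A : Axes k) (d : k) (G : PlaneRing k) (q : Ideal (ProdRing k))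
    (P Q : Fin 3 → L) (ρ α : L) : Prop where
  mem : q ∈ (pullbackIdeal (A.conic d) G).minimalPrimes
  generic : IsGeneric q P Q
  dvd_iff : ∀ h : PlaneRing k, aeval P h = 0 ↔ G ∣ h
  scale_ne_zero : α ≠ 0
  sq_eq : ρ ^ 2 = A.norm (P 0) (P 1)
  root_ne_zero : ρ ≠ 0
  fst_two_ne_zero : P 2 ≠ 0
  snd_eq : Q = α • pt P (P 2 + ρ) ρ

/-- When the image is not contained in B, L₁ or L₂, the first point is not A and uv is nonzero
there. The height bound then makes P a generic point of C, and Q takes the parametrised form. All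
other components contribute only to the removed curves. -/
theorem exists_isComponentPoint (hd : d ≠ 0) {δ : ℕ} (hG : G.IsHomogeneous δ)
    (hGirr : Irreducible G) (hGz : ¬ G ∣ X 2) (hq : q ∈ (pullbackIdeal (A.conic d) G).minimalPrimes)
    (hPQ : ∀ f, f ∈ q ↔ aeval (Sum.elim P Q) f = 0) (hx : ∃ i, X (Sum.inl i) ∉ q)
    (hF : aeval Q (A.conic d) ≠ 0) (hu : aeval Q A.uPoly ≠ 0) (hv : aeval Q A.vPoly ≠ 0) :
    ∃ ρ α : L, IsComponentPoint A d G q P Q ρ α := by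
  obtain ⟨hinc, hPG⟩ := (pullbackIdeal_le_ker_iff hd G P Q).1 fun f hf => (hPQ f).1 (hq.1.2 hf)
  have hx' : ∃ i, P i ≠ 0 := by
    obtain ⟨i, hi⟩ := hx
    refine ⟨i, fun h => hi ((hPQ _).2 (by simpa using h))⟩
  obtain ⟨i, hi, hPi⟩ := exists_fst_ne_zero hinc hx' hF
  rw [A.aeval_uPoly] at hu
  rw [A.aeval_vPoly] at hv
  have hn := norm_ne_zero_of_snd hi hPi hinc hu hv
  have hdvd : ∀ h : PlaneRing k, aeval P h = 0 ↔ G ∣ h := by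
    refine fun h => ⟨fun hh => ?_, ?_⟩
    · exact dvd_of_aeval_fst_eq_zero hd hq hPQ hi hPi (fun _ => hn) hGirr.prime hPG hh
    · rintro ⟨c, rfl⟩
      rw [map_mul, hPG, zero_mul]
  have hP2 : P 2 ≠ 0 := fun h => hGz ((hdvd _).1 (by simpa using h))
  have hQ : Q ≠ 0 := by
    rintro rfl
    simp [Axes.u] at hu
  obtain ⟨ρ, α, hα, hρ, hρ2, hQ⟩ := hinc.exists_eq_pt hP2 hn hQ
  exact ⟨ρ, α, hq, isGeneric_of_mem_minimalPrimes hd hG hq hPQ, hdvd, hα, hρ2, hρ, hP2, hQ⟩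

namespace IsComponentPoint

variable {ρ α : L}

theorem norm_ne_zero (h : IsComponentPoint A d G q P Q ρ α) : A.norm (P 0) (P 1) ≠ 0 := by
  rw [← h.sq_eq]; exact pow_ne_zero 2 h.root_ne_zero

theorem incident (h : IsComponentPoint A d G q P Q ρ α) : A.Incident P Q := by
  have := (Axes.incident_pt h.sq_eq).smul 1 α
  rwa [one_smul, ← h.snd_eq] at this

theorem snd_two_ne_zero (h : IsComponentPoint A d G q P Q ρ α) : Q 2 ≠ 0 := by
  rw [h.snd_eq]
  simpa using ⟨h.scale_ne_zero, h.fst_two_ne_zero, h.root_ne_zero⟩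

theorem snd_norm_ne_zero (h : IsComponentPoint A d G q P Q ρ α) (hPρ : P 2 + ρ ≠ 0) :
    A.norm (Q 0) (Q 1) ≠ 0 := by
  have e : ∀ i, α * (P i * (P 2 + ρ)) = P i * (α * (P 2 + ρ)) := fun i => by ring
  rw [h.snd_eq]
  simp only [Pi.smul_apply, pt_zero, pt_one, smul_eq_mul, e, A.norm_mul]
  exact mul_ne_zero h.norm_ne_zero (pow_ne_zero _ (mul_ne_zero h.scale_ne_zero hPρ))

/-- The first projection of the generic point, seen from the second one. -/
theorem exists_fst_eq (h : IsComponentPoint A d G q P Q ρ α) (hPρ : P 2 + ρ ≠ 0) :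
    ∃ τ β : L, β ≠ 0 ∧ τ ≠ 0 ∧ τ ^ 2 = A.norm (Q 0) (Q 1) ∧ P = β • pt Q (Q 2 + τ) τ := by
  refine h.incident.symm.exists_eq_pt h.snd_two_ne_zero (h.snd_norm_ne_zero hPρ) ?_
  intro hP
  exact h.fst_two_ne_zero (by rw [hP]; rfl)

end IsComponentPoint

end Component

universe u

/-! ### The components have multiplicity one. -/

section Multiplicity

/-- A polynomial whose square divides the form divides both partial derivatives, which are nonzero
multiples of the two variables because 2 and n are nonzero. -/
theorem squarefree_sq_sub {K : Type*} [Field K] (h2 : (2 : K) ≠ 0) {n : K} (hn : n ≠ 0) :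
    Squarefree (X 1 ^ 2 - C n * X 0 ^ 2 : MvPolynomial (Fin 2) K) := by
  rintro p ⟨c, hc⟩
  have hd : ∀ i, p ∣ pderiv i (X 1 ^ 2 - C n * X 0 ^ 2 : MvPolynomial (Fin 2) K) := by
    intro i
    rw [hc]
    simp only [Derivation.leibniz, smul_eq_mul]
    exact Dvd.intro (p * pderiv i c + 2 * c * pderiv i p) (by ring)
  have hu : ∀ a : K, a ≠ 0 → IsUnit (C a : MvPolynomial (Fin 2) K) := fun a ha =>
    (IsUnit.mk0 a ha).map _
  have h0 : p ∣ X 0 := by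
    have : pderiv 0 (X 1 ^ 2 - C n * X 0 ^ 2 : MvPolynomial (Fin 2) K) = C (-(2 * n)) * X 0 := by
      simp [pderiv_X, map_ofNat C 2]; ring
    have h := hd 0
    rwa [this, (hu _ (neg_ne_zero.2 (mul_ne_zero h2 hn))).dvd_mul_left] at h
  have h1 : p ∣ X 1 := by
    have : pderiv 1 (X 1 ^ 2 - C n * X 0 ^ 2 : MvPolynomial (Fin 2) K) = C 2 * X 1 := by
      simp [pderiv_X, map_ofNat C 2]
    have h := hd 1
    rwa [this, (hu _ h2).dvd_mul_left] at h
  rcases (X_prime (R := K) (i := (0 : Fin 2))).irreducible.dvd_iff.1 h0 with h | h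
  · exact h
  · have : (X 0 : MvPolynomial (Fin 2) K) ∣ X 1 := h.dvd.trans h1
    simp at this

variable {k : Type*} [Field k] {A : Axes k} {d : k} {G : PlaneRing k} {L : Type*} [Field L]
  [Algebra k L] {q : Ideal (ProdRing k)} {P Q : Fin 3 → L} {ρ α : L}

theorem aeval_sumElim_comp {B : Type*} [CommRing B] [Algebra k B] (f : ProdRing k →ₐ[k] B) :
    aeval (Sum.elim (fun i => f (X (Sum.inl i))) (fun i => f (X (Sum.inr i)))) = f := by
  apply algHom_ext; rintro (i | i) <;> simp

/-- The part of the incidence surface over a field-valued point of the plane is a pair of lines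
meeting in one point. -/
theorem exists_factor_through_pencil (hd : d ≠ 0) {K B : Type*} [Field K] [Algebra k K] [CommRing B]
    [Algebra k B] (κ : K →ₐ[k] B) {ξ : Fin 3 → K} (hξ2 : ξ 2 ≠ 0) (hξG : aeval ξ G = 0)
    (hξn : A.norm (ξ 0) (ξ 1) ≠ 0)
    (can : ProdRing k →ₐ[k] B) (hcan : ∀ i, can (X (Sum.inl i)) = κ (ξ i))
    (hI : pullbackIdeal (A.conic d) G ≤ RingHom.ker can) :
    ∃ (Φ : ProdRing k →ₐ[k] MvPolynomial (Fin 2) K),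
      (∀ f ∈ pullbackIdeal (A.conic d) G,
        (X 1 ^ 2 - C (A.norm (ξ 0) (ξ 1)) * X 0 ^ 2) ∣ Φ f) ∧
      ∀ f, (X 1 ^ 2 - C (A.norm (ξ 0) (ξ 1)) * X 0 ^ 2) ∣ Φ f → can f = 0 := by
  obtain ⟨i, hi, hξi⟩ := A.exists_ne_zero_of_norm_ne_zero hξn
  set D : MvPolynomial (Fin 2) K := X 1 ^ 2 - C (A.norm (ξ 0) (ξ 1)) * X 0 ^ 2 with hD
  let x : Fin 3 → MvPolynomial (Fin 2) K := fun j => C (ξ j)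
  -- With s = `X 0` and t = `X 1`, this parametrises the vectors over the line joining A to ξ. The
  -- incident ones satisfy t² = uv(ξ)s², and t/s plays the role of ρ.
  let y : Fin 3 → MvPolynomial (Fin 2) K :=
    ![C (ξ 0) * (C (ξ 2) * X 0 + X 1), C (ξ 1) * (C (ξ 2) * X 0 + X 1), C (ξ 2) * X 1]
  let Φ : ProdRing k →ₐ[k] MvPolynomial (Fin 2) K := aeval (Sum.elim x y)
  have hC : ∀ a : K, (C a : MvPolynomial (Fin 2) K) = IsScalarTower.toAlgHom k K _ a := fun a => rfl
  have hkey : (x 2 * y 2) ^ 2 - A.norm (x 2 * y 0 - x 0 * y 2) (x 2 * y 1 - x 1 * y 2) =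
      C (ξ 2 ^ 4) * D := by
    have e0 : x 2 * y 0 - x 0 * y 2 = x 0 * (C (ξ 2 ^ 2) * X 0) := by simp [x, y]; ring
    have e1 : x 2 * y 1 - x 1 * y 2 = x 1 * (C (ξ 2 ^ 2) * X 0) := by simp [x, y]; ring
    have e2 : A.norm (x 0) (x 1) = C (A.norm (ξ 0) (ξ 1)) := by
      simp only [x, hC]; rw [Axes.map_norm]
    rw [e0, e1, A.norm_mul, e2]
    simp [x, y, hD]; ring
  refine ⟨Φ, fun f hf => ?_, fun f hf => ?_⟩
  · let π := Ideal.Quotient.mkₐ k (Ideal.span {D})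
    have h : pullbackIdeal (A.conic d) G ≤ RingHom.ker (π.comp Φ) := by
      rw [← aeval_sumElim_comp (π.comp Φ), pullbackIdeal_le_ker_iff hd]
      have hx : ∀ j, (π.comp Φ) (X (Sum.inl j)) = π (x j) := fun j => by simp [Φ]
      have hy : ∀ j, (π.comp Φ) (X (Sum.inr j)) = π (y j) := fun j => by simp [Φ]
      simp only [hx, hy]
      refine ⟨⟨?_, ?_⟩, ?_⟩
      · rw [← sub_eq_zero]
        simp only [← map_mul, ← map_sub, ← map_pow, ← A.map_norm]
        rw [hkey, map_mul]
        have : π D = 0 := Ideal.Quotient.eq_zero_iff_mem.2 (Ideal.mem_span_singleton_self D)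
        rw [this, mul_zero]
      · simp only [← map_mul]
        congr 1
        simp [x, y]; ring
      · have : (aeval (fun j => π (x j)) : PlaneRing k →ₐ[k] _) =
            (π.comp (IsScalarTower.toAlgHom k K _)).comp (aeval ξ) := by
          apply algHom_ext; intro j; simp [x]
        rw [this, AlgHom.comp_apply, hξG, map_zero]
    have := h hf
    rw [RingHom.mem_ker, AlgHom.comp_apply] at this
    exact Ideal.mem_span_singleton.1 (Ideal.Quotient.eq_zero_iff_mem.1 this)
  · let Z := can (X (Sum.inr 2))
    -- The values of s and t recovered from the second point by inverting the linear parametrisation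
    -- `y`.
    let g : Fin 2 → B := ![κ (ξ 2)⁻¹ * (κ (ξ i)⁻¹ * can (X (Sum.inr i)) - κ (ξ 2)⁻¹ * Z), κ (ξ 2)⁻¹ * Z]
    let Ψ : MvPolynomial (Fin 2) K →ₐ[k] B :=
      { eval₂Hom (κ : K →+* B) g with
        commutes' := fun r => by
          rw [IsScalarTower.algebraMap_apply k K (MvPolynomial (Fin 2) K), algebraMap_eq]
          simp }
    have hΨC : ∀ a, Ψ (C a) = κ a := fun a => by simp [Ψ]
    have hΨX : ∀ j, Ψ (X j) = g j := fun a => by simp [Ψ]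
    have hinv : ∀ a : K, a ≠ 0 → κ a * κ a⁻¹ = 1 := fun a ha => by
      rw [← map_mul, mul_inv_cancel₀ ha, map_one]
    have hinc : A.Incident (fun i => can (X (Sum.inl i))) (fun i => can (X (Sum.inr i))) := by
      rw [← aeval_sumElim_comp can, pullbackIdeal_le_ker_iff hd] at hI
      exact hI.1
    have hcross : ∀ j, j ≠ 2 → κ (ξ j) * can (X (Sum.inr i)) = κ (ξ i) * can (X (Sum.inr j)) := by
      intro j hj
      have := hinc.2
      simp only [hcan] at this
      fin_cases i <;> fin_cases j <;> first | exact absurd rfl hi | exact absurd rfl hj | skip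
      · rfl
      · exact this.symm
      · exact this
      · rfl
    have hg0 : κ (ξ 2) * g 0 + g 1 = κ (ξ i)⁻¹ * can (X (Sum.inr i)) := by
      simp only [g, Matrix.cons_val]
      linear_combination (κ (ξ i)⁻¹ * can (X (Sum.inr i)) - κ (ξ 2)⁻¹ * Z) * hinv _ hξ2
    have hcomp : Ψ.comp Φ = can := by
      apply algHom_ext
      rintro (j | j)
      · simp [Φ, x, hΨC, hcan]
      · have hj : ∀ j, j ≠ 2 → κ (ξ j) * (κ (ξ 2) * g 0 + g 1) = can (X (Sum.inr j)) := by
          intro j hj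
          rw [hg0]
          linear_combination κ (ξ i)⁻¹ * hcross j hj + can (X (Sum.inr j)) * hinv _ hξi
        fin_cases j
        · simp [Φ, y, hΨC, hΨX, hj 0]
        · simp [Φ, y, hΨC, hΨX, hj 1]
        · simp only [Φ, y, AlgHom.comp_apply, Fin.reduceFinMk, aeval_X, Sum.elim_inr,
            Matrix.cons_val, map_mul, hΨC, hΨX, g, ← mul_assoc, hinv _ hξ2, one_mul, Z]
    have hΨD : Ψ D = 0 := by
      have h1 := congrArg Ψ hkey
      have hx : ∀ j, Ψ (x j) = can (X (Sum.inl j)) := fun j => by rw [← hcomp]; simp [Φ]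
      have hy : ∀ j, Ψ (y j) = can (X (Sum.inr j)) := fun j => by rw [← hcomp]; simp [Φ]
      simp only [map_mul, map_sub, map_pow, A.map_norm, hx, hy] at h1
      rw [hinc.1, sub_self, hΨC] at h1
      have hu : IsUnit (κ (ξ 2) ^ 4) := ((IsUnit.mk0 _ hξ2).map κ).pow 4
      rw [← hu.mul_right_eq_zero, ← h1]
    obtain ⟨c, hc⟩ := hf
    rw [← hcomp, AlgHom.comp_apply, hc, map_mul, hΨD, zero_mul]

/-- The residue field of a prime of the plane, and its map to a ring where the prime vanishes and its
complement is invertible. -/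
theorem exists_residue_field {k : Type u} [Field k] {L : Type*} [Field L] [Algebra k L]
    (P : Fin 3 → L) {B : Type*} [CommRing B] [Algebra k B] (c : PlaneRing k →ₐ[k] B)
    (h0 : ∀ g : PlaneRing k, aeval P g = 0 → c g = 0)
    (hu : ∀ g : PlaneRing k, aeval P g ≠ 0 → IsUnit (c g)) :
    ∃ (K : Type u) (_ : Field K) (_ : Algebra k K) (κ : K →ₐ[k] B) (ξ : Fin 3 → K),
      (∀ g : PlaneRing k, aeval ξ g = 0 ↔ aeval P g = 0) ∧ ∀ i, c (X i) = κ (ξ i) := by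
  let 𝔭 : Ideal (PlaneRing k) := RingHom.ker (aeval P : PlaneRing k →ₐ[k] L)
  have i𝔭 : 𝔭.IsPrime := RingHom.ker_isPrime _
  let l : (PlaneRing k ⧸ 𝔭) →ₐ[k] B := Ideal.Quotient.liftₐ 𝔭 c h0
  have hl : ∀ y : nonZeroDivisors (PlaneRing k ⧸ 𝔭), IsUnit (l y) := by
    rintro ⟨y, hy⟩
    obtain ⟨g, rfl⟩ := Ideal.Quotient.mk_surjective y
    exact hu g fun hg => nonZeroDivisors.ne_zero hy (Ideal.Quotient.eq_zero_iff_mem.2 hg)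
  let κ : FractionRing (PlaneRing k ⧸ 𝔭) →ₐ[k] B :=
    { IsLocalization.lift (M := nonZeroDivisors (PlaneRing k ⧸ 𝔭)) (g := (l : _ →+* B)) hl with
      commutes' := fun r => by
        have e : algebraMap k (FractionRing (PlaneRing k ⧸ 𝔭)) r =
          algebraMap (PlaneRing k ⧸ 𝔭) _ (algebraMap k _ r) := rfl
        rw [e]
        exact (IsLocalization.lift_eq hl _).trans (l.commutes r) }
  let ξ : Fin 3 → FractionRing (PlaneRing k ⧸ 𝔭) := fun i =>
    algebraMap (PlaneRing k ⧸ 𝔭) _ (Ideal.Quotient.mk 𝔭 (X i))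
  refine ⟨FractionRing (PlaneRing k ⧸ 𝔭), inferInstance, inferInstance, κ, ξ, fun g => ?_,
    fun i => ?_⟩
  · have : aeval ξ g = algebraMap (PlaneRing k ⧸ 𝔭) (FractionRing (PlaneRing k ⧸ 𝔭))
        (Ideal.Quotient.mk 𝔭 g) := by
      have : (aeval ξ : PlaneRing k →ₐ[k] _) =
          (IsScalarTower.toAlgHom k (PlaneRing k ⧸ 𝔭) _).comp (Ideal.Quotient.mkₐ k 𝔭) := by
        apply algHom_ext; intro i; simp [ξ]
      rw [this]; rfl
    rw [this, map_eq_zero_iff _ (IsFractionRing.injective _ _), Ideal.Quotient.eq_zero_iff_mem,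
      RingHom.mem_ker]
  · exact (IsLocalization.lift_eq hl (Ideal.Quotient.mk 𝔭 (X i))).symm

/-- Reducedness at the generic point of q. Over the residue field at P the pullback ideal is
governed by a squarefree binary form; this form divides Φ((sf)^(n+1)), hence Φ(sf), and s is
invertible. -/
theorem IsComponentPoint.eq_zero_of_mul_pow_mem {q : Ideal (ProdRing k)}
    (h : IsComponentPoint A d G q P Q ρ α) (hd : d ≠ 0) (h2 : (2 : k) ≠ 0)
    {B : Type*} [CommRing B] [Algebra k B] (can : ProdRing k →ₐ[k] B)
    (hI : pullbackIdeal (A.conic d) G ≤ RingHom.ker can) (hunit : ∀ g, g ∉ q → IsUnit (can g))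
    {s f : ProdRing k} (hs : s ∉ q) {n : ℕ} (hsf : s * f ^ n ∈ pullbackIdeal (A.conic d) G) :
    can f = 0 := by
  have hPG : aeval P G = 0 := (h.dvd_iff G).2 dvd_rfl
  obtain ⟨K, _, _, κ, ξ, hξ, hκ⟩ := exists_residue_field P (can.comp (rename Sum.inl))
    (fun a ha => by
      obtain ⟨c, rfl⟩ := (h.dvd_iff a).1 ha
      have : can (rename Sum.inl G) = 0 := hI
        ((le_sup_right : _ ≤ pullbackIdeal (A.conic d) G) (Ideal.mem_span_singleton_self _))
      rw [AlgHom.comp_apply, map_mul, map_mul, this, zero_mul])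
    (fun g hg => by
      refine hunit (rename Sum.inl g) fun hg' => hg ?_
      rwa [h.generic.mem_iff, aeval_rename, Sum.elim_comp_inl] at hg')
  have hξ2 : ξ 2 ≠ 0 := fun h0 => h.fst_two_ne_zero (by
    have := (hξ (X 2)).1 (by simpa using h0)
    simpa using this)
  have hξn : A.norm (ξ 0) (ξ 1) ≠ 0 := fun h0 => h.norm_ne_zero (by
    have := (hξ A.normPoly).1 (by simpa using h0)
    simpa using this)
  obtain ⟨Φ, h₁, h₂⟩ := exists_factor_through_pencil hd κ hξ2 ((hξ G).2 hPG) hξn can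
    (fun i => by simpa using hκ i) hI
  have hK2 : (2 : K) ≠ 0 := by
    have := (map_ne_zero (algebraMap k K)).2 h2
    rwa [map_ofNat] at this
  have hdvd : (X 1 ^ 2 - C (A.norm (ξ 0) (ξ 1)) * X 0 ^ 2) ∣ Φ (s * f) := by
    rw [← (squarefree_sq_sub hK2 hξn).dvd_pow_iff_dvd (n := n + 1) n.succ_ne_zero, ← map_pow]
    apply h₁
    have : (s * f) ^ (n + 1) = s ^ n * f * (s * f ^ n) := by ring
    rw [this]
    exact Ideal.mul_mem_left _ _ hsf
  have h0 := h₂ _ hdvd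
  rwa [map_mul, (hunit s hs).mul_right_eq_zero] at h0

/-- By minimality the localised pullback ideal has the maximal ideal as radical, and reducedness
removes the radical. The quotient is thus a field, of length 1. -/
theorem IsComponentPoint.map_pullbackIdeal_eq {q : Ideal (ProdRing k)} [q.IsPrime]
    (h : IsComponentPoint A d G q P Q ρ α) (hd : d ≠ 0) (h2 : (2 : k) ≠ 0)
    (Sq : Type*) [CommRing Sq] [Algebra (ProdRing k) Sq] [IsLocalization.AtPrime Sq q] :
    (pullbackIdeal (A.conic d) G).map (algebraMap (ProdRing k) Sq) =
      q.map (algebraMap (ProdRing k) Sq) := by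
  set J := (pullbackIdeal (A.conic d) G).map (algebraMap (ProdRing k) Sq) with hJ
  have hrad : J.radical = q.map (algebraMap (ProdRing k) Sq) :=
    IsLocalization.AtPrime.radical_map_of_mem_minimalPrimes Sq q _ h.mem
  refine le_antisymm (hrad ▸ Ideal.le_radical) ?_
  rw [Ideal.map_le_iff_le_comap]
  intro f hf
  rw [Ideal.mem_comap]
  have hfr : algebraMap (ProdRing k) Sq f ∈ J.radical := by
    rw [hrad]
    exact Ideal.mem_map_of_mem _ hf
  obtain ⟨n, hn⟩ := hfr
  rw [← map_pow, IsLocalization.algebraMap_mem_map_algebraMap_iff q.primeCompl] at hn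
  obtain ⟨s, hs, hsf⟩ := hn
  let _ : Algebra k (Sq ⧸ J) :=
    ((algebraMap (ProdRing k) (Sq ⧸ J)).comp (algebraMap k (ProdRing k))).toAlgebra
  have : IsScalarTower k (ProdRing k) (Sq ⧸ J) := IsScalarTower.of_algebraMap_eq fun _ => rfl
  let can : ProdRing k →ₐ[k] Sq ⧸ J := IsScalarTower.toAlgHom k (ProdRing k) (Sq ⧸ J)
  have hcan : ∀ g, can g = Ideal.Quotient.mk J (algebraMap (ProdRing k) Sq g) := fun _ => rfl
  have h0 : can f = 0 := by
    refine h.eq_zero_of_mul_pow_mem hd h2 can (fun g hg => ?_) (fun g hg => ?_) hs hsf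
    · rw [RingHom.mem_ker, hcan, Ideal.Quotient.eq_zero_iff_mem]
      exact Ideal.mem_map_of_mem _ hg
    · rw [hcan]
      exact (IsLocalization.map_units Sq (⟨g, hg⟩ : q.primeCompl)).map (Ideal.Quotient.mk J)
  rwa [hcan, Ideal.Quotient.eq_zero_iff_mem] at h0

theorem IsComponentPoint.pullbackMultiplicity_eq_one (hd : d ≠ 0) (h2 : (2 : k) ≠ 0)
    (q : PrimeSpectrum (ProdRing k)) (h : IsComponentPoint A d G q.asIdeal P Q ρ α) :
    pullbackMultiplicity (A.conic d) G q = 1 := by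
  have : IsSimpleModule (Localization.AtPrime q.asIdeal) (Localization.AtPrime q.asIdeal ⧸
      (pullbackIdeal (A.conic d) G).map
        (algebraMap (ProdRing k) (Localization.AtPrime q.asIdeal))) := by
    rw [isSimpleModule_iff_isCoatom, h.map_pullbackIdeal_eq hd h2,
      Localization.AtPrime.map_eq_maximalIdeal]
    exact (IsLocalRing.maximalIdeal.isMaximal _).out
  rw [pullbackMultiplicity, Module.length_eq_one_iff.2 this]
  rfl

end Multiplicity

/-! ### Plane curves have infinitely many points and meet properly in finitely many. -/

section FiniteZeros

variable {k : Type*} [Field k]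

theorem irreducible_of_isHomogeneous_one {σ : Type*} {f : MvPolynomial σ k}
    (hf : f.IsHomogeneous 1) (h0 : f ≠ 0) : Irreducible f := by
  have hunit : ∀ g : MvPolynomial σ k, g ≠ 0 → g.totalDegree = 0 → IsUnit g := by
    intro g hg h
    rw [totalDegree_eq_zero_iff_eq_C] at h
    rw [h] at hg ⊢
    exact (IsUnit.mk0 _ (by simpa using hg)).map _
  have hd := hf.totalDegree h0
  constructor
  · intro hu
    obtain ⟨c, hc, rfl⟩ := isUnit_iff_eq_C_of_isReduced.1 hu
    simp at hd
  · rintro a b rfl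
    obtain ⟨ha, hb⟩ := mul_ne_zero_iff.1 h0
    rw [totalDegree_mul_of_isDomain ha hb] at hd
    rcases (by omega : a.totalDegree = 0 ∨ b.totalDegree = 0) with h | h
    · exact .inl (hunit a ha h)
    · exact .inr (hunit b hb h)

/-- The homogeneous ideal of a point of the plane. -/
def pointIdeal (v : Fin 3 → k) : Ideal (PlaneRing k) :=
  RingHom.ker (aeval (fun i => Polynomial.C (v i) * Polynomial.X) : PlaneRing k →ₐ[k] Polynomial k)

theorem pointIdeal_isPrime (v : Fin 3 → k) : (pointIdeal v).IsPrime := RingHom.ker_isPrime _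

theorem mem_pointIdeal_of_isHomogeneous {v : Fin 3 → k} {f : PlaneRing k} {n : ℕ}
    (hf : f.IsHomogeneous n) (h : aeval v f = 0) : f ∈ pointIdeal v := by
  have e : (fun i => Polynomial.C (v i) * Polynomial.X) =
      (Polynomial.X : Polynomial k) • fun i => Polynomial.C (v i) := by
    funext i; rw [Pi.smul_apply, smul_eq_mul, mul_comm]
  have e' : (aeval fun i => Polynomial.C (v i) : PlaneRing k →ₐ[k] Polynomial k) =
      (Algebra.ofId k _).comp (aeval v) := by
    apply algHom_ext; intro i; simp [Algebra.ofId_apply]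
  rw [pointIdeal, RingHom.mem_ker, e, aeval_smul_of_isHomogeneous hf, e', AlgHom.comp_apply, h,
    map_zero, mul_zero]

theorem aeval_eq_zero_of_mem_pointIdeal {v : Fin 3 → k} {f : PlaneRing k} (hf : f ∈ pointIdeal v) :
    aeval v f = 0 := by
  have : (aeval v : PlaneRing k →ₐ[k] k) = (Polynomial.aeval 1).comp
      (aeval fun i => Polynomial.C (v i) * Polynomial.X) := by
    apply algHom_ext; intro i; simp
  rw [this, AlgHom.comp_apply, RingHom.mem_ker.1 hf, map_zero]

/-- A linear form through the point `v`. -/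
def crossForm (v : Fin 3 → k) (i j : Fin 3) : PlaneRing k := C (v i) * X j - C (v j) * X i

theorem crossForm_isHomogeneous (v : Fin 3 → k) (i j : Fin 3) : (crossForm v i j).IsHomogeneous 1 :=
  (isHomogeneous_C_mul_X _ _).sub (isHomogeneous_C_mul_X _ _)

theorem crossForm_mem (v : Fin 3 → k) (i j : Fin 3) : crossForm v i j ∈ pointIdeal v :=
  mem_pointIdeal_of_isHomogeneous (crossForm_isHomogeneous v i j) (by simp [crossForm]; ring)

/-- Modulo the two forms every variable Xⱼ equals vⱼ · (Xᵢ/vᵢ), so the quotient map factors through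
the parametrisation of the line spanned by v. -/
theorem pointIdeal_eq_span {v : Fin 3 → k} {i : Fin 3} (hi : v i ≠ 0) :
    pointIdeal v = Ideal.span {crossForm v i (i.succAbove 0), crossForm v i (i.succAbove 1)} := by
  apply le_antisymm
  · intro f hf
    set J := Ideal.span {crossForm v i (i.succAbove 0), crossForm v i (i.succAbove 1)} with hJ
    rw [← Ideal.Quotient.eq_zero_iff_mem, ← Ideal.Quotient.mkₐ_eq_mk k]
    have hmem : ∀ j, crossForm v i j ∈ J := by
      intro j
      rcases Fin.eq_self_or_eq_succAbove i j with rfl | ⟨l, rfl⟩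
      · rw [show crossForm v j j = 0 by simp [crossForm]]; exact J.zero_mem
      · apply Ideal.subset_span
        fin_cases l <;> simp
    have : Ideal.Quotient.mkₐ k J = (Polynomial.aeval
        (Ideal.Quotient.mk J (C (v i)⁻¹ * X i)) : Polynomial k →ₐ[k] _).comp
        (aeval fun i => Polynomial.C (v i) * Polynomial.X) := by
      apply algHom_ext
      intro j
      have h := Ideal.Quotient.eq_zero_iff_mem.2 (J.mul_mem_left (C (v i)⁻¹) (hmem j))
      have e : C (v i)⁻¹ * crossForm v i j = X j - C (v j) * (C (v i)⁻¹ * X i) := by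
        have : (C (v i)⁻¹ * C (v i) : PlaneRing k) = 1 := by
          rw [← C_mul, inv_mul_cancel₀ hi, C_1]
        rw [crossForm]; linear_combination X j * this
      rw [e, map_sub, sub_eq_zero] at h
      rw [Ideal.Quotient.mkₐ_eq_mk, h]
      simp only [AlgHom.comp_apply, aeval_X, map_mul, Polynomial.aeval_X, Polynomial.aeval_C]
      rfl
    rw [this, AlgHom.comp_apply, RingHom.mem_ker.1 hf, map_zero]
  · rw [Ideal.span_le]
    rintro f (rfl | rfl) <;> exact crossForm_mem _ _ _

theorem mk_eq_mk_of_crossForm {v w : Fin 3 → k} (hv : v ≠ 0) (hw : w ≠ 0)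
    (h : ∀ i j, v i * w j = v j * w i) : Projectivization.mk k v hv = Projectivization.mk k w hw := by
  obtain ⟨i, hi⟩ := Function.ne_iff.1 hw
  rw [Projectivization.mk_eq_mk_iff']
  refine ⟨v i / w i, ?_⟩
  funext j
  have := h i j
  simp only [Pi.zero_apply] at hi
  simp only [Pi.smul_apply, smul_eq_mul]
  field_simp
  rw [this, mul_comm]

/-- The ideal of a common zero has two generators, hence height at most 2, while 0 ⊂ (H) ⊂ J would
be strict for any prime J over (H, e). So these ideals are minimal primes over (H, e), of which
there are finitely many, and each determines its point. -/
theorem finite_common_zeros {H e : PlaneRing k} {m n : ℕ} (hH : H.IsHomogeneous m)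
    (hHirr : Irreducible H) (he : e.IsHomogeneous n) (hHe : ¬ H ∣ e) :
    {R : Plane k | aeval R.rep H = 0 ∧ aeval R.rep e = 0}.Finite := by
  have hfin := Ideal.finite_minimalPrimes_of_isNoetherianRing _ (Ideal.span {H, e})
  refine Set.Finite.of_finite_image (f := fun R : Plane k => pointIdeal R.rep)
    (hfin.subset ?_) ?_
  · rintro _ ⟨R, ⟨h1, h2⟩, rfl⟩
    have iR := pointIdeal_isPrime R.rep
    have hle : Ideal.span {H, e} ≤ pointIdeal R.rep := by
      rw [Ideal.span_le]
      rintro f (rfl | rfl)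
      · exact mem_pointIdeal_of_isHomogeneous hH h1
      · exact mem_pointIdeal_of_isHomogeneous he h2
    refine ⟨⟨iR, hle⟩, fun J hJ hJR => ?_⟩
    by_contra hlt
    have hlt : J < pointIdeal R.rep := lt_of_le_not_ge hJR hlt
    have iJ := hJ.1
    have iH : (Ideal.span {H}).IsPrime := (Ideal.span_singleton_prime hHirr.ne_zero).2 hHirr.prime
    have i0 : (⊥ : Ideal (PlaneRing k)).IsPrime := Ideal.isPrime_bot
    have hHJ : Ideal.span {H} < J := by
      refine lt_of_le_of_ne ?_ fun h => hHe ?_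
      · rw [Ideal.span_singleton_le_iff_mem]
        exact hJ.2 (Ideal.subset_span (by simp))
      · rw [← Ideal.mem_span_singleton, h]
        exact hJ.2 (Ideal.subset_span (by simp))
    have h0H : ⊥ < Ideal.span {H} := by
      rw [bot_lt_iff_ne_bot, Ne, Ideal.span_singleton_eq_bot]
      exact hHirr.ne_zero
    obtain ⟨i, hi⟩ := Function.ne_iff.1 R.rep_nonzero
    have hle2 : (pointIdeal R.rep).height ≤ 2 := by
      have hs := pointIdeal_eq_span hi
      refine (Ideal.height_le_card_of_mem_minimalPrimes_span (s := {crossForm R.rep i (i.succAbove 0),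
        crossForm R.rep i (i.succAbove 1)}) (by simp) ?_).trans ?_
      · rw [← hs]
        exact ⟨⟨iR, le_rfl⟩, fun J hJ _ => hJ.2⟩
      · have := Set.ncard_insert_le (crossForm R.rep i (i.succAbove 0))
          {crossForm R.rep i (i.succAbove 1)}
        rw [Set.ncard_singleton] at this
        exact_mod_cast this
    have f2 : (pointIdeal R.rep).FiniteHeight := ⟨.inr (hle2.trans_lt (by decide)).ne⟩
    have s2 := Ideal.height_strict_mono_of_isPrime_of_isPrime hlt
    have f1 : J.FiniteHeight := ⟨.inr (s2.trans_le le_top).ne⟩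
    have s1 := Ideal.height_strict_mono_of_isPrime_of_isPrime hHJ
    have f0 : (Ideal.span {H}).FiniteHeight := ⟨.inr (s1.trans_le le_top).ne⟩
    have s0 := Ideal.height_strict_mono_of_isPrime_of_isPrime h0H
    have t0 : 1 ≤ (Ideal.span {H}).height := by simpa using Order.add_one_le_of_lt s0
    have t1 : 2 ≤ J.height := by
      have := Order.add_one_le_of_lt (t0.trans_lt s1); rwa [one_add_one_eq_two] at this
    exact absurd (t1.trans_lt s2) (not_lt.2 hle2)
  · intro R _ R' _ hRR'
    simp only at hRR'
    rw [← R.mk_rep, ← R'.mk_rep]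
    apply mk_eq_mk_of_crossForm
    intro i j
    have h := crossForm_mem R.rep i j
    rw [hRR'] at h
    have := aeval_eq_zero_of_mem_pointIdeal h
    simpa [crossForm, sub_eq_zero] using this

/-- Through each point passes a line whose equation is not divisible by H. With finitely many zeros,
the product of such equations, one for each zero, would vanish wherever H does, and the
Nullstellensatz would make H divide one of the factors. -/
theorem infinite_zeros [IsAlgClosed k] {H : PlaneRing k} {m : ℕ} (hH : H.IsHomogeneous m)
    (hHirr : Irreducible H) : {R : Plane k | aeval R.rep H = 0}.Infinite := by
  intro hfin
  have hline : ∀ v : Fin 3 → k, v ≠ 0 → ∃ f : PlaneRing k, f.IsHomogeneous 1 ∧ aeval v f = 0 ∧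
      ¬ H ∣ f := by
    intro v hv
    obtain ⟨i, hi⟩ := Function.ne_iff.1 hv
    by_contra! hall
    have h0 := hall _ (crossForm_isHomogeneous v i (i.succAbove 0))
      (aeval_eq_zero_of_mem_pointIdeal (crossForm_mem _ _ _))
    have h1 := hall _ (crossForm_isHomogeneous v i (i.succAbove 1))
      (aeval_eq_zero_of_mem_pointIdeal (crossForm_mem _ _ _))
    have hne : ∀ j l : Fin 3, aeval (Pi.single j 1 : Fin 3 → k) (crossForm v i l) =
        v i * (Pi.single j 1 : Fin 3 → k) l - v l * (Pi.single j 1 : Fin 3 → k) i := by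
      intro j l; simp [crossForm]
    have hirr : Irreducible (crossForm v i (i.succAbove 0)) :=
      irreducible_of_isHomogeneous_one (crossForm_isHomogeneous _ _ _) fun h => by
        have := hne (i.succAbove 0) (i.succAbove 0)
        rw [h, map_zero, Pi.single_eq_same, Pi.single_eq_of_ne (Fin.succAbove_ne i 0).symm] at this
        simp at this
        exact hi this.symm
    have hassoc := (hirr.dvd_iff.1 h0).resolve_left hHirr.not_isUnit
    obtain ⟨c, hc⟩ := hassoc.dvd.trans h1
    have e0 := hne (i.succAbove 1) (i.succAbove 0)
    have e1 := hne (i.succAbove 1) (i.succAbove 1)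
    rw [hc, map_mul, e0, Pi.single_eq_same, Pi.single_eq_of_ne (Fin.succAbove_ne i 1).symm,
      Pi.single_eq_of_ne (fun h => absurd (Fin.succAbove_right_injective h) (by decide))] at e1
    simp at e1
    exact hi e1.symm
  choose! f hf1 hf2 hf3 using hline
  obtain ⟨j, hj⟩ : ∃ j : Fin 3, ¬ H ∣ X j := by
    by_contra! h
    have h01 := ((X_prime (R := k) (i := (0 : Fin 3))).irreducible.dvd_iff.1 (h 0)).resolve_left
      hHirr.not_isUnit
    have := h01.dvd.trans (h 1)
    simp at this
  -- The factor `X j` makes E vanish at the zero vector even if the product is empty.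
  let E : PlaneRing k := X j * ∏ R ∈ hfin.toFinset, f R.rep
  have hE : E ∈ Ideal.span {H} := by
    have iH : (Ideal.span {H}).IsPrime := (Ideal.span_singleton_prime hHirr.ne_zero).2 hHirr.prime
    rw [← MvPolynomial.IsPrime.vanishingIdeal_zeroLocus (K := k) (Ideal.span {H}),
      mem_vanishingIdeal_iff]
    intro v hv
    have hv : aeval v H = 0 := by
      rw [mem_zeroLocus_iff] at hv
      exact hv H (Ideal.mem_span_singleton_self H)
    by_cases hv0 : v = 0
    · rw [hv0]; simp [E]
    · let R : Plane k := Projectivization.mk k v hv0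
      obtain ⟨w, hw⟩ := Projectivization.exists_smul_eq_mk_rep k v hv0
      have hw' : R.rep = (w : k) • v := hw.symm
      have hR : R ∈ hfin.toFinset := by
        simp only [Set.Finite.mem_toFinset, Set.mem_ofPred_eq]
        rw [hw', aeval_smul_eq_zero_iff hH w.ne_zero, hv]
      have hfR := hf2 R.rep R.rep_nonzero
      have : aeval v (f R.rep) = 0 := by
        rw [← aeval_smul_eq_zero_iff (hf1 R.rep R.rep_nonzero) w.ne_zero, ← hw']
        exact hfR
      rw [map_mul, map_prod, Finset.prod_eq_zero hR this, mul_zero]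
  rw [Ideal.mem_span_singleton] at hE
  rcases hHirr.prime.dvd_or_dvd hE with h | h
  · exact hj h
  · obtain ⟨R, -, hR⟩ := (hHirr.prime.dvd_finsetProd_iff _).1 h
    exact hf3 R.rep R.rep_nonzero hR

end FiniteZeros

/-! ### Fibres of the projections, and the degree of a component over its image. -/

section Fiber

variable {k : Type*} [Field k] {A : Axes k} {L : Type*} [Field L] [Algebra k L]
  {q : Ideal (ProdRing k)} {P Q : Fin 3 → L} {ρ α : L}

/-- The points paired with `R` by the subvariety with ideal `q`. -/
def fiberOver (q : Ideal (ProdRing k)) (R : Plane k) : Set (Plane k) :=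
  {S | ∀ f ∈ q, aeval (Sum.elim R.rep S.rep) f = 0}

theorem IsGeneric.mk_mem_fiberOver [Infinite L] (hg : IsGeneric q P Q) {R : Plane k}
    {v : Fin 3 → k} (hv : v ≠ 0) :
    Projectivization.mk k v hv ∈ fiberOver q R ↔ ∀ f ∈ q, aeval (Sum.elim R.rep v) f = 0 := by
  obtain ⟨w, hw⟩ := Projectivization.exists_smul_eq_mk_rep k v hv
  have hw' : (Projectivization.mk k v hv).rep = (w : k) • v := hw.symm
  have hv' : v = (w : k)⁻¹ • (Projectivization.mk k v hv).rep := by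
    rw [hw', smul_smul, inv_mul_cancel₀ w.ne_zero, one_smul]
  constructor
  · intro h
    have := hg.eval_smul_eq_zero h 1 (w : k)⁻¹
    rwa [one_smul, ← hv'] at this
  · intro h
    have := hg.eval_smul_eq_zero h 1 (w : k)
    rwa [one_smul, ← hw'] at this

theorem pt_ne_zero {v : Fin 3 → L} {a b : L} (hv : v 2 ≠ 0) (hb : b ≠ 0) : pt v a b ≠ 0 := by
  intro h
  have := congrFun h 2
  simp [hv, hb] at this

/-- Where z and a do not vanish, `relation` leaves only one candidate, and `eval_pt_eq_zero` shows
that it lies in the fibre. -/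
theorem IsGeneric.ncard_fiberOver_of_ratio [Infinite L] (hg : IsGeneric q P Q) (hα : α ≠ 0)
    (hQ : Q = α • pt P (P 2 + ρ) ρ) {a b : PlaneRing k} (hab : aeval P a = aeval P b * ρ)
    {R : Plane k} (hR : ∀ h : PlaneRing k, aeval P h = 0 → aeval R.rep h = 0) (hR2 : R.rep 2 ≠ 0)
    (ha : aeval R.rep a ≠ 0) : (fiberOver q R).ncard = 1 := by
  have h0 := pt_ne_zero (a := aeval R.rep b * R.rep 2 + aeval R.rep a) hR2 ha
  rw [Set.ncard_eq_one]
  refine ⟨Projectivization.mk k _ h0, Set.Subset.antisymm (fun S hS => ?_) ?_⟩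
  · have hrel := fun i (hi : i ≠ 2) => hg.relation hQ hab (fun f hf => hS f hf) hi
    rw [Set.mem_singleton_iff, ← S.mk_rep, Projectivization.mk_eq_mk_iff']
    refine ⟨S.rep 2 / (R.rep 2 * aeval R.rep a), ?_⟩
    have h1 := hrel 0 (by decide)
    have h2 := hrel 1 (by decide)
    refine ext_three ?_ ?_ ?_
    · simp only [Pi.smul_apply, pt_zero, smul_eq_mul]; field_simp; linear_combination -h1
    · simp only [Pi.smul_apply, pt_one, smul_eq_mul]; field_simp; linear_combination -h2
    · simp only [Pi.smul_apply, pt_two, smul_eq_mul]; field_simp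
  · rw [Set.singleton_subset_iff, hg.mk_mem_fiberOver]
    exact fun f hf => hg.eval_pt_eq_zero hα hQ hab hR hf

/-- Both square roots of uv(R) occur because ρ is irrational, incidence allows no other point, and
the two points differ because 2 ≠ 0. -/
theorem IsGeneric.ncard_fiberOver_of_not_ratio [Infinite L] [IsAlgClosed k] (h2 : (2 : k) ≠ 0)
    (hg : IsGeneric q P Q) (hα : α ≠ 0) (hρ : ρ ^ 2 = A.norm (P 0) (P 1))
    (hQ : Q = α • pt P (P 2 + ρ) ρ)
    (hab : ∀ a b : PlaneRing k, aeval P a = aeval P b * ρ → aeval P b = 0) {R : Plane k}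
    (hR : ∀ h : PlaneRing k, aeval P h = 0 → aeval R.rep h = 0) (hR2 : R.rep 2 ≠ 0)
    (hRn : A.norm (R.rep 0) (R.rep 1) ≠ 0) : (fiberOver q R).ncard = 2 := by
  obtain ⟨t, ht⟩ := IsAlgClosed.exists_pow_nat_eq (A.norm (R.rep 0) (R.rep 1)) (n := 2) two_pos
  have ht0 : t ≠ 0 := by rintro rfl; apply hRn; rw [← ht]; simp
  have hv : ∀ s : k, s ≠ 0 → pt R.rep (R.rep 2 + s) s ≠ 0 := fun s hs => pt_ne_zero hR2 hs
  obtain ⟨i, hi, hRi⟩ := A.exists_ne_zero_of_norm_ne_zero hRn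
  have hmem : ∀ s (hs : s ≠ 0), s ^ 2 = A.norm (R.rep 0) (R.rep 1) →
      Projectivization.mk k _ (hv s hs) ∈ fiberOver q R := fun s hs hs2 => by
    rw [hg.mk_mem_fiberOver]
    exact fun f hf => hg.eval_pt_of_not_ratio hα hρ hQ hab hR hs2 hf
  have hne : Projectivization.mk k _ (hv t ht0) ≠ Projectivization.mk k _ (hv (-t) (neg_ne_zero.2 ht0)) := by
    intro h
    rw [Projectivization.mk_eq_mk_iff'] at h
    obtain ⟨c, hc⟩ := h
    have e2 := congrFun hc 2
    have ei := congrFun hc i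
    simp only [Pi.smul_apply, pt_two, smul_eq_mul] at e2
    have hc' : c = -1 := by
      apply mul_right_cancel₀ (mul_ne_zero hR2 ht0); linear_combination -e2
    have hp : ∀ x y : k, pt R.rep x y i = R.rep i * x := fun x y => by
      fin_cases i <;> first | rfl | exact absurd rfl hi
    rw [Pi.smul_apply, hp, hp, hc', smul_eq_mul] at ei
    have : R.rep i * R.rep 2 * 2 = 0 := by linear_combination -ei
    exact mul_ne_zero (mul_ne_zero hRi hR2) h2 this
  have hsub : fiberOver q R = {Projectivization.mk k _ (hv t ht0),
      Projectivization.mk k _ (hv (-t) (neg_ne_zero.2 ht0))} := by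
    apply Set.Subset.antisymm
    · intro S hS
      have hinc : A.Incident R.rep S.rep := by
        have h1 : incidenceIdeal (A.conic 1) ≤ q := by
          intro f hf
          rw [hg.mem_iff]
          refine (incidenceIdeal_le_ker_iff one_ne_zero P Q).2 ?_ hf
          have := (Axes.incident_pt hρ).smul 1 α
          rwa [one_smul, ← hQ] at this
        exact (incidenceIdeal_le_ker_iff one_ne_zero _ _).1 fun f hf => hS f (h1 hf)
      obtain ⟨σ, β, hβ, hσ, hσ2, hS'⟩ := hinc.exists_eq_pt hR2 hRn S.rep_nonzero
      rw [← ht, sq_eq_sq_iff_eq_or_eq_neg] at hσ2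
      rw [← S.mk_rep]
      rcases hσ2 with rfl | rfl
      · left
        rw [Projectivization.mk_eq_mk_iff']
        exact ⟨β, hS'.symm⟩
      · right
        rw [Set.mem_singleton_iff, Projectivization.mk_eq_mk_iff']
        exact ⟨β, hS'.symm⟩
    · rintro S (rfl | rfl)
      · exact hmem t ht0 ht
      · exact hmem (-t) (neg_ne_zero.2 ht0) (by rw [neg_sq, ht])
  rw [hsub, Set.ncard_pair hne]

/-- `degreeOver` counts along the second projection; the exchange of factors makes the results on
the first projection applicable. -/
theorem fiberOver_comap_swap (q : PrimeSpectrum (ProdRing k)) (R : Plane k) :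
    {S : Plane k | (S, R) ∈ zeroLocus q} =
      fiberOver (q.asIdeal.comap (rename Sum.swap : ProdRing k →ₐ[k] ProdRing k)) R := by
  have h : ∀ P Q : Fin 3 → k, Sum.elim P Q ∘ Sum.swap = Sum.elim Q P := by
    intro P Q; funext i; cases i <;> rfl
  ext S
  simp only [zeroLocus, fiberOver, Set.mem_ofPred_eq]
  constructor
  · intro hS f hf
    have := hS _ (Ideal.mem_comap.1 hf)
    rwa [← aeval_eq_eval, aeval_rename, h] at this
  · intro hS f hf
    have := hS (rename Sum.swap f) (by
      rw [Ideal.mem_comap, rename_rename, Sum.swap_swap_eq, rename_id]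
      exact hf)
    rwa [aeval_rename, h] at this

/-- Pairs of forms expressing the square root `ρ` as a rational function on the cone over `P`. -/
def IsRatio (P : Fin 3 → L) (ρ : L) (m : ℕ) (a b : PlaneRing k) : Prop :=
  a.IsHomogeneous (m + 1) ∧ b.IsHomogeneous m ∧ aeval P b ≠ 0 ∧ aeval P a = aeval P b * ρ

theorem IsGeneric.isRatio_or [Infinite L] (hg : IsGeneric q P Q)
    (hα : α ≠ 0) (hn : A.norm (P 0) (P 1) ≠ 0) (hP2 : P 2 ≠ 0) (hQ : Q = α • pt P (P 2 + ρ) ρ) :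
    (∃ (m : ℕ) (a b : PlaneRing k), IsRatio P ρ m a b) ∨
      ∀ a b : PlaneRing k, aeval P a = aeval P b * ρ → aeval P b = 0 := by
  by_cases h : ∀ a b : PlaneRing k, aeval P a = aeval P b * ρ → aeval P b = 0
  · exact .inr h
  · left
    push Not at h
    obtain ⟨a, b, hab, hb⟩ := h
    obtain ⟨i, hi, hPi⟩ := A.exists_ne_zero_of_norm_ne_zero hn
    obtain ⟨m, a', b', h⟩ := hg.exists_homogeneous_ratio hα hi hPi hP2 hQ hb hab
    exact ⟨m, a', b', h⟩

end Fiber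

section DegreeOver

variable {k : Type*} [Field k] [IsAlgClosed k] {A : Axes k} {d : k} {G : PlaneRing k} {L : Type*}
  [Field L] [Algebra k L] {P Q : Fin 3 → L} {ρ α : L}

/-- The generic fiber of a component of `π₁⁻¹(C)` over its image. -/
theorem IsComponentPoint.finite_setOf_ncard_ne {q : PrimeSpectrum (ProdRing k)}
    (h2 : (2 : k) ≠ 0) (h : IsComponentPoint A d G q.asIdeal P Q ρ α) (hPρ : P 2 + ρ ≠ 0)
    {D : PrimeCurve k} (hD : ∀ f, f ∈ D.ideal ↔ aeval Q f = 0) {τ β : L} (hβ : β ≠ 0) (hτ0 : τ ≠ 0)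
    (hτ : τ ^ 2 = A.norm (Q 0) (Q 1)) (hP : P = β • pt Q (Q 2 + τ) τ) :
    (∀ m (a b : PlaneRing k), a.IsHomogeneous m → aeval Q b ≠ 0 → aeval Q a = aeval Q b * τ →
      {R ∈ D.points | {S : Plane k | (S, R) ∈ zeroLocus q}.ncard ≠ 1}.Finite) ∧
    ((∀ a b : PlaneRing k, aeval Q a = aeval Q b * τ → aeval Q b = 0) →
      {R ∈ D.points | {S : Plane k | (S, R) ∈ zeroLocus q}.ncard ≠ 2}.Finite) := by
  have : Infinite L := Infinite.of_injective _ (algebraMap k L).injective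
  have hg := h.generic.swap
  obtain ⟨H, hH, ⟨m₀, hHh⟩, hDH⟩ := D.exists_equation
  have hdvd : ∀ f, H ∣ f ↔ aeval Q f = 0 := fun f => by
    rw [← hD, hDH, Ideal.mem_span_singleton]
  have hpts : ∀ R ∈ D.points, ∀ f : PlaneRing k, aeval Q f = 0 → aeval R.rep f = 0 :=
    fun R hR f hf => hR f ((hD f).2 hf)
  have hpts' : ∀ R ∈ D.points, aeval R.rep H = 0 := fun R hR => hpts R hR H ((hdvd H).1 dvd_rfl)
  have hnQ := h.snd_norm_ne_zero hPρ
  constructor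
  · intro m a b ha hb hab
    -- The fibre can be exceptional only where z a = 0 on D; in the irrational case below, only
    -- where z uv = 0.
    refine (finite_common_zeros hHh hH ((isHomogeneous_X k (2 : Fin 3)).mul ha) ?_).subset ?_
    · rw [hdvd, map_mul, hab]
      simpa using ⟨h.snd_two_ne_zero, hb, hτ0⟩
    · rintro R ⟨hR, hne⟩
      refine ⟨hpts' R hR, ?_⟩
      by_contra h0
      rw [map_mul, aeval_X, mul_eq_zero, not_or] at h0
      apply hne
      rw [fiberOver_comap_swap]
      exact hg.ncard_fiberOver_of_ratio hβ hP hab (hpts R hR) h0.1 h0.2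
  · intro hab
    refine (finite_common_zeros hHh hH ((isHomogeneous_X k (2 : Fin 3)).mul
      A.normPoly_isHomogeneous) ?_).subset ?_
    · rw [hdvd, map_mul]
      simpa using ⟨h.snd_two_ne_zero, hnQ⟩
    · rintro R ⟨hR, hne⟩
      refine ⟨hpts' R hR, ?_⟩
      by_contra h0
      rw [map_mul, aeval_X, mul_eq_zero, not_or, A.aeval_normPoly] at h0
      apply hne
      rw [fiberOver_comap_swap]
      exact hg.ncard_fiberOver_of_not_ratio h2 hβ hτ hP hab (hpts R hR) h0.1 h0.2

theorem PrimeCurve.points_infinite (D : PrimeCurve k) : D.points.Infinite := by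
  obtain ⟨H, hH, ⟨m, hHh⟩, hDH⟩ := D.exists_equation
  refine (infinite_zeros hHh hH).mono fun R hR f hf => ?_
  rw [hDH, Ideal.mem_span_singleton] at hf
  obtain ⟨c, rfl⟩ := hf
  have : eval R.rep H = 0 := hR
  rw [map_mul, this, zero_mul]

/-- The set defining the degree contains m, so its infimum is attained. Were it 0, almost all fibres
would have both m and 0 points, although D has infinitely many points. -/
theorem degreeOver_ne_zero {q : PrimeSpectrum (ProdRing k)} {D : PrimeCurve k} {m : ℕ} (hm : m ≠ 0)
    (h : {R ∈ D.points | {S : Plane k | (S, R) ∈ zeroLocus q}.ncard ≠ m}.Finite) :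
    degreeOver q D ≠ 0 := by
  intro h0
  have hmem : degreeOver q D ∈
      {m : ℕ | {R ∈ D.points | {S : Plane k | (S, R) ∈ zeroLocus q}.ncard ≠ m}.Finite} :=
    Nat.sInf_mem ⟨m, h⟩
  rw [h0] at hmem
  refine D.points_infinite ((h.union hmem).subset fun R hR => ?_)
  by_cases hR' : {S : Plane k | (S, R) ∈ zeroLocus q}.ncard = m
  · right
    exact ⟨hR, by rw [hR']; exact hm⟩
  · exact .inl ⟨hR, hR'⟩

end DegreeOver

/-! ### Coefficients of the proper conchoid, and reducibility of cycles. -/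

section Pushforward

variable {k : Type*} [Field k]

theorem pushforward_eq_single {q : PrimeSpectrum (ProdRing k)} {D : PrimeCurve k}
    (h : D.ideal = q.asIdeal.comap (rename Sum.inr : PlaneRing k →ₐ[k] ProdRing k)) :
    pushforward q = Finsupp.single D (degreeOver q D) := by
  have hex : ∃ D : PrimeCurve k,
      D.ideal = q.asIdeal.comap (rename Sum.inr : PlaneRing k →ₐ[k] ProdRing k) := ⟨D, h⟩
  have : hex.choose = D := PrimeCurve.ext (hex.choose_spec.trans h.symm)
  rw [pushforward, dif_pos hex, this]

theorem ideal_eq_of_pushforward_ne_zero {q : PrimeSpectrum (ProdRing k)} {D : PrimeCurve k}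
    (h : pushforward q D ≠ 0) :
    D.ideal = q.asIdeal.comap (rename Sum.inr : PlaneRing k →ₐ[k] ProdRing k) := by
  classical
  by_cases hex : ∃ D : PrimeCurve k,
      D.ideal = q.asIdeal.comap (rename Sum.inr : PlaneRing k →ₐ[k] ProdRing k)
  · obtain ⟨D', hD'⟩ := hex
    rw [pushforward_eq_single hD', Finsupp.single_apply] at h
    by_cases e : D' = D
    · rwa [← e]
    · exact absurd (if_neg e) h
  · rw [pushforward, dif_neg hex] at h
    exact absurd rfl h

theorem conchoid_eq_sum (F G : PlaneRing k) :
    conchoid F G = ∑ q ∈ (pullbackComponents_finite F G).toFinset,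
      pullbackMultiplicity F G q • pushforward q :=
  finsum_mem_eq_finite_toFinset_sum _ _

/-- The components of `π₁⁻¹(C)` lying over the curve `D`. -/
def componentsOver (F G : PlaneRing k) (D : PrimeCurve k) : Set (PrimeSpectrum (ProdRing k)) :=
  {q ∈ pullbackComponents F G |
    D.ideal = q.asIdeal.comap (rename Sum.inr : PlaneRing k →ₐ[k] ProdRing k)}

theorem exists_of_properConchoid_ne_zero {F G : PlaneRing k} {D : PrimeCurve k}
    (h : properConchoid F G D ≠ 0) : ¬ IsExceptional F D ∧ ∃ q, q ∈ componentsOver F G D := by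
  classical
  rw [properConchoid, Finsupp.filter_apply] at h
  by_cases hD : IsExceptional F D
  · simp [hD] at h
  · refine ⟨hD, ?_⟩
    rw [if_pos hD, conchoid_eq_sum, Finsupp.finsetSum_apply] at h
    obtain ⟨q, hq, hne⟩ := Finset.exists_ne_zero_of_sum_ne_zero h
    rw [Set.Finite.mem_toFinset] at hq
    refine ⟨q, hq, ideal_eq_of_pushforward_ne_zero fun h0 => hne ?_⟩
    rw [Finsupp.smul_apply, h0, smul_zero]

theorem single_le_properConchoid {F G : PlaneRing k} {D : PrimeCurve k} (hD : ¬ IsExceptional F D)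
    {s : Finset (PrimeSpectrum (ProdRing k))} (hs : ∀ q ∈ s, q ∈ componentsOver F G D) :
    ∑ q ∈ s, pullbackMultiplicity F G q * degreeOver q D ≤ properConchoid F G D := by
  classical
  rw [properConchoid, Finsupp.filter_apply, if_pos hD, conchoid_eq_sum, Finsupp.finsetSum_apply]
  calc _ = ∑ q ∈ s, (pullbackMultiplicity F G q • pushforward q) D := by
        refine Finset.sum_congr rfl fun q hq => ?_
        rw [pushforward_eq_single (hs q hq).2]; simp
    _ ≤ _ := Finset.sum_le_sum_of_subset fun q hq => by
        rw [Set.Finite.mem_toFinset]; exact (hs q hq).1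

theorem properConchoid_eq_of_subset_singleton {F G : PlaneRing k} {D : PrimeCurve k}
    (hD : ¬ IsExceptional F D) {q : PrimeSpectrum (ProdRing k)} (hq : q ∈ componentsOver F G D)
    (h : ∀ q' ∈ componentsOver F G D, q' = q) :
    properConchoid F G D = pullbackMultiplicity F G q * degreeOver q D := by
  classical
  rw [properConchoid, Finsupp.filter_apply, if_pos hD, conchoid_eq_sum, Finsupp.finsetSum_apply,
    Finset.sum_eq_single q]
  · rw [pushforward_eq_single hq.2]; simp
  · intro q' hq' hne
    rw [Set.Finite.mem_toFinset] at hq'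
    by_contra h0
    refine hne (h q' ⟨hq', ideal_eq_of_pushforward_ne_zero fun h1 => h0 ?_⟩)
    rw [Finsupp.smul_apply, h1, smul_zero]
  · intro h0
    rw [Set.Finite.mem_toFinset] at h0
    exact absurd hq.1 h0

theorem Cycle.isReducible_of_two_le {E : Cycle k} {D : PrimeCurve k} (h : 2 ≤ E D) :
    E.IsReducible := by
  have h1 : Finsupp.single D 1 ≤ E := by
    rw [Finsupp.single_le_iff]; omega
  refine ⟨Finsupp.single D 1, E - Finsupp.single D 1, by simp, fun h0 => ?_,
    (add_tsub_cancel_of_le h1).symm⟩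
  have := DFunLike.congr_fun h0 D
  simp only [Finsupp.tsub_apply, Finsupp.single_eq_same, Finsupp.coe_zero, Pi.zero_apply] at this
  omega

theorem Cycle.isReducible_of_hasTwoComponents {E : Cycle k} (h : E.HasTwoComponents) :
    E.IsReducible := by
  obtain ⟨D₁, h₁, D₂, h₂, hne⟩ := h
  rw [Finsupp.mem_support_iff] at h₁ h₂
  have h1 : Finsupp.single D₁ 1 ≤ E := by
    rw [Finsupp.single_le_iff]; omega
  refine ⟨Finsupp.single D₁ 1, E - Finsupp.single D₁ 1, by simp, fun h0 => ?_,
    (add_tsub_cancel_of_le h1).symm⟩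
  have := DFunLike.congr_fun h0 D₂
  rw [Finsupp.tsub_apply, Finsupp.single_eq_of_ne hne.symm] at this
  exact h₂ this

/-- If at most one curve occurs, two nonzero summands must share it, and their coefficients add up
to at least 2. -/
theorem Cycle.eq_of_isReducible {E : Cycle k} (h : E.IsReducible)
    (h1 : ∀ D D', E D ≠ 0 → E D' ≠ 0 → D = D') : ∃ D, 2 ≤ E D := by
  obtain ⟨D₁, D₂, h₁, h₂, rfl⟩ := h
  obtain ⟨a, ha⟩ := DFunLike.ne_iff.1 h₁
  obtain ⟨b, hb⟩ := DFunLike.ne_iff.1 h₂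
  rw [Finsupp.coe_zero, Pi.zero_apply] at ha hb
  have : a = b := h1 a b (by rw [Finsupp.add_apply]; omega) (by rw [Finsupp.add_apply]; omega)
  subst this
  exact ⟨a, by rw [Finsupp.add_apply]; omega⟩

end Pushforward

/-! ### Irreducibility of the conics z² = e uv. -/

section Main

variable {k : Type*} [Field k] {A : Axes k} {d : k} {G : PlaneRing k}

theorem Axes.exists_uv (A : Axes k) (s t : k) : ∃ x y : k, A.u x y = s ∧ A.v x y = t := by
  have h := A.det_ne_zero
  refine ⟨(A.v₁ * s - A.u₁ * t) / (A.u₀ * A.v₁ - A.u₁ * A.v₀),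
    (A.u₀ * t - A.v₀ * s) / (A.u₀ * A.v₁ - A.u₁ * A.v₀), ?_, ?_⟩
  · simp only [u, Algebra.algebraMap_self, RingHom.id_apply]; field_simp; ring
  · simp only [v, Algebra.algebraMap_self, RingHom.id_apply]
    rw [mul_div_assoc', mul_div_assoc', ← add_div, div_eq_iff h]; ring

theorem Axes.conic_isHomogeneous (A : Axes k) (e : k) :
    (X 2 ^ 2 - C e * A.normPoly : PlaneRing k).IsHomogeneous 2 :=
  ((isHomogeneous_X k (2 : Fin 3)).pow 2).sub
    (by simpa using (isHomogeneous_C (Fin 3) e).mul A.normPoly_isHomogeneous)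

/-- A degree count reduces the claim to excluding a line in the conic. On a line through A the
coordinate z varies freely while uv stays fixed. On any other line z is a linear form in x, y whose
square would be e uv: it would vanish at (u, v) = (1, 0) and (0, 1), hence at (1, 1), where e uv = e
≠ 0. -/
theorem Axes.associated_of_dvd_conic {δ : ℕ} (hG : G.IsHomogeneous δ) (hGirr : Irreducible G)
    {e : k} (he : e ≠ 0) (h : G ∣ X 2 ^ 2 - C e * A.normPoly) :
    Associated G (X 2 ^ 2 - C e * A.normPoly) := by
  have hev : ∀ v : Fin 3 → k, aeval v G = 0 → v 2 ^ 2 = e * A.norm (v 0) (v 1) := by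
    intro v hv
    obtain ⟨c, hc⟩ := h
    have := congrArg (aeval v) hc
    rw [map_mul, hv, zero_mul] at this
    rw [map_sub, map_mul, A.aeval_normPoly] at this
    simpa [sub_eq_zero] using this
  have hne : (X 2 ^ 2 - C e * A.normPoly : PlaneRing k) ≠ 0 := by
    intro h0
    have := congrArg (aeval (![0, 0, 1] : Fin 3 → k)) h0
    rw [map_sub, map_mul, A.aeval_normPoly] at this
    simp at this
  have h1 : δ ≠ 1 := by
    rintro rfl
    obtain ⟨a, b, c, rfl⟩ := exists_linear_of_isHomogeneous_one hG
    by_cases hc : c = 0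
    · have e1 := hev ![b, -a, 0] (by simp [hc]; ring)
      have e2 := hev ![b, -a, 1] (by simp [hc]; ring)
      simp only [Matrix.cons_val_zero, Matrix.cons_val_one, Matrix.cons_val] at e1 e2
      rw [← e1] at e2
      simp at e2
    · obtain ⟨x, y, hu, hv⟩ := A.exists_uv 1 0
      obtain ⟨x', y', hu', hv'⟩ := A.exists_uv 0 1
      have hz : ∀ x y : k, (a * x + b * y) ^ 2 = c ^ 2 * e * A.norm x y := by
        intro x y
        have := hev ![x, y, -(a * x + b * y) / c] (by simp; field_simp; ring)
        simp only [Matrix.cons_val_zero, Matrix.cons_val_one, Matrix.cons_val] at this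
        rw [mul_assoc, ← this]; field_simp
      have e1 := hz x y
      have e2 := hz x' y'
      have e3 := hz (x + x') (y + y')
      have hu3 : A.u (x + x') (y + y') = 1 := by
        have : A.u (x + x') (y + y') = A.u x y + A.u x' y' := by simp only [Axes.u]; ring
        rw [this, hu, hu', add_zero]
      have hv3 : A.v (x + x') (y + y') = 1 := by
        have : A.v (x + x') (y + y') = A.v x y + A.v x' y' := by simp only [Axes.v]; ring
        rw [this, hv, hv', zero_add]
      rw [Axes.norm, hu, hv, mul_zero, mul_zero, pow_eq_zero_iff two_ne_zero] at e1
      rw [Axes.norm, hu', hv', zero_mul, mul_zero, pow_eq_zero_iff two_ne_zero] at e2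
      have : a * (x + x') + b * (y + y') = 0 := by linear_combination e1 + e2
      rw [Axes.norm, hu3, hv3, this] at e3
      simp [hc, he] at e3
  obtain ⟨c, hc⟩ := h
  have hG0 := hGirr.ne_zero
  have hc0 : c ≠ 0 := by rintro rfl; rw [mul_zero] at hc; exact hne hc
  have hdeg : δ + c.totalDegree = 2 := by
    rw [← hG.totalDegree hG0, ← totalDegree_mul_of_isDomain hG0 hc0, ← hc]
    exact (A.conic_isHomogeneous e).totalDegree hne
  have hδ0 : δ ≠ 0 := by
    rintro rfl
    rw [← totalDegree_zero_iff_isHomogeneous, totalDegree_eq_zero_iff_eq_C] at hG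
    apply hGirr.not_isUnit
    rw [hG] at hG0 ⊢
    exact (IsUnit.mk0 _ (fun h => hG0 (by rw [h, C_0]))).map _
  have hc2 : c.totalDegree = 0 := by omega
  rw [totalDegree_eq_zero_iff_eq_C] at hc2
  have hcu : IsUnit c := by
    rw [hc2] at hc0 ⊢
    exact (IsUnit.mk0 _ (fun h => hc0 (by rw [h, C_0]))).map _
  rw [hc]
  exact (associated_mul_unit_right _ _ hcu)

theorem exists_isComponentPoint_of_mem (hd : d ≠ 0) {δ : ℕ} (hG : G.IsHomogeneous δ)
    (hGirr : Irreducible G) (hGz : ¬ G ∣ X 2) {D : PrimeCurve k} {q : PrimeSpectrum (ProdRing k)}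
    (hq : q ∈ componentsOver (A.conic d) G D)
    (hD : ¬ (A.conic d ∈ D.ideal ∨ A.uPoly ∈ D.ideal ∨ A.vPoly ∈ D.ideal)) :
    (∀ f, f ∈ D.ideal ↔ aeval (genericSnd q.asIdeal) f = 0) ∧ ∃ ρ α,
      IsComponentPoint A d G q.asIdeal (genericFst q.asIdeal) (genericSnd q.asIdeal) ρ α := by
  have hDQ : ∀ f, f ∈ D.ideal ↔ aeval (genericSnd q.asIdeal) f = 0 := fun f => by
    rw [hq.2, Ideal.mem_comap, mem_iff_aeval_generic, aeval_rename, Sum.elim_comp_inr]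
  simp only [hDQ, not_or] at hD
  exact ⟨hDQ, exists_isComponentPoint hd hG hGirr hGz hq.1.1 (mem_iff_aeval_generic q.asIdeal)
    hq.1.2.1 hD.1 hD.2.1 hD.2.2⟩

end Main

/-! ### Curves stable under many homotheties with centre A. -/

section Homothety

variable {k : Type*} [Field k] {G : PlaneRing k} {δ : ℕ}

theorem cast_injOn_range {p : ℕ} [CharP k p] (hp : p = 0 ∨ δ < p) {L : Type*} [Field L]
    [Algebra k L] : Set.InjOn (fun n : ℕ => (n : L)) (Finset.range (δ + 1)) := by
  have : CharP L p := charP_of_injective_algebraMap (algebraMap k L).injective p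
  intro m hm n hn hmn
  simp only [Finset.coe_range, Set.mem_Iio] at hm hn
  rcases hp with rfl | hp
  · have := CharP.charP_to_charZero L
    exact Nat.cast_injective hmn
  · have h := (CharP.natCast_eq_natCast L p).1 hmn
    rwa [Nat.ModEq, Nat.mod_eq_of_lt (by omega), Nat.mod_eq_of_lt (by omega)] at h

/-- As a polynomial in s, G(x(r + sz), y(r + sz), zr) has degree at most δ and vanishes at s = 0, 2,
…, 2δ. These values are distinct by the hypothesis on the characteristic, so the polynomial is zero;
up to scalars its arguments are all the points [xσ : yσ : zτ] with τ ≠ 0. -/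
theorem aeval_pt_eq_zero_of_forall_nat {L : Type*} [Field L] [Algebra k L] {p : ℕ} [CharP k p]
    (hp : p = 0 ∨ (2 < p ∧ δ < p)) (hG : G.IsHomogeneous δ) {P : Fin 3 → L} (hP : P 2 ≠ 0) {r : L}
    (hr : r ≠ 0) (h : ∀ n : ℕ, aeval (pt P (r + 2 * n * P 2) r) G = 0) (σ τ : L) (hτ : τ ≠ 0) :
    aeval (pt P σ τ) G = 0 := by
  classical
  have hL2 : (2 : L) ≠ 0 := by
    have : CharP L p := charP_of_injective_algebraMap (algebraMap k L).injective p
    rcases hp with rfl | hp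
    · have := CharP.charP_to_charZero L
      exact two_ne_zero
    · intro h2
      have := (CharP.cast_eq_zero_iff L p 2).1 (by exact_mod_cast h2)
      exact absurd (Nat.le_of_dvd two_pos this) (by omega)
  let g : Polynomial L := aeval (pt (fun i => Polynomial.C (P i))
    (Polynomial.C r + Polynomial.X * Polynomial.C (P 2)) (Polynomial.C r)) G
  have hev : ∀ s, g.eval s = aeval (pt P (r + s * P 2) r) G := by
    intro s
    have : ((Polynomial.aeval s : Polynomial L →ₐ[L] L).restrictScalars k).comp
        (aeval (pt (fun i => Polynomial.C (P i))
          (Polynomial.C r + Polynomial.X * Polynomial.C (P 2)) (Polynomial.C r))) =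
        (aeval (pt P (r + s * P 2) r) : PlaneRing k →ₐ[k] L) := by
      apply algHom_ext; intro i; fin_cases i <;> simp [mul_comm s]
    rw [← this]; simp [g]
  have hdeg : g.natDegree ≤ δ := by
    have hg' : g = aeval (pt (fun i => Polynomial.C (P i))
        (Polynomial.C r + Polynomial.X * Polynomial.C (P 2)) (Polynomial.C r))
        (map (algebraMap k L) G) := (aeval_map_algebraMap L _ G).symm
    rw [hg']
    refine (MvPolynomial.aeval_natDegree_le _ (hG.map (algebraMap k L)).totalDegree_le _ (n := 1)
      fun i => ?_).trans (mul_one δ).le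
    have h1 : (Polynomial.C r + Polynomial.X * Polynomial.C (P 2)).natDegree ≤ 1 := by compute_degree
    fin_cases i
    · exact (Polynomial.natDegree_C_mul_le _ _).trans h1
    · exact (Polynomial.natDegree_C_mul_le _ _).trans h1
    · exact (Polynomial.natDegree_C_mul_le _ _).trans (by simp)
  have hg : g = 0 := by
    refine Polynomial.eq_zero_of_natDegree_lt_card_of_eval_eq_zero' g
      ((Finset.range (δ + 1)).image fun n : ℕ => (2 * n : L)) ?_ ?_
    · intro s hs
      obtain ⟨n, -, rfl⟩ := Finset.mem_image.1 hs
      rw [hev, h n]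
    · rw [Finset.card_image_of_injOn, Finset.card_range]
      · omega
      · intro m hm n hn hmn
        exact cast_injOn_range (k := k) (hp.imp_right And.right) hm hn (mul_left_cancel₀ hL2 hmn)
  have e : pt P σ τ = (τ / r) • pt P (r + (r * σ / τ - r) / P 2 * P 2) r := by
    rw [smul_pt]; congr 1 <;> field_simp; ring
  rw [e, aeval_smul_of_isHomogeneous hG, ← hev, hg, Polynomial.eval_zero, mul_zero]

/-- For a point R of the curve off A and L∞, the affine part of the line AR lies on the curve.
Infinitely many common zeros force G to divide the equation of this line, and the ratio s = 0 puts A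
on the curve. -/
theorem isLine_of_forall_aeval_pt [IsAlgClosed k] (hG : G.IsHomogeneous δ) (hGirr : Irreducible G)
    (hGz : ¬ G ∣ X 2)
    (h : ∀ (R : Fin 3 → k) (s t : k), aeval R G = 0 → t ≠ 0 → aeval (pt R s t) G = 0) :
    δ = 1 ∧ eval (origin k) G = 0 := by
  have hinf : Infinite k := IsAlgClosed.instInfinite
  have h0 : (origin k) ≠ 0 := fun h => by simpa [origin] using congrFun h 2
  obtain ⟨R, hRG, hR2⟩ : ∃ R ∈ {R : Plane k | aeval R.rep G = 0},
      R ∉ {R : Plane k | aeval R.rep G = 0 ∧ aeval R.rep (X 2 : PlaneRing k) = 0} ∪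
        {Projectivization.mk k _ h0} := by
    have := (infinite_zeros hG hGirr).sdiff
      ((finite_common_zeros hG hGirr (isHomogeneous_X k (2 : Fin 3)) hGz).union
        (Set.finite_singleton (Projectivization.mk k _ h0)))
    obtain ⟨R, hR⟩ := this.nonempty
    exact ⟨R, hR.1, hR.2⟩
  simp only [Set.mem_union, Set.mem_ofPred_eq, aeval_X, Set.mem_singleton_iff, not_or, not_and] at hRG hR2
  obtain ⟨hz, hor⟩ := hR2
  replace hz := hz hRG
  have hxy : R.rep 0 ≠ 0 ∨ R.rep 1 ≠ 0 := by
    by_contra! h'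
    apply hor
    conv_lhs => rw [← R.mk_rep]
    refine mk_eq_mk_of_crossForm R.rep_nonzero h0 fun i j => ?_
    fin_cases i <;> fin_cases j <;> simp [origin, h'.1, h'.2]
  have hline : ∀ s t : k, t ≠ 0 → aeval (![R.rep 0 * s, R.rep 1 * s, t]) G = 0 := by
    intro s t ht
    have := h R.rep s (t / R.rep 2) hRG (div_ne_zero ht hz)
    rwa [pt, mul_div_cancel₀ _ hz] at this
  refine ⟨?_, ?_⟩
  · have hne : ∀ t : kˣ, (![R.rep 0, R.rep 1, t] : Fin 3 → k) ≠ 0 := fun t h =>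
      t.ne_zero (by simpa using congrFun h 2)
    have hdvd : G ∣ crossForm R.rep 0 1 := by
      by_contra hcon
      have hfin := finite_common_zeros hG hGirr (crossForm_isHomogeneous R.rep 0 1) hcon
      have hku : Infinite kˣ := by
        rw [(unitsEquivNeZero (G₀ := k)).infinite_iff]
        exact (Set.finite_singleton (0 : k)).infinite_compl.to_subtype
      refine Set.infinite_of_injective_forall_mem (f := fun t : kˣ => Projectivization.mk k _ (hne t))
        ?_ (fun t => ?_) hfin
      · intro t t' htt
        simp only at htt
        rw [Projectivization.mk_eq_mk_iff'] at htt
        obtain ⟨c, hc⟩ := htt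
        have e0 := congrFun hc 0
        have e1 := congrFun hc 1
        have e2 := congrFun hc 2
        simp at e0 e1 e2
        have hc1 : c = 1 := by
          rcases hxy with hx | hx
          · simpa [hx] using e0
          · simpa [hx] using e1
        rw [hc1, one_mul] at e2
        exact (Units.ext e2).symm
      · obtain ⟨c, hc⟩ := Projectivization.exists_smul_eq_mk_rep k _ (hne t)
        have hc' : (Projectivization.mk k _ (hne t)).rep = (c : k) • ![R.rep 0, R.rep 1, (t : k)] := hc.symm
        simp only [Set.mem_ofPred_eq]
        rw [hc', aeval_smul_eq_zero_iff hG c.ne_zero,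
          aeval_smul_eq_zero_iff (crossForm_isHomogeneous R.rep 0 1) c.ne_zero]
        refine ⟨by simpa using hline 1 t t.ne_zero, ?_⟩
        simp [crossForm]; ring
    have hc0 : crossForm R.rep 0 1 ≠ 0 := by
      intro h'
      have e1 := congrArg (aeval (![1, 0, 0] : Fin 3 → k)) h'
      have e2 := congrArg (aeval (![0, 1, 0] : Fin 3 → k)) h'
      simp [crossForm] at e1 e2
      tauto
    have hirr := irreducible_of_isHomogeneous_one (crossForm_isHomogeneous R.rep 0 1) hc0
    have hass : Associated G (crossForm R.rep 0 1) := hGirr.associated_of_dvd hirr hdvd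
    obtain ⟨c, hc⟩ := hdvd
    have hcc : c ≠ 0 := by rintro rfl; rw [mul_zero] at hc; exact hc0 hc
    have := (crossForm_isHomogeneous R.rep 0 1).totalDegree hc0
    rw [hc, totalDegree_mul_of_isDomain hGirr.ne_zero hcc, hG.totalDegree hGirr.ne_zero] at this
    have hδ0 : δ ≠ 0 := by
      rintro rfl
      rw [← totalDegree_zero_iff_isHomogeneous, totalDegree_eq_zero_iff_eq_C] at hG
      apply hGirr.not_isUnit
      have hG0 := hGirr.ne_zero
      rw [hG] at hG0 ⊢
      exact (IsUnit.mk0 _ (fun h => hG0 (by rw [h, C_0]))).map _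
    omega
  · have := hline 0 1 one_ne_zero
    simpa [origin] using this

/-- An irreducible curve that contains, with its generic point, the images of this point under
arbitrarily many homotheties with center `A` is a line through `A`. -/
theorem isLine_of_forall_nat [IsAlgClosed k] {L : Type*} [Field L] [Algebra k L] {p : ℕ} [CharP k p]
    (hp : p = 0 ∨ (2 < p ∧ δ < p)) (hG : G.IsHomogeneous δ) (hGirr : Irreducible G)
    {P : Fin 3 → L} (hPG : ∀ f : PlaneRing k, aeval P f = 0 ↔ G ∣ f) (hP : P 2 ≠ 0) {r : L}
    (hr : r ≠ 0) (h : ∀ n : ℕ, aeval (pt P (r + 2 * n * P 2) r) G = 0) :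
    δ = 1 ∧ eval (origin k) G = 0 := by
  refine isLine_of_forall_aeval_pt hG hGirr (fun h => hP (by simpa using (hPG _).2 h))
    fun R s t hR ht => ?_
  have h1 := aeval_pt_eq_zero_of_forall_nat hp hG hP hr h (algebraMap k L s) (algebraMap k L t)
    (by simpa using ht)
  have h2 : aeval (pt P (algebraMap k L s) (algebraMap k L t)) G =
      aeval P (aeval (pt X (C s) (C t)) G : PlaneRing k) := by
    rw [← AlgHom.comp_apply]
    congr 1
    apply algHom_ext; intro i; fin_cases i <;> simp
  rw [h2, hPG] at h1
  obtain ⟨c, hc⟩ := h1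
  have h3 : aeval (pt R s t) G = aeval R (aeval (pt X (C s) (C t)) G : PlaneRing k) := by
    rw [← AlgHom.comp_apply]
    congr 1
    apply algHom_ext; intro i; fin_cases i <;> simp
  rw [h3, hc, map_mul, hR, zero_mul]

end Homothety

/-! ### The case where uv is not a square on C: one reduced component, of degree one over its image.
-/

section Nonsplit

variable {k : Type*} [Field k] {A : Axes k} {d : k} {G : PlaneRing k} {δ : ℕ}

/-- The product `u v` is the square of a rational function on the cone over `G = 0`. -/
def HasRoot (A : Axes k) (G : PlaneRing k) : Prop :=
  ∃ (m : ℕ) (a b : PlaneRing k), a.IsHomogeneous (m + 1) ∧ b.IsHomogeneous m ∧ ¬ G ∣ b ∧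
    G ∣ a ^ 2 - A.normPoly * b ^ 2

theorem Axes.exists_linear_eq (A : Axes k) (a b : k) :
    ∃ s t : k, C a * X 0 + C b * X 1 = C s * A.uPoly + C t * A.vPoly := by
  have h := A.det_ne_zero
  obtain ⟨s, t, rfl, rfl⟩ : ∃ s t, a = s * A.u₀ + t * A.v₀ ∧ b = s * A.u₁ + t * A.v₁ := by
    refine ⟨(a * A.v₁ - b * A.v₀) / (A.u₀ * A.v₁ - A.u₁ * A.v₀),
      (b * A.u₀ - a * A.u₁) / (A.u₀ * A.v₁ - A.u₁ * A.v₀), ?_, ?_⟩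
    all_goals rw [div_mul_eq_mul_div, div_mul_eq_mul_div, ← add_div, eq_div_iff h]; ring
  refine ⟨s, t, ?_⟩
  simp only [uPoly, vPoly, u, v, algebraMap_eq, C_add, C_mul]
  ring

variable {L : Type*} [Field L] [Algebra k L] {q : Ideal (ProdRing k)} {P Q : Fin 3 → L} {ρ α : L}

theorem IsComponentPoint.hasRoot (h : IsComponentPoint A d G q P Q ρ α) {m : ℕ} {a b : PlaneRing k}
    (hab : IsRatio P ρ m a b) : HasRoot A G := by
  obtain ⟨ha, hb, hb0, e⟩ := hab
  refine ⟨m, a, b, ha, hb, fun hh => hb0 ((h.dvd_iff _).2 hh), (h.dvd_iff _).1 ?_⟩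
  rw [map_sub, map_mul, map_pow, map_pow, A.aeval_normPoly, ← h.sq_eq, e]; ring

variable [IsAlgClosed k]

/-- On the line su + tv = 0 with s ≠ 0 one has uv = -(t/s)v², a square over an algebraically closed
field; if s = 0 the line is v = 0 and uv vanishes on it. -/
theorem HasRoot.of_isLine (hG : G.IsHomogeneous 1) (hGirr : Irreducible G)
    (hA : eval (origin k) G = 0) : HasRoot A G := by
  have hb : ¬ G ∣ 1 := fun h => hGirr.not_isUnit (isUnit_of_dvd_one h)
  obtain ⟨a, b, c, rfl⟩ := exists_linear_of_isHomogeneous_one hG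
  obtain rfl : c = 0 := by simpa [origin] using hA
  rw [C_0, zero_mul, add_zero] at hb ⊢
  obtain ⟨s, t, hst⟩ := A.exists_linear_eq a b
  rw [hst] at hb ⊢
  by_cases hs : s = 0
  · refine ⟨0, 0, 1, isHomogeneous_zero _ _ _, isHomogeneous_one _ _, hb, ?_⟩
    have ht : t ≠ 0 := by
      rintro rfl
      rw [hs] at hst
      apply hGirr.ne_zero
      rw [C_0, zero_mul, add_zero, hst]; simp
    refine ⟨-(C t⁻¹ * A.uPoly), ?_⟩
    have : (C t : PlaneRing k) * C t⁻¹ = 1 := by rw [← C_mul, mul_inv_cancel₀ ht, C_1]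
    rw [hs, A.normPoly_eq, C_0]
    linear_combination (A.uPoly * A.vPoly) * this
  · obtain ⟨r, hr⟩ := IsAlgClosed.exists_pow_nat_eq (-t / s) (n := 2) two_pos
    refine ⟨0, C r * A.vPoly, 1, ?_, isHomogeneous_one _ _, hb, -(C s⁻¹ * A.vPoly), ?_⟩
    · simpa using (isHomogeneous_C (Fin 3) r).mul A.vPoly_isHomogeneous
    · have h1 : (C s : PlaneRing k) * C s⁻¹ = 1 := by rw [← C_mul, mul_inv_cancel₀ hs, C_1]
      have h2 : (C r : PlaneRing k) ^ 2 = -(C t * C s⁻¹) := by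
        rw [← C_pow, hr, ← C_mul, ← C_neg]; congr 1; ring
      rw [A.normPoly_eq]
      linear_combination A.vPoly ^ 2 * h2 + (A.uPoly * A.vPoly) * h1

namespace IsComponentPoint

theorem not_ratio (h : IsComponentPoint A d G q P Q ρ α) (hroot : ¬ HasRoot A G) :
    ∀ a b : PlaneRing k, aeval P a = aeval P b * ρ → aeval P b = 0 := by
  have : Infinite L := Infinite.of_injective _ (algebraMap k L).injective
  refine (h.generic.isRatio_or h.scale_ne_zero h.norm_ne_zero h.fst_two_ne_zero h.snd_eq).resolve_left ?_
  rintro ⟨m, a, b, hab⟩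
  exact hroot (h.hasRoot hab)

/-- Otherwise ρ = -nz would be rational. This keeps the scale factors of the iteration in
`isLine_of_not_ratio` nonzero. -/
theorem root_add_ne_zero (h : IsComponentPoint A d G q P Q ρ α) (hroot : ¬ HasRoot A G) (n : ℕ) :
    ρ + n * P 2 ≠ 0 := by
  intro h0
  have := h.not_ratio hroot (-((n : PlaneRing k) * X 2)) 1 (by
    rw [map_neg, map_mul, map_natCast, aeval_X, map_one]; linear_combination -h0)
  simp at this

/-- With ρ irrational, q vanishes at every incident pair over a specialisation of P with either
root, in particular at the generic point of q'. By symmetry there is only one component. -/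
theorem le_of_not_hasRoot {L' : Type*} [Field L'] [Algebra k L'] {q' : Ideal (ProdRing k)}
    {P' Q' : Fin 3 → L'} {ρ' α' : L'} (h : IsComponentPoint A d G q P Q ρ α)
    (h' : IsComponentPoint A d G q' P' Q' ρ' α') (hroot : ¬ HasRoot A G) : q ≤ q' := by
  have : Infinite L := Infinite.of_injective _ (algebraMap k L).injective
  intro f hf
  have := h.generic.eval_smul_eq_zero (fun f hf => h.generic.eval_pt_of_not_ratio h.scale_ne_zero
    h.sq_eq h.snd_eq (h.not_ratio hroot) (fun g hg => (h'.dvd_iff g).2 ((h.dvd_iff g).1 hg))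
    h'.sq_eq hf) 1 α' f hf
  rwa [one_smul, ← h'.snd_eq, ← h'.generic.mem_iff] at this

/-- The homothetic image `pt P c ρ` of P has uv = (ρc)². Passing along q with the root ρc leads to c
+ z on the image curve; as τ is irrational too, the way back may use the root ρ(c + z), which leads
to c + 2z on C instead of returning to c. Starting from c = ρ, the curve contains the points with c
= ρ + 2nz. -/
theorem isLine_of_not_ratio {p : ℕ} [CharP k p]
    (hp : p = 0 ∨ (2 < p ∧ δ < p)) (hG : G.IsHomogeneous δ) (hGirr : Irreducible G)
    (h : IsComponentPoint A d G q P Q ρ α) (hroot : ¬ HasRoot A G)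
    {τ β : L} (hβ : β ≠ 0) (hτ : τ ^ 2 = A.norm (Q 0) (Q 1)) (hP : P = β • pt Q (Q 2 + τ) τ)
    (hab : ∀ a b : PlaneRing k, aeval Q a = aeval Q b * τ → aeval Q b = 0) :
    δ = 1 ∧ eval (origin k) G = 0 := by
  have : Infinite L := Infinite.of_injective _ (algebraMap k L).injective
  have hn := h.norm_ne_zero
  refine isLine_of_forall_nat hp hG hGirr h.dvd_iff h.fst_two_ne_zero h.root_ne_zero fun n => ?_
  suffices H : ∀ n : ℕ, ∀ f : PlaneRing k, aeval P f = 0 → aeval (pt P (ρ + 2 * n * P 2) ρ) f = 0 from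
    H n G ((h.dvd_iff G).2 dvd_rfl)
  intro n
  induction n with
  | zero =>
    intro f hf
    have := h.generic.isConical_fst f hf ρ
    refine Eq.trans (congrArg (fun R => aeval R f) ?_) this
    exact ext_three (by simp [mul_comm]) (by simp [mul_comm]) (by simp [mul_comm])
  | succ n ih =>
    have hc : ρ + 2 * n * P 2 ≠ 0 := by exact_mod_cast h.root_add_ne_zero hroot (2 * n)
    have hc' : ρ + (2 * n + 1) * P 2 ≠ 0 := by exact_mod_cast h.root_add_ne_zero hroot (2 * n + 1)
    have hnorm : ∀ c : L, (ρ * c) ^ 2 = A.norm (pt P c ρ 0) (pt P c ρ 1) := fun c => by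
      rw [pt_zero, pt_one, A.norm_mul, ← h.sq_eq]; ring
    have hstep : ∀ c : L, pt (pt P c ρ) (pt P c ρ 2 + ρ * c) (ρ * c) =
        (ρ * c) • pt P (c + P 2) ρ := fun c =>
      ext_three (by simp; ring) (by simp; ring) (by simp; ring)
    have h1 : ∀ f ∈ q, aeval (Sum.elim (pt P (ρ + 2 * n * P 2) ρ)
        (pt P (ρ + (2 * n + 1) * P 2) ρ)) f = 0 := by
      have := h.generic.eval_smul_eq_zero (fun f hf => h.generic.eval_pt_of_not_ratio
        h.scale_ne_zero h.sq_eq h.snd_eq (h.not_ratio hroot) ih (hnorm _) hf)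
        1 (ρ * (ρ + 2 * n * P 2))⁻¹
      rw [one_smul, hstep, smul_smul, inv_mul_cancel₀ (mul_ne_zero h.root_ne_zero hc), one_smul,
        add_assoc, ← add_one_mul] at this
      exact this
    have h2 : ∀ f : PlaneRing k, aeval Q f = 0 → aeval (pt P (ρ + (2 * n + 1) * P 2) ρ) f = 0 := by
      intro f hf
      have := h1 (rename Sum.inr f) (by
        rw [h.generic.mem_iff, aeval_rename, Sum.elim_comp_inr, hf])
      rwa [aeval_rename, Sum.elim_comp_inr] at this
    intro f hf
    have h3 := h.generic.swap.eval_smul_eq_zero (fun f hf => h.generic.swap.eval_pt_of_not_ratio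
        hβ hτ hP hab h2 (hnorm _) hf) 1 (ρ * (ρ + (2 * n + 1) * P 2))⁻¹ (rename Sum.inr f) (by
          rw [h.generic.swap.mem_iff, aeval_rename, Sum.elim_comp_inr, hf])
    rw [aeval_rename, Sum.elim_comp_inr, hstep, smul_smul,
      inv_mul_cancel₀ (mul_ne_zero h.root_ne_zero hc'), one_smul] at h3
    refine Eq.trans (congrArg (fun c => aeval (pt P c ρ) f) ?_) h3
    push_cast; ring

end IsComponentPoint

/-- When `u v` is not a square on the curve, the proper conchoid is a reduced irreducible curve or
zero. -/
theorem properConchoid_of_not_hasRoot {p : ℕ} [CharP k p] (h2 : (2 : k) ≠ 0)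
    (hp : p = 0 ∨ (2 < p ∧ δ < p)) (hd : d ≠ 0) (hG : G.IsHomogeneous δ) (hGirr : Irreducible G)
    (hGz : ¬ G ∣ X 2) (hex : ∀ D : PrimeCurve k, IsExceptional (A.conic d) D ↔
      A.conic d ∈ D.ideal ∨ A.uPoly ∈ D.ideal ∨ A.vPoly ∈ D.ideal) (hroot : ¬ HasRoot A G) :
    (∀ D D', properConchoid (A.conic d) G D ≠ 0 → properConchoid (A.conic d) G D' ≠ 0 → D = D') ∧
      ∀ D, properConchoid (A.conic d) G D ≤ 1 := by
  have hmain : ∀ D D' q q', ¬ IsExceptional (A.conic d) D → ¬ IsExceptional (A.conic d) D' →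
      q ∈ componentsOver (A.conic d) G D → q' ∈ componentsOver (A.conic d) G D' → q = q' := by
    intro D D' q q' hD hD' hq hq'
    rw [hex] at hD hD'
    obtain ⟨-, ρ, α, h⟩ := exists_isComponentPoint_of_mem hd hG hGirr hGz hq hD
    obtain ⟨-, ρ', α', h'⟩ := exists_isComponentPoint_of_mem hd hG hGirr hGz hq' hD'
    exact PrimeSpectrum.ext (le_antisymm (h.le_of_not_hasRoot h' hroot) (h'.le_of_not_hasRoot h hroot))
  constructor
  · intro D D' hD hD'
    obtain ⟨hD, q, hq⟩ := exists_of_properConchoid_ne_zero hD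
    obtain ⟨hD', q', hq'⟩ := exists_of_properConchoid_ne_zero hD'
    obtain rfl := hmain D D' q q' hD hD' hq hq'
    exact PrimeCurve.ext (hq.2.trans hq'.2.symm)
  · intro D
    by_cases h0 : properConchoid (A.conic d) G D = 0
    · omega
    obtain ⟨hD, q, hq⟩ := exists_of_properConchoid_ne_zero h0
    rw [properConchoid_eq_of_subset_singleton hD hq fun q' hq' => hmain D D q' q hD hD hq' hq]
    rw [hex] at hD
    obtain ⟨hDQ, ρ, α, h⟩ := exists_isComponentPoint_of_mem hd hG hGirr hGz hq hD
    rw [h.pullbackMultiplicity_eq_one hd h2, one_mul]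
    have hPρ : genericFst q.asIdeal 2 + ρ ≠ 0 := by
      have := h.root_add_ne_zero hroot 1
      rwa [Nat.cast_one, one_mul, add_comm] at this
    obtain ⟨τ, β, hβ, hτ0, hτ, hP⟩ := h.exists_fst_eq hPρ
    have : Infinite (FractionRing (ProdRing k ⧸ q.asIdeal)) :=
      Infinite.of_injective _ (algebraMap k _).injective
    have hdeg := h.finite_setOf_ncard_ne h2 hPρ hDQ hβ hτ0 hτ hP
    rcases h.generic.swap.isRatio_or hβ (h.snd_norm_ne_zero hPρ) h.snd_two_ne_zero hP with
      ⟨m, a, b, ha, hb, hb0, hab⟩ | hab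
    -- The degree is an infimum, so generic fibres of one point bound it by 1.
    · exact Nat.sInf_le (hdeg.1 _ a b ha hb0 hab)
    · have := h.isLine_of_not_ratio hp hG hGirr hroot hβ hτ hP hab
      exact absurd (HasRoot.of_isLine (this.1 ▸ hG) hGirr this.2) hroot

end Nonsplit

/-! ### The cover u = x², v = y² and descent of factorisations from it. -/

section Cover

variable {k : Type*} [Field k] (A : Axes k)

/-- The substitution `u = x²`, `v = y²`. -/
def Axes.cover : PlaneRing k →ₐ[k] PlaneRing k :=
  aeval ![C (A.u₀ * A.v₁ - A.u₁ * A.v₀)⁻¹ * (C A.v₁ * X 0 ^ 2 - C A.u₁ * X 1 ^ 2),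
    C (A.u₀ * A.v₁ - A.u₁ * A.v₀)⁻¹ * (C A.u₀ * X 1 ^ 2 - C A.v₀ * X 0 ^ 2), X 2]

/-- The change of sign of the first variable. -/
def flipFst (k : Type*) [Field k] : PlaneRing k →ₐ[k] PlaneRing k := aeval ![-X 0, X 1, X 2]

/-- The change of sign of the second variable. -/
def flipSnd (k : Type*) [Field k] : PlaneRing k →ₐ[k] PlaneRing k := aeval ![X 0, -X 1, X 2]

@[simp] theorem flipFst_X_zero : flipFst k (X 0) = -X 0 := by simp [flipFst]
@[simp] theorem flipFst_X_one : flipFst k (X 1) = X 1 := by simp [flipFst]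
@[simp] theorem flipFst_X_two : flipFst k (X 2) = X 2 := by simp [flipFst]
@[simp] theorem flipSnd_X_zero : flipSnd k (X 0) = X 0 := by simp [flipSnd]
@[simp] theorem flipSnd_X_one : flipSnd k (X 1) = -X 1 := by simp [flipSnd]
@[simp] theorem flipSnd_X_two : flipSnd k (X 2) = X 2 := by simp [flipSnd]

@[simp] theorem flipFst_flipFst (f : PlaneRing k) : flipFst k (flipFst k f) = f := by
  rw [← AlgHom.comp_apply]
  conv_rhs => rw [← AlgHom.id_apply (R := k) f]
  congr 1
  apply algHom_ext; intro i; fin_cases i <;> simp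

@[simp] theorem flipSnd_flipSnd (f : PlaneRing k) : flipSnd k (flipSnd k f) = f := by
  rw [← AlgHom.comp_apply]
  conv_rhs => rw [← AlgHom.id_apply (R := k) f]
  congr 1
  apply algHom_ext; intro i; fin_cases i <;> simp

@[simp] theorem flipFst_C (c : k) : flipFst k (C c) = C c := (flipFst k).commutes c

@[simp] theorem flipSnd_C (c : k) : flipSnd k (C c) = C c := (flipSnd k).commutes c

theorem flipFst_flipSnd (f : PlaneRing k) : flipFst k (flipSnd k f) = flipSnd k (flipFst k f) := by
  rw [← AlgHom.comp_apply, ← AlgHom.comp_apply]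
  congr 1
  apply algHom_ext; intro i; fin_cases i <;> simp

namespace Axes

@[simp] theorem flipFst_cover (f : PlaneRing k) : flipFst k (A.cover f) = A.cover f := by
  rw [← AlgHom.comp_apply]
  congr 1
  apply algHom_ext; intro i; fin_cases i <;> simp [cover, ← algebraMap_eq]

@[simp] theorem flipSnd_cover (f : PlaneRing k) : flipSnd k (A.cover f) = A.cover f := by
  rw [← AlgHom.comp_apply]
  congr 1
  apply algHom_ext; intro i; fin_cases i <;> simp [cover, ← algebraMap_eq]

theorem C_det_inv : (C (A.u₀ * A.v₁ - A.u₁ * A.v₀)⁻¹ : PlaneRing k) *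
    (C A.u₀ * C A.v₁ - C A.u₁ * C A.v₀) = 1 := by
  rw [← C_mul, ← C_mul, ← C_sub, ← C_mul, inv_mul_cancel₀ A.det_ne_zero, C_1]

@[simp] theorem cover_uPoly : A.cover A.uPoly = X 0 ^ 2 := by
  rw [cover, aeval_uPoly]
  simp only [Matrix.cons_val_zero, Matrix.cons_val_one, u, algebraMap_eq]
  linear_combination X 0 ^ 2 * A.C_det_inv

@[simp] theorem cover_vPoly : A.cover A.vPoly = X 1 ^ 2 := by
  rw [cover, aeval_vPoly]
  simp only [Matrix.cons_val_zero, Matrix.cons_val_one, v, algebraMap_eq]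
  linear_combination X 1 ^ 2 * A.C_det_inv

@[simp] theorem cover_X_two : A.cover (X 2) = X 2 := by simp [cover]

theorem cover_normPoly : A.cover A.normPoly = (X 0 * X 1) ^ 2 := by
  rw [normPoly_eq, map_mul, cover_uPoly, cover_vPoly]; ring

theorem cover_C (c : k) : A.cover (C c) = C c := A.cover.commutes c

/-- Every point lifts to the cover because square roots exist, so the values of f are determined
upstairs. -/
theorem cover_injective [IsAlgClosed k] : Function.Injective A.cover := by
  have : Infinite k := IsAlgClosed.instInfinite
  rw [injective_iff_map_eq_zero]
  intro f hf
  refine MvPolynomial.funext fun P => ?_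
  obtain ⟨s, hs⟩ := IsAlgClosed.exists_pow_nat_eq (A.u (P 0) (P 1)) (n := 2) two_pos
  obtain ⟨t, ht⟩ := IsAlgClosed.exists_pow_nat_eq (A.v (P 0) (P 1)) (n := 2) two_pos
  have h1 : aeval (![s, t, P 2] : Fin 3 → k) (A.cover f) = aeval P f := by
    rw [← AlgHom.comp_apply]
    congr 1
    have hd := A.det_ne_zero
    apply algHom_ext; intro i; fin_cases i
    · simp [cover, hs, ht, u, v]; field_simp; ring
    · simp [cover, hs, ht, u, v]; rw [inv_mul_eq_iff_eq_mul₀ hd]; ring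
    · simp
  rw [hf, map_zero] at h1
  rw [map_zero]; exact h1.symm

/-- The monomials 1, x, y, xy generate the ring over the image of `cover`. The sign changes act on
them by characters, which isolates the summands when 2 ≠ 0. -/
theorem exists_eq_cover_add (h : PlaneRing k) : ∃ a b c e : PlaneRing k,
    h = A.cover a + X 0 * A.cover b + X 1 * A.cover c + X 0 * X 1 * A.cover e := by
  induction h using MvPolynomial.induction_on with
  | C r => exact ⟨C r, 0, 0, 0, by simp⟩
  | add p q hp hq =>
    obtain ⟨a, b, c, e, rfl⟩ := hp
    obtain ⟨a', b', c', e', rfl⟩ := hq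
    exact ⟨a + a', b + b', c + c', e + e', by simp only [map_add]; ring⟩
  | mul_X p i hp =>
    obtain ⟨a, b, c, e, rfl⟩ := hp
    fin_cases i
    · exact ⟨A.uPoly * b, a, A.uPoly * e, c, by
        simp only [map_mul, cover_uPoly, Fin.zero_eta]; ring⟩
    · exact ⟨A.vPoly * c, A.vPoly * e, a, b, by
        simp only [map_mul, cover_vPoly, Fin.mk_one]; ring⟩
    · exact ⟨a * X 2, b * X 2, c * X 2, e * X 2, by
        simp only [map_mul, cover_X_two, Fin.reduceFinMk]; ring⟩

theorem two_ne_zero_planeRing (h2 : (2 : k) ≠ 0) : (2 : PlaneRing k) ≠ 0 := by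
  rw [show (2 : PlaneRing k) = C 2 from (map_ofNat C 2).symm]
  exact fun h => h2 (C_injective _ _ (h.trans C_0.symm))

theorem exists_eq_cover_add_of_fixed (h2 : (2 : k) ≠ 0) {h : PlaneRing k}
    (h₁ : flipFst k (flipSnd k h) = h) : ∃ a b, h = A.cover a + X 0 * X 1 * A.cover b := by
  obtain ⟨a, b, c, e, rfl⟩ := A.exists_eq_cover_add h
  refine ⟨a, e, ?_⟩
  simp only [map_add, map_mul, flipFst_cover, flipSnd_cover, flipFst_X_zero, flipFst_X_one,
    flipSnd_X_zero, flipSnd_X_one, map_neg] at h₁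
  apply mul_left_cancel₀ (two_ne_zero_planeRing h2)
  linear_combination -h₁

theorem exists_eq_cover_add_of_neg (h2 : (2 : k) ≠ 0) {h : PlaneRing k}
    (h₁ : flipFst k (flipSnd k h) = -h) : ∃ a b, h = X 0 * A.cover a + X 1 * A.cover b := by
  obtain ⟨a, b, c, e, rfl⟩ := A.exists_eq_cover_add h
  refine ⟨b, c, ?_⟩
  simp only [map_add, map_mul, flipFst_cover, flipSnd_cover, flipFst_X_zero, flipFst_X_one,
    flipSnd_X_zero, flipSnd_X_one, map_neg] at h₁
  apply mul_left_cancel₀ (two_ne_zero_planeRing h2)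
  linear_combination h₁

theorem exists_eq_cover (h2 : (2 : k) ≠ 0) {h : PlaneRing k} (h₁ : flipFst k h = h)
    (h₂ : flipSnd k h = h) : ∃ a, h = A.cover a := by
  obtain ⟨a, b, rfl⟩ := A.exists_eq_cover_add_of_fixed h2 (h := h) (by rw [h₂, h₁])
  refine ⟨a, ?_⟩
  simp only [map_add, map_mul, flipFst_cover, flipFst_X_zero, flipFst_X_one] at h₁
  apply mul_left_cancel₀ (two_ne_zero_planeRing h2)
  linear_combination -h₁

/-- The quotient upstairs is invariant under both sign changes, so it comes from below. -/
theorem dvd_of_cover_dvd_cover [IsAlgClosed k] (h2 : (2 : k) ≠ 0) {f g : PlaneRing k}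
    (h : A.cover f ∣ A.cover g) : f ∣ g := by
  obtain ⟨c, hc⟩ := h
  by_cases hf : f = 0
  · rw [hf, map_zero, zero_mul, map_eq_zero_iff _ A.cover_injective] at hc
    rw [hc]; exact dvd_zero _
  have hf' : A.cover f ≠ 0 := by rwa [Ne, map_eq_zero_iff _ A.cover_injective]
  obtain ⟨a, rfl⟩ := A.exists_eq_cover h2 (h := c)
    (mul_left_cancel₀ hf' (by rw [← hc]; conv_lhs => rw [← A.flipFst_cover f, ← map_mul, ← hc, A.flipFst_cover]))
    (mul_left_cancel₀ hf' (by rw [← hc]; conv_lhs => rw [← A.flipSnd_cover f, ← map_mul, ← hc, A.flipSnd_cover]))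
  exact ⟨a, A.cover_injective (by rw [hc, map_mul])⟩

/-- The product ν of the four conjugates of a common divisor descends and divides G⁴ and a⁴. As G is
prime and does not divide a, ν is a unit. -/
theorem isRelPrime_cover [IsAlgClosed k] (h2 : (2 : k) ≠ 0) {G a : PlaneRing k} (hG : Prime G)
    (h : ¬ G ∣ a) : IsRelPrime (A.cover G) (A.cover a) := by
  intro e heG hea
  obtain ⟨ν, hν⟩ := A.exists_eq_cover h2
    (h := e * flipFst k e * (flipSnd k e * flipFst k (flipSnd k e)))
    (by simp only [map_mul, flipFst_flipFst]; ring)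
    (by simp only [map_mul, flipFst_flipSnd, flipSnd_flipSnd]; ring)
  have hdvd : ∀ f, e ∣ A.cover f → ν ∣ f ^ 4 := by
    intro f hf
    apply A.dvd_of_cover_dvd_cover h2
    have h1 : flipFst k e ∣ A.cover f := by simpa using map_dvd (flipFst k) hf
    have h2 : flipSnd k e ∣ A.cover f := by simpa using map_dvd (flipSnd k) hf
    have h3 : flipFst k (flipSnd k e) ∣ A.cover f := by simpa using map_dvd (flipFst k) h2
    rw [← hν, show A.cover (f ^ 4) = A.cover f * A.cover f * (A.cover f * A.cover f) by
      rw [map_pow]; ring]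
    exact mul_dvd_mul (mul_dvd_mul hf h1) (mul_dvd_mul h2 h3)
  obtain ⟨i, -, hi⟩ := (dvd_prime_pow hG 4).1 (hdvd G heG)
  have hi0 : i = 0 := by
    by_contra hi0
    have : G ∣ ν := (dvd_pow_self G hi0).trans hi.symm.dvd
    exact h (hG.dvd_of_dvd_pow (this.trans (hdvd a hea)))
  rw [hi0, pow_zero, associated_one_iff_isUnit] at hi
  have := hi.map A.cover
  rw [← hν] at this
  exact isUnit_of_mul_isUnit_left (isUnit_of_mul_isUnit_left this)

/-- Upstairs a = ± xy b. The sign change in x fixes a and b but negates xy, so both sides vanish.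
This anisotropy is what later prevents leading terms from cancelling. -/
theorem eq_zero_of_sq_eq [IsAlgClosed k] (h2 : (2 : k) ≠ 0) {a b : PlaneRing k}
    (h : a ^ 2 = A.normPoly * b ^ 2) : a = 0 ∧ b = 0 := by
  have h' := congrArg A.cover h
  rw [map_mul, map_pow, map_pow, cover_normPoly, ← mul_pow, sq_eq_sq_iff_eq_or_eq_neg] at h'
  have hX : (X 0 * X 1 : PlaneRing k) ≠ 0 := mul_ne_zero (X_ne_zero _) (X_ne_zero _)
  have key : X 0 * X 1 * A.cover b = 0 := by
    apply mul_left_cancel₀ (two_ne_zero_planeRing h2)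
    rcases h' with h' | h' <;>
    · have h1 := congrArg (flipFst k) h'
      simp only [map_mul, map_neg, flipFst_cover, flipFst_X_zero, flipFst_X_one] at h1
      first | linear_combination h1 - h' | linear_combination h' - h1
  rw [key, neg_zero, or_self, map_eq_zero_iff _ A.cover_injective] at h'
  refine ⟨h', ?_⟩
  rwa [mul_eq_zero, or_iff_right hX, map_eq_zero_iff _ A.cover_injective] at key

theorem eq_zero_of_mul_sq_eq [IsAlgClosed k] (h2 : (2 : k) ≠ 0) {a b : PlaneRing k}
    (h : A.uPoly * a ^ 2 = A.vPoly * b ^ 2) : a = 0 ∧ b = 0 := by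
  have h' := congrArg A.cover h
  rw [map_mul, map_pow, map_mul, map_pow, cover_uPoly, cover_vPoly, ← mul_pow, ← mul_pow,
    sq_eq_sq_iff_eq_or_eq_neg] at h'
  have key : X 0 * A.cover a = 0 := by
    apply mul_left_cancel₀ (two_ne_zero_planeRing h2)
    rcases h' with h' | h' <;>
    · have h1 := congrArg (flipFst k) h'
      simp only [map_mul, map_neg, flipFst_cover, flipFst_X_zero, flipFst_X_one] at h1
      linear_combination h' - h1
  rw [key, zero_eq_neg, eq_comm, or_self] at h'
  constructor
  · rwa [mul_eq_zero, or_iff_right (X_ne_zero _), map_eq_zero_iff _ A.cover_injective] at key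
  · rwa [mul_eq_zero, or_iff_right (X_ne_zero _), map_eq_zero_iff _ A.cover_injective] at h'

/-- Upstairs G divides f · f^σ with f = a - xy b, and no nonunit factor of G divides both, since it
would divide 2a. So G = g₁g₂ with g₁ ∣ f and g₂ ∣ f^σ. Each sign change exchanges f and f^σ, hence
g₁ and g₂ up to constants; the composite of the two multiplies g₁ by a constant of square 1. -/
theorem exists_mul_flipFst_eq_cover [IsAlgClosed k] (h2 : (2 : k) ≠ 0) {G a b : PlaneRing k}
    (hG : Prime G) (ha : ¬ G ∣ a) (h : G ∣ a ^ 2 - A.normPoly * b ^ 2) :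
    ∃ g, A.cover G = g * flipFst k g ∧
      (flipFst k (flipSnd k g) = g ∨ flipFst k (flipSnd k g) = -g) := by
  have hG0 : A.cover G ≠ 0 := by rw [Ne, map_eq_zero_iff _ A.cover_injective]; exact hG.ne_zero
  have hrel := A.isRelPrime_cover h2 hG ha
  set f := A.cover a - X 0 * X 1 * A.cover b with hf
  have hf₁ : flipFst k f = A.cover a + X 0 * X 1 * A.cover b := by
    simp only [hf, map_sub, map_mul, flipFst_cover, flipFst_X_zero, flipFst_X_one]; ring
  have hf₂ : flipSnd k f = flipFst k f := by
    rw [hf₁]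
    simp only [hf, map_sub, map_mul, flipSnd_cover, flipSnd_X_zero, flipSnd_X_one]; ring
  have hdvd : A.cover G ∣ f * flipFst k f := by
    have := map_dvd A.cover h
    rw [map_sub, map_mul, map_pow, map_pow, cover_normPoly] at this
    rw [hf₁]
    convert this using 1
    rw [hf]; ring
  obtain ⟨g₁, g₂, h₁, h₂, hg⟩ := exists_dvd_and_dvd_of_dvd_mul hdvd
  have hco : ∀ e, e ∣ A.cover G → e ∣ f → e ∣ flipFst k f → IsUnit e := by
    intro e he hef hef'
    refine hrel he ?_
    have h2u : IsUnit (C 2 : PlaneRing k) := (IsUnit.mk0 2 h2).map _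
    rw [← h2u.dvd_mul_left]
    have : C 2 * A.cover a = f + flipFst k f := by
      rw [hf₁, hf, map_ofNat]; ring
    rw [this]
    exact dvd_add hef hef'
  have hg₁ : g₁ ∣ A.cover G := ⟨g₂, hg⟩
  have hg₂ : g₂ ∣ A.cover G := ⟨g₁, by rw [hg, mul_comm]⟩
  -- an involution exchanging the factors of the norm exchanges `g₁` and `g₂`
  have hass : ∀ σ : PlaneRing k →ₐ[k] PlaneRing k, (∀ x, σ (σ x) = x) → σ (A.cover G) = A.cover G →
      σ f = flipFst k f → Associated g₂ (σ g₁) := by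
    intro σ hσ hσG hσf
    have hσf' : σ (flipFst k f) = f := by rw [← hσf, hσ]
    have e1 : σ g₁ ∣ flipFst k f := hσf ▸ map_dvd σ h₁
    have e2 : σ g₂ ∣ f := hσf' ▸ map_dvd σ h₂
    have e3 : g₁ * g₂ = σ g₁ * σ g₂ := by rw [← map_mul, ← hg, hσG, hg]
    have r1 : IsRelPrime (σ g₁) g₁ := fun e he he' =>
      hco e (he'.trans hg₁) (he'.trans h₁) (he.trans e1)
    have r2 : IsRelPrime g₂ (σ g₂) := fun e he he' =>
      hco e (he.trans hg₂) (he'.trans e2) (he.trans h₂)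
    exact associated_of_dvd_dvd (r2.dvd_of_dvd_mul_right ⟨g₁, by rw [← e3, mul_comm]⟩)
      (r1.dvd_of_dvd_mul_left ⟨σ g₂, e3⟩)
  have hunit : ∀ x y : PlaneRing k, Associated x y → ∃ c : k, c ≠ 0 ∧ x * C c = y := by
    rintro x y ⟨w, hw⟩
    obtain ⟨c, hc, hc'⟩ := isUnit_iff_eq_C_of_isReduced.1 w.isUnit
    exact ⟨c, hc.ne_zero, by rw [← hc', hw]⟩
  obtain ⟨c, hc, hσ⟩ := hunit _ _ (hass (flipFst k) flipFst_flipFst (A.flipFst_cover G) rfl).symm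
  obtain ⟨c', hc', hτ⟩ := hunit _ _ (hass (flipSnd k) flipSnd_flipSnd (A.flipSnd_cover G) hf₂)
  have hg0 : g₁ ≠ 0 := by rintro rfl; rw [zero_mul] at hg; exact hG0 hg
  -- `flipSnd g₁` is `± flipFst g₁`
  have e1 : flipSnd k g₁ = flipFst k g₁ * C (c * c') := by rw [← hτ, ← hσ, C_mul]; ring
  have e2 : flipFst k (flipSnd k g₁) = g₁ * C (c * c') := by
    rw [e1, map_mul, flipFst_flipFst, flipFst_C]
  have e3 : g₁ * C ((c * c') ^ 2) = g₁ * 1 := by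
    have h3 := congrArg (flipFst k) (congrArg (flipSnd k) e2)
    rw [← flipFst_flipSnd, flipFst_flipFst, flipSnd_flipSnd, map_mul, map_mul, flipSnd_C, flipFst_C,
      e2] at h3
    rw [mul_one, C_pow]
    linear_combination -h3
  have hw : (c * c') ^ 2 = 1 := C_injective _ _ ((mul_left_cancel₀ hg0 e3).trans C_1.symm)
  -- Since g₂ = c g₁^σ, rescaling g₁ by a square root of c makes the product exactly g · g^σ.
  obtain ⟨r, hr⟩ := IsAlgClosed.exists_pow_nat_eq c (n := 2) two_pos
  refine ⟨g₁ * C r, ?_, ?_⟩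
  · rw [hg, ← hσ, map_mul, flipFst_C, ← hr, C_pow]; ring
  · rw [map_mul, map_mul, flipSnd_C, flipFst_C, e2]
    rcases (sq_eq_sq_iff_eq_or_eq_neg.1 (hw.trans (one_pow 2).symm)) with h | h
    · left; rw [h, C_1]; ring
    · right; rw [h, C_neg, C_1]; ring

/-- An irreducible form dividing `a² - u v b²` is itself represented by one of the quadratic forms
`r² - u v s²`, `u r² - v s²`. -/
theorem exists_eq_of_dvd [IsAlgClosed k] (h2 : (2 : k) ≠ 0) {G a b : PlaneRing k} (hG : Prime G)
    (ha : ¬ G ∣ a) (h : G ∣ a ^ 2 - A.normPoly * b ^ 2) :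
    ∃ r s, G = r ^ 2 - A.normPoly * s ^ 2 ∨ G = A.uPoly * r ^ 2 - A.vPoly * s ^ 2 := by
  obtain ⟨g, hg, hg' | hg'⟩ := A.exists_mul_flipFst_eq_cover h2 hG ha h
  · obtain ⟨r, s, rfl⟩ := A.exists_eq_cover_add_of_fixed h2 hg'
    refine ⟨r, s, .inl (A.cover_injective ?_)⟩
    rw [hg]
    simp only [map_add, map_sub, map_mul, map_pow, flipFst_cover, flipFst_X_zero, flipFst_X_one,
      cover_normPoly]
    ring
  · obtain ⟨r, s, rfl⟩ := A.exists_eq_cover_add_of_neg h2 hg'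
    -- For g = x r + y s the norm is v s² - u r²; a square root of -1 corrects the sign.
    obtain ⟨i, hi⟩ := IsAlgClosed.exists_pow_nat_eq (-1 : k) (n := 2) two_pos
    have hi' : (C i : PlaneRing k) ^ 2 = -1 := by rw [← C_pow, hi, C_neg, C_1]
    refine ⟨C i * r, C i * s, .inr (A.cover_injective ?_)⟩
    rw [hg]
    simp only [map_add, map_sub, map_mul, map_pow, flipFst_cover, flipFst_X_zero, flipFst_X_one,
      cover_uPoly, cover_vPoly, cover_C]
    linear_combination (X 1 ^ 2 * (A.cover s) ^ 2 - X 0 ^ 2 * (A.cover r) ^ 2) * hi'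

end Axes

end Cover

/-! ### Making the representing polynomials homogeneous. -/

section Homogenize

variable {k : Type*} [Field k] {A : Axes k} {G : PlaneRing k} {δ : ℕ}

/-- The polynomial `f(T x, T y, T z)` in `T`. -/
def homothety (k : Type*) [Field k] : PlaneRing k →ₐ[k] Polynomial (PlaneRing k) :=
  aeval ((Polynomial.X : Polynomial (PlaneRing k)) • fun i => Polynomial.C (X i))

theorem homothety_eq {f : PlaneRing k} {n : ℕ} (hf : f.IsHomogeneous n) :
    homothety k f = Polynomial.X ^ n * Polynomial.C f := by
  have : (aeval (fun i => Polynomial.C (X i)) : PlaneRing k →ₐ[k] Polynomial (PlaneRing k)) =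
      IsScalarTower.toAlgHom k (PlaneRing k) _ := by
    apply algHom_ext; intro i; simp
  rw [homothety, aeval_smul_of_isHomogeneous hf, this]
  rfl

theorem coeff_homothety (f : PlaneRing k) (n : ℕ) :
    (homothety k f).coeff n = homogeneousComponent n f := by
  conv_lhs => rw [← sum_homogeneousComponent f, map_sum, Polynomial.finsetSum_coeff]
  simp only [homothety_eq (homogeneousComponent_isHomogeneous _ f), mul_comm (Polynomial.X ^ _),
    Polynomial.coeff_C_mul_X_pow]
  rw [Finset.sum_ite_eq]
  split_ifs with h
  · rfl
  · rw [homogeneousComponent_eq_zero]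
    simpa using h

/-- Let e be the larger of the two degrees. By anisotropy the coefficient in degree 2e does not
vanish unless p = q = 0, so the monomial on the right has degree 2e and the identity can be read off
there. Applied to f(Tx, Ty, Tz), it selects homogeneous components. -/
theorem exists_coeff_eq {R : Type*} [CommRing R] {w₁ w₂ G : R}
    (hw : ∀ a b, w₁ * a ^ 2 = w₂ * b ^ 2 → a = 0 ∧ b = 0) (hG : G ≠ 0) {p q : Polynomial R} {N : ℕ}
    (h : Polynomial.C w₁ * p ^ 2 - Polynomial.C w₂ * q ^ 2 = Polynomial.C G * Polynomial.X ^ N) :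
    ∃ e, N = 2 * e ∧ G = w₁ * p.coeff e ^ 2 - w₂ * q.coeff e ^ 2 := by
  have hcoeff : ∀ e, p.natDegree ≤ e → q.natDegree ≤ e →
      w₁ * p.coeff e ^ 2 - w₂ * q.coeff e ^ 2 = if 2 * e = N then G else 0 := by
    intro e hp hq
    rw [← Polynomial.coeff_pow_of_natDegree_le hp, ← Polynomial.coeff_pow_of_natDegree_le hq,
      ← Polynomial.coeff_C_mul, ← Polynomial.coeff_C_mul, ← Polynomial.coeff_sub, h,
      Polynomial.coeff_C_mul_X_pow]
  set e := max p.natDegree q.natDegree with he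
  have hpe : p.natDegree ≤ e := le_max_left _ _
  have hqe : q.natDegree ≤ e := le_max_right _ _
  have hN : 2 * e = N := by
    by_contra hne
    have h0 := hcoeff e hpe hqe
    rw [if_neg hne, sub_eq_zero] at h0
    obtain ⟨hp0, hq0⟩ := hw _ _ h0
    have he0 : e = 0 := by
      rcases max_choice p.natDegree q.natDegree with h' | h'
      · rw [he, h'] at hp0 ⊢
        rw [Polynomial.coeff_natDegree, Polynomial.leadingCoeff_eq_zero] at hp0
        rw [hp0, Polynomial.natDegree_zero]
      · rw [he, h'] at hq0 ⊢
        rw [Polynomial.coeff_natDegree, Polynomial.leadingCoeff_eq_zero] at hq0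
        rw [hq0, Polynomial.natDegree_zero]
    have hp : p = 0 := by
      rw [Polynomial.eq_C_of_natDegree_le_zero (hpe.trans he0.le), ← he0, hp0, Polynomial.C_0]
    have hq : q = 0 := by
      rw [Polynomial.eq_C_of_natDegree_le_zero (hqe.trans he0.le), ← he0, hq0, Polynomial.C_0]
    have := congrArg (fun f => Polynomial.coeff f N) h
    simp only [hp, hq, Polynomial.coeff_C_mul_X_pow, if_true] at this
    simp [eq_comm, hG] at this
  exact ⟨e, hN.symm, by rw [hcoeff e hpe hqe, if_pos hN]⟩

theorem exists_homogeneous_even [IsAlgClosed k] (h2 : (2 : k) ≠ 0) (hG : G.IsHomogeneous δ)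
    (hG0 : G ≠ 0) {r s : PlaneRing k} (h : G = r ^ 2 - A.normPoly * s ^ 2) :
    ∃ r' s' : PlaneRing k, (∃ m, r'.IsHomogeneous m) ∧ (∃ n, s'.IsHomogeneous n) ∧ Even δ ∧
      G = r' ^ 2 - A.normPoly * s' ^ 2 := by
  have h' := congrArg (homothety k) h
  rw [map_sub, map_mul, map_pow, map_pow, homothety_eq hG, homothety_eq A.normPoly_isHomogeneous] at h'
  -- uv has degree 2, which accounts for the extra variable on the second square: s contributes its
  -- component of degree e - 1.
  obtain ⟨e, he, hGe⟩ := exists_coeff_eq (w₁ := 1) (w₂ := A.normPoly) (p := homothety k r)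
    (q := Polynomial.X * homothety k s) (N := δ) (fun a b hab => A.eq_zero_of_sq_eq h2 (by
      rw [← hab, one_mul])) hG0 (by rw [mul_comm _ (Polynomial.X ^ δ), h', Polynomial.C_1]; ring)
  rw [one_mul, coeff_homothety] at hGe
  refine ⟨_, _, ⟨e, homogeneousComponent_isHomogeneous _ _⟩, ?_, ⟨e, by omega⟩, hGe⟩
  cases e with
  | zero => exact ⟨0, by rw [Polynomial.coeff_X_mul_zero]; exact isHomogeneous_zero _ _ _⟩
  | succ e =>
    exact ⟨e, by
      rw [Polynomial.coeff_X_mul, coeff_homothety]; exact homogeneousComponent_isHomogeneous _ _⟩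

theorem exists_homogeneous_odd [IsAlgClosed k] (h2 : (2 : k) ≠ 0) (hG : G.IsHomogeneous δ)
    (hG0 : G ≠ 0) {r s : PlaneRing k} (h : G = A.uPoly * r ^ 2 - A.vPoly * s ^ 2) :
    ∃ r' s' : PlaneRing k, (∃ m, r'.IsHomogeneous m) ∧ (∃ n, s'.IsHomogeneous n) ∧ Odd δ ∧
      G = A.uPoly * r' ^ 2 - A.vPoly * s' ^ 2 := by
  have h' := congrArg (homothety k) h
  rw [map_sub, map_mul, map_mul, map_pow, map_pow, homothety_eq hG,
    homothety_eq A.uPoly_isHomogeneous, homothety_eq A.vPoly_isHomogeneous] at h'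
  -- u and v contribute a single power of the variable; one further power turns it into a square and
  -- makes the total exponent δ + 1.
  obtain ⟨e, he, hGe⟩ := exists_coeff_eq (w₁ := A.uPoly) (w₂ := A.vPoly)
    (p := Polynomial.X * homothety k r) (q := Polynomial.X * homothety k s) (N := δ + 1)
    (fun a b hab => A.eq_zero_of_mul_sq_eq h2 hab) hG0 (by
      linear_combination -Polynomial.X * h')
  obtain ⟨e, rfl⟩ : ∃ n, e = n + 1 := ⟨e - 1, by omega⟩
  rw [Polynomial.coeff_X_mul, Polynomial.coeff_X_mul, coeff_homothety, coeff_homothety] at hGe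
  exact ⟨_, _, ⟨e, homogeneousComponent_isHomogeneous _ _⟩, ⟨e, homogeneousComponent_isHomogeneous _ _⟩,
    ⟨e, by omega⟩, hGe⟩

end Homogenize

/-! ### Equivalence of the square-root condition with (*). -/

section Criterion

variable {k : Type*} [Field k] {A : Axes k} {G : PlaneRing k} {δ : ℕ}

/-- (*) does not prescribe the degrees of H₁ and H₂; they are forced because nonzero homogeneous
terms of different degrees cannot have a homogeneous difference. -/
theorem eq_of_sub_isHomogeneous {f g : PlaneRing k} {i j δ : ℕ} (hf : f.IsHomogeneous i)
    (hg : g.IsHomogeneous j) (hf0 : f ≠ 0) (hg0 : g ≠ 0) (h : (f - g).IsHomogeneous δ) : i = j := by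
  by_contra hij
  have h1 := congrArg (homogeneousComponent i) (sub_add_cancel f g)
  have h2 := congrArg (homogeneousComponent j) (sub_add_cancel f g)
  rw [map_add, homogeneousComponent_of_mem hf, homogeneousComponent_of_mem hg,
    homogeneousComponent_of_mem h, if_pos rfl, if_neg hij, add_zero] at h1
  rw [map_add, homogeneousComponent_of_mem hf, homogeneousComponent_of_mem hg,
    homogeneousComponent_of_mem h, if_pos rfl, if_neg (Ne.symm hij)] at h2
  have hi : i = δ := by
    by_contra hne; rw [if_neg hne] at h1; exact hf0 h1.symm
  have hj : j ≠ δ := fun h => hij (hi.trans h.symm)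
  rw [if_neg hj, zero_add] at h2
  exact hg0 h2

theorem not_irreducible_sq (H : PlaneRing k) : ¬ Irreducible (H ^ 2) := fun h => by
  have := h.isUnit_or_isUnit (sq H)
  exact h.not_isUnit (by rw [sq]; exact (or_self_iff.1 this).mul (or_self_iff.1 this))

theorem Axes.uPoly_ne_zero (A : Axes k) : A.uPoly ≠ 0 := by
  intro h
  obtain ⟨x, y, hu, -⟩ := A.exists_uv 1 1
  have := congrArg (aeval ![x, y, 0]) h
  rw [A.aeval_uPoly, map_zero] at this
  exact one_ne_zero (hu.symm.trans this)

theorem Axes.vPoly_ne_zero (A : Axes k) : A.vPoly ≠ 0 := by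
  intro h
  obtain ⟨x, y, -, hv⟩ := A.exists_uv 1 1
  have := congrArg (aeval ![x, y, 0]) h
  rw [A.aeval_vPoly, map_zero] at this
  exact one_ne_zero (hv.symm.trans this)

theorem not_sq_dvd_of_irreducible (hG : Irreducible G) (h : G ^ 2 ∣ G) : False := by
  obtain ⟨c, hc⟩ := h
  apply hG.not_isUnit
  refine IsUnit.of_mul_eq_one c (mul_left_cancel₀ hG.ne_zero ?_)
  rw [mul_one]; conv_rhs => rw [hc]
  ring

/-- The condition `(*)`: `G` is represented by a quadratic form attached to the two lines. -/
theorem hasRoot_iff [IsAlgClosed k] (h2 : (2 : k) ≠ 0) (hG : G.IsHomogeneous δ) (hGirr : Irreducible G)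
    (hu : ¬ Associated G A.uPoly) (hv : ¬ Associated G A.vPoly) {c₁ c₂ : k} (hc₁ : c₁ ≠ 0)
    (hc₂ : c₂ ≠ 0) :
    HasRoot A G ↔ ∃ H₁ H₂ : PlaneRing k, (∃ m, H₁.IsHomogeneous m) ∧ (∃ n, H₂.IsHomogeneous n) ∧
      ((Even δ ∧ G = H₁ ^ 2 - C c₁ * A.uPoly * (C c₂ * A.vPoly) * H₂ ^ 2) ∨
        (Odd δ ∧ G = C c₁ * A.uPoly * H₁ ^ 2 - C c₂ * A.vPoly * H₂ ^ 2)) := by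
  have hGp := hGirr.prime
  have hui := irreducible_of_isHomogeneous_one A.uPoly_isHomogeneous A.uPoly_ne_zero
  have hvi := irreducible_of_isHomogeneous_one A.vPoly_isHomogeneous A.vPoly_ne_zero
  have hud : ¬ G ∣ A.uPoly := fun h => hu (hGirr.associated_of_dvd hui h)
  have hvd : ¬ G ∣ A.vPoly := fun h => hv (hGirr.associated_of_dvd hvi h)
  have hroot : ∀ c : k, ∃ r : k, r ^ 2 = c := fun c => IsAlgClosed.exists_pow_nat_eq c two_pos
  obtain ⟨r₁, hr₁⟩ := hroot c₁
  obtain ⟨r₂, hr₂⟩ := hroot c₂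
  have hr₁0 : r₁ ≠ 0 := by rintro rfl; exact hc₁ (by rw [← hr₁]; simp)
  have hr₂0 : r₂ ≠ 0 := by rintro rfl; exact hc₂ (by rw [← hr₂]; simp)
  have hC : ∀ (r : k) {H : PlaneRing k} {n : ℕ}, H.IsHomogeneous n → (C r * H).IsHomogeneous n :=
    fun r H n hH => by simpa using (isHomogeneous_C (Fin 3) r).mul hH
  have hCu : ∀ r : k, r ≠ 0 → IsUnit (C r : PlaneRing k) := fun r hr => (IsUnit.mk0 r hr).map _
  constructor
  · rintro ⟨m, a, b, ha, hb, hGb, hab⟩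
    -- Otherwise G divides uv b², hence b, because C is neither L₁ nor L₂.
    have hGa : ¬ G ∣ a := by
      intro h
      have h1 : G ∣ A.normPoly * b ^ 2 := by
        have := dvd_sub (h.trans (dvd_pow_self a two_ne_zero)) hab
        rwa [sub_sub_cancel] at this
      rcases hGp.dvd_or_dvd h1 with h1 | h1
      · rcases hGp.dvd_or_dvd h1 with h1 | h1
        exacts [hud h1, hvd h1]
      · exact hGb (hGp.dvd_of_dvd_pow h1)
    have e1 : (C r₁ : PlaneRing k) * C r₁⁻¹ = 1 := by rw [← C_mul, mul_inv_cancel₀ hr₁0, C_1]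
    have e2 : (C r₂ : PlaneRing k) * C r₂⁻¹ = 1 := by rw [← C_mul, mul_inv_cancel₀ hr₂0, C_1]
    have e1' : (C r₁ : PlaneRing k) ^ 2 * C r₁⁻¹ ^ 2 = 1 := by rw [← mul_pow, e1, one_pow]
    have e2' : (C r₂ : PlaneRing k) ^ 2 * C r₂⁻¹ ^ 2 = 1 := by rw [← mul_pow, e2, one_pow]
    obtain ⟨r, s, h | h⟩ := A.exists_eq_of_dvd h2 hGp hGa hab
    · obtain ⟨r', s', ⟨m, hm⟩, ⟨n, hn⟩, hδ, hG'⟩ := exists_homogeneous_even h2 hG hGirr.ne_zero h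
      refine ⟨r', C r₁⁻¹ * (C r₂⁻¹ * s'), ⟨m, hm⟩, ⟨n, hC _ (hC _ hn)⟩, .inl ⟨hδ, ?_⟩⟩
      rw [hG', A.normPoly_eq, ← hr₁, ← hr₂, C_pow, C_pow]
      linear_combination (A.uPoly * A.vPoly * s' ^ 2) * (C r₁ ^ 2 * C r₁⁻¹ ^ 2 * e2' + e1')
    · obtain ⟨r', s', ⟨m, hm⟩, ⟨n, hn⟩, hδ, hG'⟩ := exists_homogeneous_odd h2 hG hGirr.ne_zero h
      refine ⟨C r₁⁻¹ * r', C r₂⁻¹ * s', ⟨m, hC _ hm⟩, ⟨n, hC _ hn⟩, .inr ⟨hδ, ?_⟩⟩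
      rw [hG', ← hr₁, ← hr₂, C_pow, C_pow]
      linear_combination A.vPoly * s' ^ 2 * e2' - A.uPoly * r' ^ 2 * e1'
  · rintro ⟨H₁, H₂, ⟨m, hm⟩, ⟨n, hn⟩, ⟨-, h⟩ | ⟨-, h⟩⟩
    · have hH₂ : H₂ ≠ 0 := by
        rintro rfl
        rw [zero_pow two_ne_zero, mul_zero, sub_zero] at h
        exact not_irreducible_sq H₁ (h ▸ hGirr)
      have hH₁ : H₁ ≠ 0 := by
        rintro rfl
        refine hu (hui.associated_of_dvd hGirr ?_).symm
        exact ⟨-(C c₁ * (C c₂ * A.vPoly) * H₂ ^ 2), by linear_combination h⟩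
      have hdeg : m * 2 = 1 + 1 + n * 2 := by
        refine eq_of_sub_isHomogeneous (hm.pow 2) (((hC c₁ A.uPoly_isHomogeneous).mul
          (hC c₂ A.vPoly_isHomogeneous)).mul (hn.pow 2)) (pow_ne_zero 2 hH₁) ?_ (h ▸ hG)
        exact mul_ne_zero (mul_ne_zero (mul_ne_zero (hCu c₁ hc₁).ne_zero hui.ne_zero)
          (mul_ne_zero (hCu c₂ hc₂).ne_zero hvi.ne_zero)) (pow_ne_zero 2 hH₂)
      obtain rfl : m = n + 1 := by omega
      -- Otherwise G also divides H₁, and then G² divides G.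
      have hGH₂ : ¬ G ∣ H₂ := by
        rintro ⟨c, rfl⟩
        have h1 : G ∣ H₁ := by
          apply hGp.dvd_of_dvd_pow (n := 2)
          refine ⟨1 + C c₁ * A.uPoly * (C c₂ * A.vPoly) * G * c ^ 2, ?_⟩
          linear_combination -h
        obtain ⟨c', rfl⟩ := h1
        refine not_sq_dvd_of_irreducible hGirr
          ⟨c' ^ 2 - C c₁ * A.uPoly * (C c₂ * A.vPoly) * c ^ 2, ?_⟩
        linear_combination h
      refine ⟨n, H₁, C r₁ * (C r₂ * H₂), hm, hC _ (hC _ hn), ?_, 1, ?_⟩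
      · rwa [(hCu r₁ hr₁0).dvd_mul_left, (hCu r₂ hr₂0).dvd_mul_left]
      · rw [← hr₁, ← hr₂, C_pow, C_pow] at h
        rw [A.normPoly_eq]
        linear_combination -h
    · have hH₂ : H₂ ≠ 0 := by
        rintro rfl
        refine hu (hui.associated_of_dvd hGirr ⟨C c₁ * H₁ ^ 2, ?_⟩).symm
        linear_combination h
      have hH₁ : H₁ ≠ 0 := by
        rintro rfl
        refine hv (hvi.associated_of_dvd hGirr ⟨-(C c₂ * H₂ ^ 2), ?_⟩).symm
        linear_combination h
      have hdeg : 1 + m * 2 = 1 + n * 2 := by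
        refine eq_of_sub_isHomogeneous ((hC c₁ A.uPoly_isHomogeneous).mul (hm.pow 2))
          ((hC c₂ A.vPoly_isHomogeneous).mul (hn.pow 2)) ?_ ?_ (h ▸ hG)
        · exact mul_ne_zero (mul_ne_zero (hCu c₁ hc₁).ne_zero hui.ne_zero) (pow_ne_zero 2 hH₁)
        · exact mul_ne_zero (mul_ne_zero (hCu c₂ hc₂).ne_zero hvi.ne_zero) (pow_ne_zero 2 hH₂)
      obtain rfl : m = n := by omega
      have hGH₂ : ¬ G ∣ H₂ := by
        rintro ⟨c, rfl⟩
        have h1 : G ∣ C c₁ * A.uPoly * H₁ ^ 2 :=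
          ⟨1 + C c₂ * A.vPoly * G * c ^ 2, by linear_combination -h⟩
        rw [mul_assoc, (hCu c₁ hc₁).dvd_mul_left] at h1
        obtain ⟨c', rfl⟩ := hGp.dvd_of_dvd_pow ((hGp.dvd_or_dvd h1).resolve_left hud)
        refine not_sq_dvd_of_irreducible hGirr ⟨C c₁ * A.uPoly * c' ^ 2 - C c₂ * A.vPoly * c ^ 2, ?_⟩
        linear_combination h
      -- Multiplication by ℓ₁ turns ℓ₁H₁² - ℓ₂H₂² into (ℓ₁H₁)² - c₁c₂uv H₂², and r₁r₂ is a square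
      -- root of c₁c₂.
      refine ⟨m, C c₁ * A.uPoly * H₁, C r₁ * (C r₂ * H₂), ?_, hC _ (hC _ hn), ?_, C c₁ * A.uPoly, ?_⟩
      · rw [add_comm]; exact (hC c₁ A.uPoly_isHomogeneous).mul hm
      · rwa [(hCu r₁ hr₁0).dvd_mul_left, (hCu r₂ hr₂0).dvd_mul_left]
      · have e1 : (C c₁ : PlaneRing k) = C r₁ ^ 2 := by rw [← hr₁, C_pow]
        have e2 : (C c₂ : PlaneRing k) = C r₂ ^ 2 := by rw [← hr₂, C_pow]
        rw [A.normPoly_eq]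
        rw [e1, e2] at h
        rw [e1]
        linear_combination -(C r₁ ^ 2 * A.uPoly) * h

end Criterion

/-! ### The image of a component is a curve. -/

section Image

variable {k : Type*} [Field k] {A : Axes k} {d : k} {G : PlaneRing k} {δ : ℕ}

/-- The equations of Q form a nonzero prime ideal, which contains a prime element H and is generated
by it. Being conical, Q also satisfies each homogeneous component of H; a nonzero one is divisible
by H and of no larger degree, so H is homogeneous. -/
theorem exists_primeCurve_of_isConical {L : Type*} [Field L] [Algebra k L] [Infinite L]
    {Q : Fin 3 → L} (hQ : IsConical (k := k) Q)
    (hdvd : ∀ H e : PlaneRing k, Prime H → aeval Q H = 0 → aeval Q e = 0 → H ∣ e)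
    {N : PlaneRing k} (hN0 : N ≠ 0) (hN : aeval Q N = 0) :
    ∃ D : PrimeCurve k, ∀ f, f ∈ D.ideal ↔ aeval Q f = 0 := by
  have hker : (RingHom.ker (aeval Q : PlaneRing k →ₐ[k] L)).IsPrime := RingHom.ker_isPrime _
  obtain ⟨H, hH, hHp⟩ := Ideal.IsPrime.exists_mem_prime_of_ne_bot hker (by
    intro h
    have : N ∈ RingHom.ker (aeval Q : PlaneRing k →ₐ[k] L) := hN
    rw [h] at this
    exact hN0 this)
  rw [RingHom.mem_ker] at hH
  have h : ∀ f, aeval Q f = 0 ↔ H ∣ f := fun f => by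
    refine ⟨hdvd H f hHp hH, ?_⟩
    rintro ⟨c, rfl⟩
    rw [map_mul, hH, zero_mul]
  obtain ⟨i, hi⟩ : ∃ i, homogeneousComponent i H ≠ 0 := by
    by_contra! h0
    apply hHp.ne_zero
    rw [← sum_homogeneousComponent H]
    exact Finset.sum_eq_zero fun i _ => h0 i
  refine ⟨⟨Ideal.span {H}, H, hHp.irreducible, ⟨i, ?_⟩, rfl⟩, fun f => by
    rw [Ideal.mem_span_singleton, h]⟩
  obtain ⟨c, hc⟩ := (h _).1 (hQ.component hH i)
  have hc0 : c ≠ 0 := by rintro rfl; rw [mul_zero] at hc; exact hi hc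
  have hdeg := (homogeneousComponent_isHomogeneous i H).totalDegree hi
  rw [hc, totalDegree_mul_of_isDomain hHp.ne_zero hc0] at hdeg
  have hle : i ≤ H.totalDegree := by
    by_contra! hlt
    exact hi (homogeneousComponent_eq_zero _ _ hlt)
  have hcC := totalDegree_eq_zero_iff_eq_C.1 (show c.totalDegree = 0 by omega)
  set r := coeff 0 c
  have hr : r ≠ 0 := by intro h; rw [h, C_0] at hcC; exact hc0 hcC
  have : H = C r⁻¹ * homogeneousComponent i H := by
    rw [hc, hcC, mul_left_comm, ← C_mul, inv_mul_cancel₀ hr, C_1, mul_one]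
  rw [this]
  simpa using (isHomogeneous_C (Fin 3) r⁻¹).mul (homogeneousComponent_isHomogeneous i H)

theorem aeval_pt_of_secantHom_eq {f : ProdRing k} {r s : PlaneRing k} {g : Polynomial (PlaneRing k)}
    (hg : secantHom f = Polynomial.C r + Polynomial.C s * Polynomial.X +
      (Polynomial.X ^ 2 - Polynomial.C A.normPoly) * g) {Ω : Type*} [CommRing Ω] [Algebra k Ω]
    (R : Fin 3 → Ω) {t : Ω} (ht : t ^ 2 = A.norm (R 0) (R 1)) :
    aeval (Sum.elim R (pt R (R 2 + t) t)) f = aeval R r + aeval R s * t := by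
  rw [← eval₂_secantHom, hg]
  simp [Polynomial.eval₂_add, Polynomial.eval₂_mul, ht]

/-- Every point off the conic and the two lines is of the form `(x (z + t), y (z + t), z t)` with
`t² = u v`. -/
theorem eq_zero_of_forall_eval_pt [IsAlgClosed k] (A : Axes k)
    (h : ∀ (R : Fin 3 → k) (t : k), t ^ 2 = A.norm (R 0) (R 1) → aeval (pt R (R 2 + t) t) G = 0) :
    G = 0 := by
  have : Infinite k := IsAlgClosed.instInfinite
  have hz : G * (A.normPoly * (X 2 ^ 2 - C 1 * A.normPoly)) = 0 := by
    refine MvPolynomial.funext fun R => ?_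
    rw [map_zero, ← aeval_eq_eval, map_mul, map_mul, map_sub, map_mul, A.aeval_normPoly, map_pow,
      aeval_X, aeval_C, map_one, one_mul]
    by_cases hn : A.norm (R 0) (R 1) = 0
    · rw [hn]; ring
    by_cases hc : R 2 ^ 2 = A.norm (R 0) (R 1)
    · rw [hc]; ring
    obtain ⟨w, hw⟩ := IsAlgClosed.exists_pow_nat_eq (A.norm (R 0) (R 1)) (n := 2) two_pos
    -- The preimage is sought as (xt/w, yt/w, z/t) with w² = uv, whose uv is t². It is sent to R
    -- when z/t + t = w/t, that is, t² = w - z; z² ≠ uv ensures t ≠ 0.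
    obtain ⟨t, ht⟩ := IsAlgClosed.exists_pow_nat_eq (w - R 2) (n := 2) two_pos
    have hw0 : w ≠ 0 := by rintro rfl; exact hn (by rw [← hw]; ring)
    have ht0 : t ≠ 0 := by
      rintro rfl
      apply hc
      rw [← hw, sub_eq_zero.1 (ht.symm.trans (zero_pow two_ne_zero))]
    have hwt : w = R 2 + t ^ 2 := by rw [ht]; ring
    have := h ![R 0 * (t / w), R 1 * (t / w), R 2 / t] t (by
      simp only [Matrix.cons_val_zero, Matrix.cons_val_one, A.norm_mul, ← hw]
      field_simp)
    have e : pt ![R 0 * (t / w), R 1 * (t / w), R 2 / t] (R 2 / t + t) t = R := by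
      have h1 : t / w * (R 2 / t + t) = 1 := by
        rw [show R 2 / t + t = w / t by rw [hwt]; field_simp]; field_simp
      refine ext_three ?_ ?_ ?_
      · simp only [pt_zero, Matrix.cons_val_zero]; rw [mul_assoc, h1, mul_one]
      · simp only [pt_one, Matrix.cons_val_one, Matrix.cons_val_zero]; rw [mul_assoc, h1, mul_one]
      · simp only [pt_two, Matrix.cons_val]; field_simp
    simp only [Matrix.cons_val] at this
    rw [e] at this
    rw [this, zero_mul]
  have hn : A.normPoly ≠ 0 := mul_ne_zero A.uPoly_ne_zero A.vPoly_ne_zero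
  have hc : (X 2 ^ 2 - C 1 * A.normPoly : PlaneRing k) ≠ 0 := by
    intro h0
    have := congrArg (aeval (![0, 0, 1] : Fin 3 → k)) h0
    rw [map_sub, map_mul, A.aeval_normPoly] at this
    simp at this
  exact (mul_eq_zero.1 hz).resolve_right (mul_ne_zero hn hc)

variable {L : Type*} [Field L] [Algebra k L] {q : Ideal (ProdRing k)} {P Q : Fin 3 → L} {ρ α : L}

/-- G evaluated at the first point, expressed through Q, is r + sτ up to a power of β; its norm r² -
uv s² is an equation of Q. If this norm were zero then r = s = 0, and G would vanish at all points
of the form `pt R (R 2 + t) t`, hence identically. -/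
theorem IsComponentPoint.exists_primeCurve [IsAlgClosed k] (h2 : (2 : k) ≠ 0) (hd : d ≠ 0)
    (hG : G.IsHomogeneous δ) (hGirr : Irreducible G) (h : IsComponentPoint A d G q P Q ρ α)
    (hPρ : P 2 + ρ ≠ 0) : ∃ D : PrimeCurve k, ∀ f, f ∈ D.ideal ↔ aeval Q f = 0 := by
  have : Infinite L := Infinite.of_injective _ (algebraMap k L).injective
  have hn := h.snd_norm_ne_zero hPρ
  obtain ⟨i, hi, hQi⟩ := A.exists_ne_zero_of_norm_ne_zero hn
  obtain ⟨τ, β, hβ, hτ0, hτ, hP⟩ := h.exists_fst_eq hPρ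
  obtain ⟨r, s, g, hg⟩ := exists_secantHom_eq A (rename Sum.inr G)
  refine exists_primeCurve_of_isConical h.generic.isConical_snd
    (fun H e hH hQH hQe => dvd_of_aeval_snd_eq_zero hd h.mem h.generic hi hQi (fun _ => hn) hH hQH hQe)
    (N := r ^ 2 - A.normPoly * s ^ 2) ?_ ?_
  · intro h0
    obtain ⟨rfl, rfl⟩ := A.eq_zero_of_sq_eq h2 (sub_eq_zero.1 h0)
    refine hGirr.ne_zero (eq_zero_of_forall_eval_pt A fun R t ht => ?_)
    have := aeval_pt_of_secantHom_eq hg R ht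
    rwa [aeval_rename, Sum.elim_comp_inr, map_zero, zero_mul, add_zero] at this
  · have h0 : aeval P G = 0 := (h.dvd_iff G).2 dvd_rfl
    have h1 := aeval_pt_of_secantHom_eq hg Q hτ
    rw [aeval_rename, Sum.elim_comp_inr] at h1
    rw [hP, aeval_smul_eq_zero_iff hG hβ, h1] at h0
    rw [map_sub, map_mul, map_pow, map_pow, A.aeval_normPoly, ← hτ]
    linear_combination (aeval Q r - aeval Q s * τ) * h0

end Image

/-! ### Components obtained from a square root of uv on C. -/

section GenericPoint

variable {k : Type u} [Field k]

theorem exists_generic_point {G : PlaneRing k} (hG : Prime G) :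
    ∃ (K : Type u) (_ : Field K) (_ : Algebra k K) (x : Fin 3 → K),
      ∀ h : PlaneRing k, aeval x h = 0 ↔ G ∣ h := by
  have : (Ideal.span {G}).IsPrime := (Ideal.span_singleton_prime hG.ne_zero).2 hG
  let R := PlaneRing k ⧸ Ideal.span {G}
  refine ⟨FractionRing R, inferInstance, inferInstance,
    fun i => algebraMap R _ (Ideal.Quotient.mk _ (X i)), fun h => ?_⟩
  have e : (aeval fun i => algebraMap R (FractionRing R) (Ideal.Quotient.mk _ (X i))) =
      (IsScalarTower.toAlgHom k R (FractionRing R)).comp (Ideal.Quotient.mkₐ k (Ideal.span {G})) := by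
    apply algHom_ext; intro i; simp [R]
  rw [e, AlgHom.comp_apply, IsScalarTower.coe_toAlgHom', map_eq_zero_iff _ (IsFractionRing.injective _ _),
    Ideal.Quotient.mkₐ_eq_mk, Ideal.Quotient.eq_zero_iff_mem, Ideal.mem_span_singleton]

end GenericPoint

section Split

variable {k : Type*} [Field k] [IsAlgClosed k] {A : Axes k} {d : k} {G : PlaneRing k} {δ : ℕ}

/-- At a generic point x of C, ρ = a/b defines an incident point y, with u(y) = u(x)(z + ρ), v(y) =
v(x)(z + ρ) and F(y) = -dρ³(2z + ρ). The factors z + ρ and 2z + ρ are nonzero because C is neither B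
nor B₂, so the image lies in no removed curve. -/
theorem exists_component_of_root (h2 : (2 : k) ≠ 0) (hd : d ≠ 0) (hG : G.IsHomogeneous δ)
    (hGirr : Irreducible G) (hGz : ¬ G ∣ X 2) (hu : ¬ G ∣ A.uPoly) (hv : ¬ G ∣ A.vPoly)
    (hF : ¬ G ∣ X 2 ^ 2 - C 1 * A.normPoly) (hF2 : ¬ G ∣ X 2 ^ 2 - C (4⁻¹) * A.normPoly) {m : ℕ}
    {a b : PlaneRing k} (ha : a.IsHomogeneous (m + 1)) (hb : b.IsHomogeneous m) (hGb : ¬ G ∣ b)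
    (hab : G ∣ a ^ 2 - A.normPoly * b ^ 2) :
    ∃ (q : PrimeSpectrum (ProdRing k)) (D : PrimeCurve k), q ∈ componentsOver (A.conic d) G D ∧
      ¬ (A.conic d ∈ D.ideal ∨ A.uPoly ∈ D.ideal ∨ A.vPoly ∈ D.ideal) ∧
      (∀ f, f ∈ D.ideal ↔ aeval (genericSnd q.asIdeal) f = 0) ∧
      ∃ ρ α, IsComponentPoint A d G q.asIdeal (genericFst q.asIdeal) (genericSnd q.asIdeal) ρ α ∧
        genericFst q.asIdeal 2 + ρ ≠ 0 ∧ IsRatio (genericFst q.asIdeal) ρ m a b := by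
  obtain ⟨K, _, _, x, hx⟩ := exists_generic_point hGirr.prime
  have hK2 : (2 : K) ≠ 0 := by
    have := (map_ne_zero (algebraMap k K)).2 h2
    rwa [map_ofNat] at this
  have hbx : aeval x b ≠ 0 := fun h => hGb ((hx b).1 h)
  have hz : x 2 ≠ 0 := fun h => hGz ((hx _).1 (by rwa [aeval_X]))
  have hux : A.u (x 0) (x 1) ≠ 0 := fun h => hu ((hx _).1 (by rwa [A.aeval_uPoly]))
  have hvx : A.v (x 0) (x 1) ≠ 0 := fun h => hv ((hx _).1 (by rwa [A.aeval_vPoly]))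
  obtain ⟨i, hi, hxi⟩ := A.exists_ne_zero_of_norm_ne_zero (mul_ne_zero hux hvx)
  set ρ := aeval x a / aeval x b with hρ
  have hρb : aeval x a = aeval x b * ρ := by rw [hρ]; field_simp
  have hρ2 : ρ ^ 2 = A.norm (x 0) (x 1) := by
    have := (hx _).2 hab
    rw [map_sub, map_mul, map_pow, map_pow, A.aeval_normPoly, hρb] at this
    apply mul_right_cancel₀ (pow_ne_zero 2 hbx)
    linear_combination this
  have hρ0 : ρ ≠ 0 := by
    intro h
    rw [h, zero_pow two_ne_zero] at hρ2
    exact mul_ne_zero hux hvx hρ2.symm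
  have h1 : x 2 + ρ ≠ 0 := by
    intro h
    refine hF ((hx _).1 ?_)
    rw [map_sub, map_mul, A.aeval_normPoly, ← hρ2, map_pow, aeval_X, aeval_C, map_one]
    linear_combination (x 2 - ρ) * h
  have h3 : 2 * x 2 + ρ ≠ 0 := by
    intro h
    refine hF2 ((hx _).1 ?_)
    have h4 : algebraMap k K 4⁻¹ * 4 = 1 := by
      rw [← map_ofNat (algebraMap k K) 4, ← map_mul, inv_mul_cancel₀, map_one]
      rw [show (4 : k) = 2 * 2 by norm_num]; exact mul_ne_zero h2 h2
    rw [map_sub, map_mul, A.aeval_normPoly, ← hρ2, map_pow, aeval_X, aeval_C]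
    linear_combination algebraMap k K 4⁻¹ * (2 * x 2 - ρ) * h - x 2 ^ 2 * h4
  set y := pt x (x 2 + ρ) ρ with hy
  have hI : pullbackIdeal (A.conic d) G ≤
      RingHom.ker (aeval (Sum.elim x y) : ProdRing k →ₐ[k] K) :=
    (pullbackIdeal_le_ker_iff hd G x y).2 ⟨Axes.incident_pt hρ2, (hx G).2 dvd_rfl⟩
  have hprime : (RingHom.ker (aeval (Sum.elim x y) : ProdRing k →ₐ[k] K)).IsPrime :=
    RingHom.ker_isPrime _
  -- The kernel itself need not be known to be minimal: what is nonzero at (x, y) is nonzero at the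
  -- generic point of any smaller prime.
  obtain ⟨q, hq, hle⟩ := Ideal.exists_minimalPrimes_le hI
  have hqp : q.IsPrime := hq.1.1
  have hsnd : ∀ f : PlaneRing k, aeval y f ≠ 0 → aeval (genericSnd q) f ≠ 0 := by
    intro f hf h0
    have : rename Sum.inr f ∈ q := by
      rw [mem_iff_aeval_generic, aeval_rename, Sum.elim_comp_inr, h0]
    have := hle this
    rw [RingHom.mem_ker, aeval_rename, Sum.elim_comp_inr] at this
    exact hf this
  have hyu : A.u (y 0) (y 1) = A.u (x 0) (x 1) * (x 2 + ρ) := by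
    rw [hy, pt_zero, pt_one, A.u_mul]
  have hyv : A.v (y 0) (y 1) = A.v (x 0) (x 1) * (x 2 + ρ) := by
    rw [hy, pt_zero, pt_one, A.v_mul]
  have hQF : aeval (genericSnd q) (A.conic d) ≠ 0 := by
    apply hsnd
    rw [Axes.conic, map_mul, map_sub, A.aeval_normPoly, map_pow, aeval_X, aeval_C]
    refine mul_ne_zero ((map_ne_zero _).2 hd) ?_
    rw [Axes.norm, hyu, hyv, hy, pt_two]
    have : (x 2 * ρ) ^ 2 - A.u (x 0) (x 1) * (x 2 + ρ) * (A.v (x 0) (x 1) * (x 2 + ρ)) =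
        -(ρ ^ 3 * (2 * x 2 + ρ)) := by
      rw [Axes.norm] at hρ2
      linear_combination -(x 2 + ρ) ^ 2 * hρ2.symm
    rw [this]
    exact neg_ne_zero.2 (mul_ne_zero (pow_ne_zero 3 hρ0) h3)
  have hQu : aeval (genericSnd q) A.uPoly ≠ 0 := by
    apply hsnd; rw [A.aeval_uPoly, hyu]; exact mul_ne_zero hux h1
  have hQv : aeval (genericSnd q) A.vPoly ≠ 0 := by
    apply hsnd; rw [A.aeval_vPoly, hyv]; exact mul_ne_zero hvx h1
  have hX : ∃ i, X (Sum.inl i) ∉ q := ⟨2, fun h => hz (by simpa using hle h)⟩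
  have hY : ∃ i, X (Sum.inr i) ∉ q := ⟨2, fun h => by
    have := hle h
    rw [RingHom.mem_ker, aeval_X, Sum.elim_inr, hy, pt_two] at this
    exact mul_ne_zero hz hρ0 this⟩
  obtain ⟨ρ', α, hcp⟩ := exists_isComponentPoint hd hG hGirr hGz hq (mem_iff_aeval_generic q) hX
    hQF hQu hQv
  have hPρ : genericFst q 2 + ρ' ≠ 0 := by
    intro h
    refine hF ((hcp.dvd_iff _).1 ?_)
    rw [map_sub, map_mul, A.aeval_normPoly, ← hcp.sq_eq, map_pow, aeval_X, aeval_C, map_one]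
    linear_combination (genericFst q 2 - ρ') * h
  obtain ⟨D, hD⟩ := hcp.exists_primeCurve h2 hd hG hGirr hPρ
  have hbP : aeval (genericFst q) b ≠ 0 := fun h => hGb ((hcp.dvd_iff b).1 h)
  refine ⟨⟨q, hqp⟩, D, ⟨⟨hq, hX, hY⟩, ?_⟩, ?_, hD, ρ', α, hcp, hPρ, ha, hb, hbP, ?_⟩
  · ext f
    rw [hD, Ideal.mem_comap, mem_iff_aeval_generic, aeval_rename, Sum.elim_comp_inr]
  · simp only [hD, not_or]; exact ⟨hQF, hQu, hQv⟩
  · have hsq : aeval (genericFst q) a ^ 2 = (aeval (genericFst q) b * ρ') ^ 2 := by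
      have := (hcp.dvd_iff _).2 hab
      rw [map_sub, map_mul, map_pow, map_pow, A.aeval_normPoly, ← hcp.sq_eq] at this
      linear_combination this
    rcases sq_eq_sq_iff_eq_or_eq_neg.1 hsq with h | h
    · exact h
    exfalso
    -- If q carried the root -a/b, its relation specialised at (x, y) would contradict the choice of
    -- y with the root a/b.
    have hrel := hcp.generic.relation hcp.snd_eq (a := -a) (b := b) (by rw [map_neg, h, neg_neg])
      (P' := x) (Q' := y) (fun f hf => hle hf) hi
    have hyi : y i = x i * (x 2 + ρ) := by
      rw [hy]; fin_cases i <;> first | rfl | exact absurd rfl hi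
    rw [hyi, hy, pt_two, map_neg, hρb] at hrel
    have : 2 * (x i * x 2 ^ 2 * aeval x b * ρ) = 0 := by linear_combination -hrel
    exact mul_ne_zero hK2 (mul_ne_zero (mul_ne_zero (mul_ne_zero hxi (pow_ne_zero 2 hz)) hbx) hρ0) this

end Split

/-! ### Two components with the same image force C to be a line through A. -/

section Distinct

variable {k : Type*} [Field k] {A : Axes k} {d : k} {G : PlaneRing k} {δ : ℕ}
  {L : Type*} [Field L] [Algebra k L] {q : Ideal (ProdRing k)} {P Q : Fin 3 → L} {ρ α : L}
  {L' : Type*} [Field L'] [Algebra k L'] {q' : Ideal (ProdRing k)} {P' Q' : Fin 3 → L'} {ρ' α' : L'}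
  {m : ℕ} {a b : PlaneRing k}

theorem SameEquations.of_forall {Ω : Type*} [CommRing Ω] [Algebra k Ω] {R : Fin 3 → Ω}
    (hPP' : ∀ f : PlaneRing k, aeval P f = 0 ↔ aeval P' f = 0) (h : SameEquations (k := k) P R) :
    SameEquations (k := k) P' R := fun n f hf => (h n f hf).trans (hPP' f)

theorem IsGeneric.eval_smul_snd_eq_zero [Infinite L] (hg : IsGeneric q P Q) {Ω : Type*} [Field Ω]
    [Algebra k Ω] {R S : Fin 3 → Ω} {c : Ω} (hc : c ≠ 0)
    (h : ∀ f ∈ q, aeval (Sum.elim R (c • S)) f = 0) : ∀ f ∈ q, aeval (Sum.elim R S) f = 0 := by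
  have := hg.eval_smul_eq_zero h 1 c⁻¹
  rwa [one_smul, smul_smul, inv_mul_cancel₀ hc, one_smul] at this

theorem eval_swap {Ω : Type*} [CommRing Ω] [Algebra k Ω] {R S : Fin 3 → Ω}
    (h : ∀ f ∈ q.comap (rename Sum.swap : ProdRing k →ₐ[k] ProdRing k), aeval (Sum.elim S R) f = 0) :
    ∀ f ∈ q, aeval (Sum.elim R S) f = 0 := by
  have e : Sum.elim S R ∘ Sum.swap = Sum.elim R S := by funext i; cases i <;> rfl
  intro f hf
  have := h (rename Sum.swap f) (by
    rw [Ideal.mem_comap, rename_rename, Sum.swap_swap_eq, rename_id]; exact hf)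
  rwa [aeval_rename, e] at this

namespace IsComponentPoint

variable [IsAlgClosed k]

/-- The points over which the two components attached to the two square roots of `u v` on the curve
meet the same point on the image side are related by homotheties. -/
theorem sameEquations_step (h2 : (2 : k) ≠ 0) (h : IsComponentPoint A d G q P Q ρ α)
    (h' : IsComponentPoint A d G q' P' Q' ρ' α') (hPρ : P 2 + ρ ≠ 0) (hPρ' : P' 2 + ρ' ≠ 0)
    (hab : IsRatio P ρ m a b) (hab' : IsRatio P' ρ' m (-a) b)
    (hQQ' : ∀ f : PlaneRing k, aeval Q f = 0 ↔ aeval Q' f = 0) {c : L}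
    (hc : SameEquations (k := k) P (pt P c ρ))
    (hac : aeval (pt P c ρ) a = aeval (pt P c ρ) b * (ρ * c)) :
    SameEquations (k := k) P (pt P (c + 2 * P 2) ρ) ∧
      aeval (pt P (c + 2 * P 2) ρ) a = aeval (pt P (c + 2 * P 2) ρ) b * (ρ * (c + 2 * P 2)) := by
  have : Infinite L := Infinite.of_injective _ (algebraMap k L).injective
  have : Infinite L' := Infinite.of_injective _ (algebraMap k L').injective
  have hL2 : (2 : L) ≠ 0 := by
    have := (map_ne_zero (algebraMap k L)).2 h2
    rwa [map_ofNat] at this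
  have hPP' : ∀ f : PlaneRing k, aeval P f = 0 ↔ aeval P' f = 0 := fun f => by
    rw [h.dvd_iff, h'.dvd_iff]
  obtain ⟨ha, hb, hb0, hab0⟩ := hab
  obtain ⟨-, -, hb0', hab0'⟩ := hab'
  obtain ⟨i, hi, hPi⟩ := A.exists_ne_zero_of_norm_ne_zero h.norm_ne_zero
  have hpt : ∀ x y : L, pt P x y i = P i * x := fun x y => by
    fin_cases i <;> first | rfl | exact absurd rfl hi
  have hP2 := h.fst_two_ne_zero
  have hρ0 := h.root_ne_zero
  have hbc : aeval (pt P c ρ) b ≠ 0 := fun h0 => hb0 ((hc _ b hb).1 h0)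
  have hac0 : aeval (pt P c ρ) b * ρ * c ≠ 0 := by
    rw [mul_assoc, ← hac]
    intro h0
    have := (hc _ a ha).1 h0
    rw [hab0] at this
    exact mul_ne_zero hb0 hρ0 this
  have hc0 : c ≠ 0 := right_ne_zero_of_mul hac0
  -- the image point
  have hQc : SameEquations (k := k) Q (pt P (c + P 2) ρ) := by
    have := IsGeneric.sameEquations_pt h.scale_ne_zero h.snd_eq ha hb hb0 hab0 hc
    have e : pt (pt P c ρ) (aeval (pt P c ρ) b * pt P c ρ 2 + aeval (pt P c ρ) a)
        (aeval (pt P c ρ) a) = (aeval (pt P c ρ) b * ρ * c) • pt P (c + P 2) ρ := by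
      rw [hac]
      exact ext_three (by simp; ring) (by simp; ring) (by simp; ring)
    rw [e] at this
    exact this.of_smul hac0
  have hQc' : SameEquations (k := k) Q' (pt P (c + P 2) ρ) := hQc.of_forall hQQ'
  have hnc : (ρ * (c + P 2)) ^ 2 = A.norm (pt P (c + P 2) ρ 0) (pt P (c + P 2) ρ 1) := by
    rw [pt_zero, pt_one, A.norm_mul, ← h.sq_eq]; ring
  have hcc : c + P 2 ≠ 0 := by
    intro h0
    have h1 : aeval (pt P (c + P 2) ρ) A.normPoly = 0 := by
      rw [A.aeval_normPoly, ← hnc, h0]; ring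
    rw [hQc _ _ A.normPoly_isHomogeneous, A.aeval_normPoly] at h1
    exact h.snd_norm_ne_zero hPρ h1
  have hstep : ∀ b' : L, pt (pt P (c + P 2) ρ) (b' * pt P (c + P 2) ρ 2 + b' * (ρ * (c + P 2)))
      (b' * (ρ * (c + P 2))) = (b' * (ρ * (c + P 2))) • pt P (c + 2 * P 2) ρ := fun b' =>
    ext_three (by simp; ring) (by simp; ring) (by simp; ring)
  have hstep' : ∀ b' : L, pt (pt P (c + P 2) ρ) (b' * pt P (c + P 2) ρ 2 + -(b' * (ρ * (c + P 2))))
      (-(b' * (ρ * (c + P 2)))) = (-(b' * (ρ * (c + P 2)))) • pt P c ρ := fun b' =>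
    ext_three (by simp; ring) (by simp; ring) (by simp; ring)
  -- the second component does not pass through the old point
  have hback : ¬ ∀ f ∈ q', aeval (Sum.elim (pt P c ρ) (pt P (c + P 2) ρ)) f = 0 := by
    intro h0
    -- q' carries the root -a/b, while the passage from c to c + z uses a/b.
    have hrel := h'.generic.relation h'.snd_eq hab0' h0 hi
    rw [hpt, hpt, map_neg, hac, pt_two, pt_two] at hrel
    have : 2 * (P i * P 2 ^ 2 * ρ * (aeval (pt P c ρ) b * ρ * c)) = 0 := by
      linear_combination -hrel
    exact mul_ne_zero hL2 (mul_ne_zero (mul_ne_zero (mul_ne_zero hPi (pow_ne_zero 2 hP2)) hρ0) hac0) this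
  obtain ⟨τ, β, hβ, hτ0, hτ, hP'⟩ := h'.exists_fst_eq hPρ'
  -- From the image point at c + z, the way back along q' leads to c + 2z or to c according to the
  -- sign of the root. The latter is excluded by `hback`, and an irrational τ would allow it.
  rcases h'.generic.swap.isRatio_or hβ (h'.snd_norm_ne_zero hPρ') h'.snd_two_ne_zero hP' with
    ⟨n, a', b', ha', hb', hb0'', hab''⟩ | hN
  · have hb'c : aeval (pt P (c + P 2) ρ) b' ≠ 0 := fun h0 => hb0'' ((hQc' _ b' hb').1 h0)
    have hv := fun f (hf : f ∈ q'.comap (rename Sum.swap : ProdRing k →ₐ[k] ProdRing k)) =>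
      h'.generic.swap.eval_pt_eq_zero hβ hP' hab''
        (hQc'.eq_zero h'.generic.isConical_snd) hf
    have hsq : aeval (pt P (c + P 2) ρ) a' ^ 2 =
        (aeval (pt P (c + P 2) ρ) b' * (ρ * (c + P 2))) ^ 2 := by
      have h0 : aeval Q' (a' ^ 2 - A.normPoly * b' ^ 2) = 0 := by
        rw [map_sub, map_mul, map_pow, map_pow, A.aeval_normPoly, ← hτ, hab'']; ring
      have := hQc'.eq_zero h'.generic.isConical_snd _ h0
      rw [map_sub, map_mul, map_pow, map_pow, A.aeval_normPoly, ← hnc] at this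
      linear_combination this
    have hs0 : aeval (pt P (c + P 2) ρ) b' * (ρ * (c + P 2)) ≠ 0 :=
      mul_ne_zero hb'c (mul_ne_zero hρ0 hcc)
    rcases sq_eq_sq_iff_eq_or_eq_neg.1 hsq with hs | hs
    · have hPc : SameEquations (k := k) P' (pt P (c + 2 * P 2) ρ) := by
        have := IsGeneric.sameEquations_pt hβ hP' ha' hb' hb0'' hab'' hQc'
        rw [hs, hstep] at this
        exact this.of_smul hs0
      refine ⟨hPc.of_forall fun f => (hPP' f).symm, ?_⟩
      have hv' : ∀ f ∈ q', aeval (Sum.elim (pt P (c + 2 * P 2) ρ) (pt P (c + P 2) ρ)) f = 0 := by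
        apply eval_swap
        apply h'.generic.swap.eval_smul_snd_eq_zero hs0
        rw [hs, hstep] at hv
        exact hv
      have hrel := h'.generic.relation h'.snd_eq hab0' hv' hi
      rw [hpt, hpt, map_neg, pt_two, pt_two] at hrel
      apply mul_left_cancel₀ (mul_ne_zero (mul_ne_zero hPi (pow_ne_zero 2 hP2)) hρ0)
      linear_combination hrel
    · exfalso
      apply hback
      apply eval_swap
      apply h'.generic.swap.eval_smul_snd_eq_zero (neg_ne_zero.2 hs0)
      rw [hs, hstep'] at hv
      exact hv
  · exfalso
    apply hback
    have hv := fun f (hf : f ∈ q'.comap (rename Sum.swap : ProdRing k →ₐ[k] ProdRing k)) =>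
      h'.generic.swap.eval_pt_of_not_ratio hβ hτ hP' hN
        (hQc'.eq_zero h'.generic.isConical_snd) (t := -(ρ * (c + P 2))) (by rw [neg_sq, hnc]) hf
    have := hstep' 1
    rw [one_mul, one_mul] at this
    rw [this] at hv
    apply eval_swap
    exact h'.generic.swap.eval_smul_snd_eq_zero
      (neg_ne_zero.2 (mul_ne_zero hρ0 hcc)) hv

/-- Going out along q and back along q' adds 2z to c, so C contains the points with c = ρ + 2nz, as
in `isLine_of_not_ratio`. -/
theorem isLine_of_same_image {p : ℕ} [CharP k p] (h2 : (2 : k) ≠ 0)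
    (hp : p = 0 ∨ (2 < p ∧ δ < p)) (hG : G.IsHomogeneous δ) (hGirr : Irreducible G)
    (h : IsComponentPoint A d G q P Q ρ α)
    (h' : IsComponentPoint A d G q' P' Q' ρ' α') (hPρ : P 2 + ρ ≠ 0) (hPρ' : P' 2 + ρ' ≠ 0)
    (hab : IsRatio P ρ m a b) (hab' : IsRatio P' ρ' m (-a) b)
    (hQQ' : ∀ f : PlaneRing k, aeval Q f = 0 ↔ aeval Q' f = 0) :
    δ = 1 ∧ eval (origin k) G = 0 := by
  refine isLine_of_forall_nat hp hG hGirr h.dvd_iff h.fst_two_ne_zero h.root_ne_zero fun n => ?_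
  suffices H : ∀ n : ℕ, SameEquations (k := k) P (pt P (ρ + 2 * n * P 2) ρ) ∧
      aeval (pt P (ρ + 2 * n * P 2) ρ) a =
        aeval (pt P (ρ + 2 * n * P 2) ρ) b * (ρ * (ρ + 2 * n * P 2)) from
    ((H n).1 δ G hG).2 ((h.dvd_iff G).2 dvd_rfl)
  intro n
  induction n with
  | zero =>
    have e : pt P (ρ + 2 * (0 : ℕ) * P 2) ρ = ρ • P :=
      ext_three (by simp [mul_comm]) (by simp [mul_comm]) (by simp [mul_comm])
    rw [e]
    refine ⟨SameEquations.smul (fun n f hf => Iff.rfl) h.root_ne_zero, ?_⟩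
    rw [aeval_smul_of_isHomogeneous hab.1, aeval_smul_of_isHomogeneous hab.2.1, hab.2.2.2]
    simp; ring
  | succ n ih =>
    have := h.sameEquations_step h2 h' hPρ hPρ' hab hab' hQQ' ih.1 ih.2
    have e : ρ + 2 * ((n + 1 : ℕ) : L) * P 2 = ρ + 2 * n * P 2 + 2 * P 2 := by push_cast; ring
    rw [e]
    exact this

end IsComponentPoint

end Distinct

/-! ### The case C = L∞. -/

section LineAtInfinity

variable {k : Type*} [Field k] {A : Axes k} {d : k} {G : PlaneRing k} {δ : ℕ}

/-- The proper conchoid of the line at infinity is supported on this line. -/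
theorem X_two_mem_of_mem_componentsOver (hd : d ≠ 0) (hG : G ∣ X 2) {D : PrimeCurve k}
    {q : PrimeSpectrum (ProdRing k)} (hq : q ∈ componentsOver (A.conic d) G D)
    (hD : ¬ (A.conic d ∈ D.ideal ∨ A.uPoly ∈ D.ideal ∨ A.vPoly ∈ D.ideal)) : X 2 ∈ D.ideal := by
  set P := genericFst q.asIdeal with hP
  set Q := genericSnd q.asIdeal with hQ
  have hDQ : ∀ f, f ∈ D.ideal ↔ aeval Q f = 0 := fun f => by
    rw [hq.2, Ideal.mem_comap, mem_iff_aeval_generic, aeval_rename, Sum.elim_comp_inr]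
  simp only [hDQ, not_or, A.aeval_uPoly, A.aeval_vPoly] at hD
  obtain ⟨hinc, hPG⟩ := (pullbackIdeal_le_ker_iff hd G P Q).1 fun f hf =>
    (mem_iff_aeval_generic q.asIdeal f).1 (hq.1.1.1.2 hf)
  have hP2 : P 2 = 0 := by
    obtain ⟨c, hc⟩ := hG
    have := congrArg (aeval P) hc
    rwa [aeval_X, map_mul, hPG, zero_mul] at this
  obtain ⟨i, hi⟩ := hq.1.2.1
  have hPi : P i ≠ 0 := fun h => hi ((mem_iff_aeval_generic q.asIdeal _).2 (by simpa using h))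
  have hi2 : i ≠ 2 := by rintro rfl; exact hPi hP2
  have hn := norm_ne_zero_of_snd hi2 hPi hinc hD.2.1 hD.2.2
  rw [hDQ, aeval_X]
  -- With z = 0 the incidence equation reads uv(x, y)Z² = 0.
  have e := hinc.1
  have e' : ∀ j, P 2 * Q j - P j * Q 2 = P j * (-Q 2) := fun j => by rw [hP2]; ring
  rw [e', e', A.norm_mul, hP2, zero_mul, zero_pow two_ne_zero, eq_comm, neg_sq] at e
  simpa [hn] using e

theorem PrimeCurve.eq_of_mem {f : PlaneRing k} (hf : Irreducible f) {D D' : PrimeCurve k}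
    (h : f ∈ D.ideal) (h' : f ∈ D'.ideal) : D = D' := by
  have key : ∀ D : PrimeCurve k, f ∈ D.ideal → D.ideal = Ideal.span {f} := fun D h => by
    obtain ⟨H, hH, -, hD⟩ := D.exists_equation
    rw [hD, Ideal.mem_span_singleton] at h
    rw [hD, Ideal.span_singleton_eq_span_singleton]
    exact hH.associated_of_dvd hf h
  exact PrimeCurve.ext ((key D h).trans (key D' h').symm)

theorem degree_eq_one_of_associated (hG : G.IsHomogeneous δ) {ℓ : PlaneRing k}
    (hℓ : ℓ.IsHomogeneous 1) (h0 : ℓ ≠ 0) (h : Associated G ℓ) :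
    δ = 1 ∧ ∀ v : Fin 3 → k, eval v G = 0 ↔ eval v ℓ = 0 := by
  obtain ⟨w, hw⟩ := h
  obtain ⟨c, hc, hwc⟩ := isUnit_iff_eq_C_of_isReduced.1 w.isUnit
  rw [hwc] at hw
  have hG0 : G ≠ 0 := by rintro rfl; rw [zero_mul] at hw; exact h0 hw.symm
  have hC0 : (C c : PlaneRing k) ≠ 0 := hwc ▸ w.ne_zero
  refine ⟨?_, fun v => ?_⟩
  · have := hℓ.totalDegree h0
    rwa [← hw, totalDegree_mul_of_isDomain hG0 hC0, totalDegree_C, add_zero, hG.totalDegree hG0] at this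
  · rw [← hw, map_mul, eval_C, mul_eq_zero, or_iff_left hc.ne_zero]

end LineAtInfinity

/-! ### The case where uv is a square on C. -/

section Dichotomy

variable {k : Type*} [Field k] [IsAlgClosed k] {A : Axes k} {d : k} {G : PlaneRing k} {δ : ℕ}

theorem IsComponentPoint.degreeOver_ne_zero {L : Type*} [Field L] [Algebra k L] {P Q : Fin 3 → L}
    {ρ α : L} (h2 : (2 : k) ≠ 0) {q : PrimeSpectrum (ProdRing k)}
    (h : IsComponentPoint A d G q.asIdeal P Q ρ α) (hPρ : P 2 + ρ ≠ 0) {D : PrimeCurve k}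
    (hD : ∀ f, f ∈ D.ideal ↔ aeval Q f = 0) : degreeOver q D ≠ 0 := by
  have : Infinite L := Infinite.of_injective _ (algebraMap k L).injective
  obtain ⟨τ, β, hβ, hτ0, hτ, hP⟩ := h.exists_fst_eq hPρ
  have hdeg := h.finite_setOf_ncard_ne h2 hPρ hD hβ hτ0 hτ hP
  rcases h.generic.swap.isRatio_or hβ (h.snd_norm_ne_zero hPρ) h.snd_two_ne_zero hP with
    ⟨m, a, b, ha, hb, hb0, hab⟩ | hab
  · exact Conchoid.degreeOver_ne_zero one_ne_zero (hdeg.1 _ a b ha hb0 hab)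
  · exact Conchoid.degreeOver_ne_zero two_ne_zero (hdeg.2 hab)

/-- When `u v` is a square on the curve, its two square roots yield two components of the
incidence correspondence. -/
theorem exists_two_components {p : ℕ} [CharP k p] (h2 : (2 : k) ≠ 0)
    (hp : p = 0 ∨ (2 < p ∧ δ < p)) (hd : d ≠ 0) (hG : G.IsHomogeneous δ)
    (hGirr : Irreducible G) (hGz : ¬ G ∣ X 2) (hu : ¬ G ∣ A.uPoly) (hv : ¬ G ∣ A.vPoly)
    (hF : ¬ G ∣ X 2 ^ 2 - C 1 * A.normPoly) (hF2 : ¬ G ∣ X 2 ^ 2 - C (4⁻¹) * A.normPoly)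
    (hex : ∀ D : PrimeCurve k, IsExceptional (A.conic d) D ↔
      A.conic d ∈ D.ideal ∨ A.uPoly ∈ D.ideal ∨ A.vPoly ∈ D.ideal) (hroot : HasRoot A G) :
    (properConchoid (A.conic d) G).HasTwoComponents ∨
      (properConchoid (A.conic d) G).IsReducible ∧ δ = 1 ∧ eval (origin k) G = 0 := by
  classical
  obtain ⟨m, a, b, ha, hb, hGb, hab⟩ := hroot
  have ha' : (-a).IsHomogeneous (m + 1) := ha.neg
  have hab' : G ∣ (-a) ^ 2 - A.normPoly * b ^ 2 := by rwa [neg_sq]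
  obtain ⟨q₁, D₁, hq₁, hex₁, hD₁, ρ₁, α₁, h₁, hρ₁, hr₁⟩ :=
    exists_component_of_root h2 hd hG hGirr hGz hu hv hF hF2 ha hb hGb hab
  obtain ⟨q₂, D₂, hq₂, hex₂, hD₂, ρ₂, α₂, h₂, hρ₂, hr₂⟩ :=
    exists_component_of_root h2 hd hG hGirr hGz hu hv hF hF2 ha' hb hGb hab'
  rw [← hex] at hex₁ hex₂
  have hm₁ := h₁.pullbackMultiplicity_eq_one hd h2
  have hm₂ := h₂.pullbackMultiplicity_eq_one hd h2
  have hd₁ := h₁.degreeOver_ne_zero h2 hρ₁ hD₁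
  have hd₂ := h₂.degreeOver_ne_zero h2 hρ₂ hD₂
  by_cases hD : D₁ = D₂
  · right
    subst hD
    refine ⟨?_, h₁.isLine_of_same_image h2 hp hG hGirr h₂ hρ₁ hρ₂ hr₁ hr₂ fun f => by
      rw [← hD₁, ← hD₂]⟩
    -- A common component would satisfy `relation` for both a and -a; adding the two gives 2 times a
    -- nonzero product.
    have hne : q₁ ≠ q₂ := by
      rintro rfl
      obtain ⟨i, hi, hPi⟩ := A.exists_ne_zero_of_norm_ne_zero h₁.norm_ne_zero
      have e₁ := h₁.generic.relation h₁.snd_eq hr₁.2.2.2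
        (fun f hf => (h₁.generic.mem_iff f).1 hf) hi
      have e₂ := h₁.generic.relation h₂.snd_eq hr₂.2.2.2
        (fun f hf => (h₁.generic.mem_iff f).1 hf) hi
      rw [map_neg] at e₂
      have hL2 : (2 : FractionRing (ProdRing k ⧸ q₁.asIdeal)) ≠ 0 := by
        have := (map_ne_zero (algebraMap k (FractionRing (ProdRing k ⧸ q₁.asIdeal)))).2 h2
        rwa [map_ofNat] at this
      have : 2 * (genericSnd q₁.asIdeal 2 * genericFst q₁.asIdeal i *
          (aeval (genericFst q₁.asIdeal) b * genericFst q₁.asIdeal 2)) = 0 := by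
        linear_combination -(e₁ + e₂)
      exact mul_ne_zero hL2 (mul_ne_zero (mul_ne_zero h₁.snd_two_ne_zero hPi)
        (mul_ne_zero hr₁.2.2.1 h₁.fst_two_ne_zero)) this
    -- Two distinct components, each of multiplicity 1 and positive degree, lie over the same curve.
    apply Cycle.isReducible_of_two_le (D := D₁)
    have := single_le_properConchoid hex₁ (s := {q₁, q₂}) (by
      intro q hq
      rw [Finset.mem_insert, Finset.mem_singleton] at hq
      rcases hq with rfl | rfl
      exacts [hq₁, hq₂])
    rw [Finset.sum_pair hne, hm₁, hm₂] at this
    omega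
  · left
    refine ⟨D₁, ?_, D₂, ?_, hD⟩
    · have := single_le_properConchoid hex₁ (s := {q₁}) (by simpa using hq₁)
      rw [Finset.sum_singleton, hm₁] at this
      rw [Finsupp.mem_support_iff]; omega
    · have := single_le_properConchoid hex₂ (s := {q₂}) (by simpa using hq₂)
      rw [Finset.sum_singleton, hm₂] at this
      rw [Finsupp.mem_support_iff]; omega

end Dichotomy

end

end Conchoid

/-! ### The theorem. -/

theorem mainTheorem4 {k : Type*} [Field k] [IsAlgClosed k] (p : ℕ) [CharP k p]
    -- the conic `B : F = 0` with center `A`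
    (F : MvPolynomial (Fin 3) k) (hF : Conchoid.IsCenteredConic F)
    -- its points at infinity and the equations of the lines joining them to `A`
    (P₁ P₂ : Conchoid.Plane k) (hP : Conchoid.pointsAtInfinity F = {P₁, P₂})
    (ℓ₁ ℓ₂ : MvPolynomial (Fin 3) k)
    (hℓ₁ : Conchoid.IsLineThroughOriginAnd ℓ₁ P₁) (hℓ₂ : Conchoid.IsLineThroughOriginAnd ℓ₂ P₂)
    -- the reduced irreducible curve `C : G = 0` of degree `δ`
    (δ : ℕ) (G : MvPolynomial (Fin 3) k) (hG : G.IsHomogeneous δ) (hGirr : Irreducible G)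
    -- the characteristic is zero or larger than the degrees of `B` and `C`
    (hp : p = 0 ∨ (2 < p ∧ δ < p))
    -- `C` is neither `B` nor its image under the homothety of center `A` and ratio `2`
    (hGB : ¬ Associated G F) (hGB₂ : ¬ Associated G (Conchoid.double F)) :
    (¬ Associated G ℓ₁ → ¬ Associated G ℓ₂ → ¬ Associated G (MvPolynomial.X 2) →
      ((Conchoid.properConchoid F G).IsReducible ↔
        ∃ H₁ H₂ : MvPolynomial (Fin 3) k,
          (∃ m, H₁.IsHomogeneous m) ∧ (∃ n, H₂.IsHomogeneous n) ∧
          ((Even δ ∧ G = H₁ ^ 2 - ℓ₁ * ℓ₂ * H₂ ^ 2) ∨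
           (Odd δ ∧ G = ℓ₁ * H₁ ^ 2 - ℓ₂ * H₂ ^ 2)))) ∧
    (¬ (δ = 1 ∧ MvPolynomial.eval (Conchoid.origin k) G = 0) →
      ((Conchoid.properConchoid F G).HasTwoComponents ↔
        ∃ H₁ H₂ : MvPolynomial (Fin 3) k,
          (∃ m, H₁.IsHomogeneous m) ∧ (∃ n, H₂.IsHomogeneous n) ∧
          ((Even δ ∧ G = H₁ ^ 2 - ℓ₁ * ℓ₂ * H₂ ^ 2) ∨
           (Odd δ ∧ G = ℓ₁ * H₁ ^ 2 - ℓ₂ * H₂ ^ 2)))) := by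
  open MvPolynomial Conchoid in
  have h2 : (2 : k) ≠ 0 := by
    rcases hp with rfl | ⟨hp, -⟩
    · have := CharP.charP_to_charZero k
      exact two_ne_zero
    · intro h
      have := (CharP.cast_eq_zero_iff k p 2).1 (by exact_mod_cast h)
      exact absurd (Nat.le_of_dvd two_pos this) (by omega)
  obtain ⟨A, d, c₁, c₂, hd, hc₁, hc₂, rfl, rfl, rfl⟩ := hF.exists_axes h2 hP hℓ₁ hℓ₂
  have hex := isExceptional_iff hc₁ hc₂ hP hℓ₁ hℓ₂
  have hCu : ∀ c : k, c ≠ 0 → IsUnit (C c : PlaneRing k) := fun c hc => (IsUnit.mk0 c hc).map _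
  have hui := irreducible_of_isHomogeneous_one A.uPoly_isHomogeneous A.uPoly_ne_zero
  have hvi := irreducible_of_isHomogeneous_one A.vPoly_isHomogeneous A.vPoly_ne_zero
  have hXi : Irreducible (X 2 : PlaneRing k) :=
    irreducible_of_isHomogeneous_one (isHomogeneous_X k (2 : Fin 3)) (X_ne_zero _)
  have hass : ∀ (f : PlaneRing k) (c : k), c ≠ 0 → Associated f (C c * f) := fun f c hc =>
    (associated_unit_mul_right f _ (hCu c hc))
  have h4 : (4 : k) ≠ 0 := by
    rw [show (4 : k) = 2 * 2 by norm_num]; exact mul_ne_zero h2 h2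
  have hF1 : ¬ G ∣ X 2 ^ 2 - C 1 * A.normPoly := fun h => by
    have := A.associated_of_dvd_conic hG hGirr one_ne_zero h
    rw [C_1, one_mul] at this
    exact hGB (this.trans (hass _ d hd))
  have hF2 : ¬ G ∣ X 2 ^ 2 - C 4⁻¹ * A.normPoly := fun h => by
    refine hGB₂ ((A.associated_of_dvd_conic hG hGirr (inv_ne_zero h4) h).trans ?_)
    have e : double (A.conic d) = C (d * 4) * (X 2 ^ 2 - C 4⁻¹ * A.normPoly) := by
      have e4 : (C 4 : PlaneRing k) * C 4⁻¹ = 1 := by rw [← C_mul, mul_inv_cancel₀ h4, C_1]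
      have e2 : (C 4 : PlaneRing k) = C 2 ^ 2 := by rw [← C_pow]; norm_num
      rw [double, Axes.conic, map_mul, map_sub, A.aeval_normPoly, map_pow, aeval_X, C_mul]
      simp only [Matrix.cons_val_zero, Matrix.cons_val_one, Matrix.cons_val, aeval_C, algebraMap_eq]
      rw [← Axes.normPoly]
      linear_combination C d * A.normPoly * e4 - C d * X 2 ^ 2 * e2
    rw [e]
    exact hass _ _ (mul_ne_zero hd h4)
  have key : ¬ Associated G (C c₁ * A.uPoly) → ¬ Associated G (C c₂ * A.vPoly) →
      ¬ Associated G (X 2) → ((properConchoid (A.conic d) G).IsReducible ↔ HasRoot A G) ∧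
        (¬ (δ = 1 ∧ eval (origin k) G = 0) →
          ((properConchoid (A.conic d) G).HasTwoComponents ↔ HasRoot A G)) := by
    intro h₁ h₂ h₃
    have hud : ¬ G ∣ A.uPoly := fun h => h₁ ((hGirr.associated_of_dvd hui h).trans (hass _ _ hc₁))
    have hvd : ¬ G ∣ A.vPoly := fun h => h₂ ((hGirr.associated_of_dvd hvi h).trans (hass _ _ hc₂))
    have hzd : ¬ G ∣ X 2 := fun h => h₃ (hGirr.associated_of_dvd hXi h)
    have hsplit := exists_two_components h2 hp hd hG hGirr hzd hud hvd hF1 hF2 hex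
    have hred : (properConchoid (A.conic d) G).IsReducible → HasRoot A G := by
      intro h
      by_contra hroot
      obtain ⟨h1, h2⟩ := properConchoid_of_not_hasRoot h2 hp hd hG hGirr hzd hex hroot
      obtain ⟨D, hD⟩ := Cycle.eq_of_isReducible h h1
      have := h2 D
      omega
    refine ⟨⟨hred, fun h => ?_⟩, fun hl => ⟨fun h => hred (Cycle.isReducible_of_hasTwoComponents h),
      fun h => (hsplit h).resolve_right fun h' => hl h'.2⟩⟩
    rcases hsplit h with h | h
    · exact Cycle.isReducible_of_hasTwoComponents h
    · exact h.1
  have hiff := fun (h₁ : ¬ Associated G (C c₁ * A.uPoly)) (h₂ : ¬ Associated G (C c₂ * A.vPoly)) =>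
    hasRoot_iff (A := A) h2 hG hGirr
    (fun h => h₁ (h.trans (hass _ _ hc₁))) (fun h => h₂ (h.trans (hass _ _ hc₂))) hc₁ hc₂
  refine ⟨fun h₁ h₂ h₃ => (key h₁ h₂ h₃).1.trans (hiff h₁ h₂), fun hl => ?_⟩
  have hline : ∀ ℓ : PlaneRing k, ℓ.IsHomogeneous 1 → eval (origin k) ℓ = 0 → ℓ ≠ 0 →
      ¬ Associated G ℓ := by
    intro ℓ hℓ hA h0 h
    have := degree_eq_one_of_associated hG hℓ h0 h
    exact hl ⟨this.1, (this.2 _).2 hA⟩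
  have h₁ := hline _ hℓ₁.2.1 hℓ₁.2.2.1 hℓ₁.1
  have h₂ := hline _ hℓ₂.2.1 hℓ₂.2.2.1 hℓ₂.1
  -- For C = L∞ the proper conchoid has no component other than L∞, and (*) fails: δ = 1 is odd, and
  -- ℓ₁, ℓ₂ vanish at A while z does not.
  by_cases h₃ : Associated G (X 2)
  · have hδ := degree_eq_one_of_associated hG (isHomogeneous_X k (2 : Fin 3)) (X_ne_zero _) h₃
    refine iff_of_false ?_ ?_
    · rintro ⟨D, hD, D', hD', hne⟩
      rw [Finsupp.mem_support_iff] at hD hD'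
      obtain ⟨hD, q, hq⟩ := exists_of_properConchoid_ne_zero hD
      obtain ⟨hD', q', hq'⟩ := exists_of_properConchoid_ne_zero hD'
      rw [hex] at hD hD'
      exact hne (PrimeCurve.eq_of_mem hXi (X_two_mem_of_mem_componentsOver hd h₃.dvd hq hD)
        (X_two_mem_of_mem_componentsOver hd h₃.dvd hq' hD'))
    · rintro ⟨H₁, H₂, -, -, ⟨h, -⟩ | ⟨-, h⟩⟩
      · rw [hδ.1] at h
        exact absurd h (by decide)
      · have h0 := congrArg (eval (origin k)) h
        rw [map_sub, map_mul, map_mul _ (C c₂ * A.vPoly), hℓ₁.2.2.1, hℓ₂.2.2.1, zero_mul, zero_mul,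
          sub_zero, hδ.2] at h0
        simp [origin] at h0
  · exact ((key h₁ h₂ h₃).2 hl).trans (hiff h₁ h₂)
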